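/- **Setting.** Let $A=(x_1,\dots,x_n)$ be an array over a linearly ordered set, representing a multiset of size $n$. A decomposition of $A$ into $\rho$ runs cuts $A$ into $\rho$ consecutive nonempty nondecreasing subarrays; it is the decomposition into *maximal* runs if moreover the last entry of each run is larger than the first entry of the next one. Given a decomposition into runs, partition the sorted list of distinct values of $A$ into members as follows: each value which occurs in at least two runs is a member by itself; the other members are the maximal intervals of consecutive values which all occur in one and the same single run. Let $\chi$ be the number of members, and let the value $m_i$ of the $i$-th member be the number of runs that contain elements of it (so $m_i=1$ if the member is an interval of a single run, and $m_i$ is the number of runs that contain the value otherwise). In each run that meets a member, the elements whose value is in this member form a block. Let $g_1,\dots,g_\delta$ be the sizes of all the blocks, where both blocks and members are listed in the order of the sorted output (blocks of the same member in the order of their runs). Put $$B(n,\rho,g,m)=n+\sum_{i=1}^{\delta}\log_2 g_i+\sum_{i=1}^{\chi}\log_2\binom{\rho}{m_i}.$$ *Quick Synergy Sort* is the following algorithm. Detect the maximal runs of $A$ by a linear scan. Then recursively: compute the median $\mu$ of the middle elements of the (nonempty) runs by a selection algorithm that uses a linear number of comparisons; split every run, except the run $R$ that contains $\mu$, by the value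 of $\mu$, by doubling searches starting at both ends of the run in parallel; find the maximum $\max_\ell$ of the elements smaller than $\mu$ and the minimum $\min_r$ of the elements larger than $\mu$ in the runs other than $R$; locate $\max_\ell$ and $\min_r$ in $R$ by doubling searches starting at the position of $\mu$; recurse on the elements that are at most $\max_\ell$ and on the elements that are at least $\min_r$. Cost is the number of data comparisons, each with the three outcomes $<,=,>$. **Theorem.** 1. Quick Synergy Sort sorts every array. There is an absolute constant $C$ such that on every array of size $n$, and for every decomposition of it into $\rho$ runs (in particular the one into its maximal runs), with block sizes $g_1,\dots,g_\delta$ and partition values $m_1,\dots,m_\chi$, it performs at most $C\cdot B(n,\rho,g,m)$ data comparisons. 2. This is optimal in the worst case over the arrays with these parameters: there is an absolute constant $c>0$ such that, for all $n\ge 2$, $\rho$, $g=(g_1,\dots,g_\delta)$, $m=(m_1,\dots,m_\chi)$ for which there is an array of size $n$ with a decomposition into runs with the parameters $\rho,g,m$, every comparison-based algorithm that sorts all arrays of size $n$ performs at least $c\cdot B(n,\rho,g,m)$ data comparisons on some array of size $n$ that has a decomposition into runs with the parameters $\rho,g,m$. 3. If $\delta\ge 2\rho$, it is also optimal over the arrays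 whose decomposition into *maximal* runs has these parameters: part 2 holds, with an absolute constant $c>0$, with "decomposition into maximal runs" in place of "decomposition into runs", for all parameters with $\delta\ge2\rho$. -/

import Mathlib

/-! ### Comparison-based algorithms -/

/-- A comparison-based algorithm (ternary decision tree) on an array with positions `Fin n`,
returning a value in `β`: it either stops with an answer, or compares the entries at positions
`i` and `j` and continues according to the outcome (`lt`, `eq` or `gt`). -/
inductive Comp (n : ℕ) (β : Type) : Type where
  | ret (b : β) : Comp n β
  | query (i j : Fin n) (next : Ordering → Comp n β) : Comp n β

namespace Comp

variable {n : ℕ} {β γ : Type}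

/-- Run the first algorithm, then continue with its answer. -/
def bind : Comp n β → (β → Comp n γ) → Comp n γ
  | ret b, f => f b
  | query i j next, f => query i j (fun o => bind (next o) f)

instance : Monad (Comp n) where
  pure := ret
  bind := bind

/-- The answer on the array `a`. -/
def eval {α : Type*} [LinearOrder α] (a : Fin n → α) : Comp n β → β
  | ret b => b
  | query i j next => eval a (next (compare (a i) (a j)))

/-- The number of data comparisons performed on the array `a`. -/
def cost {α : Type*} [LinearOrder α] (a : Fin n → α) : Comp n β → ℕ
  | ret _ => 0
  | query i j next => cost a (next (compare (a i) (a j))) + 1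

/-- The algorithm sorts every array with `n` entries in `α`: it returns all the positions, each
exactly once, in an order along which the entries are nondecreasing. -/
def Sorts (T : Comp n (List (Fin n))) (α : Type*) [LinearOrder α] : Prop :=
  ∀ a : Fin n → α, (T.eval a).Perm (List.finRange n) ∧ ((T.eval a).map a).Pairwise (· ≤ ·)

/-- One data comparison. -/
def compareAt (i j : Fin n) : Comp n Ordering := query i j ret

end Comp

/-! ### Quick Synergy Sort

Lists of positions stand for sequences of elements of the input array. The arguments called
`fuel` only bound the depth of a recursion; the initial values are large enough for the bound
never to be reached. -/

namespace QuickSynergy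

variable {n : ℕ}

/-- Linear scan for the runs: a run ends where an entry is larger than the next one. -/
def detectRuns : List (Fin n) → Comp n (List (List (Fin n)))
  | [] => pure []
  | [i] => pure [[i]]
  | i :: j :: t => do
      let o ← Comp.compareAt i j
      let rs ← detectRuns (j :: t)
      match o, rs with
      | Ordering.gt, rs => pure ([i] :: rs)
      | _, r :: rs => pure ((i :: r) :: rs)
      | _, [] => pure [[i]]

/-! #### Selection in a linear number of comparisons (groups of five) -/

def insertSorted (x : Fin n) : List (Fin n) → Comp n (List (Fin n))
  | [] => pure [x]
  | y :: t => do
      let o ← Comp.compareAt x y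
      if o = Ordering.gt then do
        let s ← insertSorted x t
        pure (y :: s)
      else pure (x :: y :: t)

def insertionSort : List (Fin n) → Comp n (List (Fin n))
  | [] => pure []
  | x :: t => do
      let s ← insertionSort t
      insertSorted x s

def groupsOfFive : List (Fin n) → List (List (Fin n))
  | x₁ :: x₂ :: x₃ :: x₄ :: x₅ :: t => [x₁, x₂, x₃, x₄, x₅] :: groupsOfFive t
  | [] => []
  | l => [l]

def groupMedians : List (List (Fin n)) → Comp n (List (Fin n))
  | [] => pure []
  | l :: ls => do
      let s ← insertionSort l
      let ms ← groupMedians ls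
      pure ((s[s.length / 2]?).toList ++ ms)

/-- The elements smaller than, equal to, and larger than the element at position `p`. -/
def partition3 (p : Fin n) :
    List (Fin n) → Comp n (List (Fin n) × List (Fin n) × List (Fin n))
  | [] => pure ([], [], [])
  | x :: t => do
      let o ← Comp.compareAt x p
      let s ← partition3 p t
      match o with
      | Ordering.lt => pure (x :: s.1, s.2.1, s.2.2)
      | Ordering.eq => pure (s.1, x :: s.2.1, s.2.2)
      | Ordering.gt => pure (s.1, s.2.1, x :: s.2.2)

/-- The element of rank `k` (from `0`) of the list `l`; `d` is a default answer. -/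
def select (d : Fin n) : (fuel : ℕ) → (l : List (Fin n)) → (k : ℕ) → Comp n (Fin n)
  | 0, _, _ => pure d
  | fuel + 1, l, k =>
      if l.length ≤ 5 then do
        let s ← insertionSort l
        pure (s.getD k d)
      else do
        let ms ← groupMedians (groupsOfFive l)
        let p ← select d fuel ms (ms.length / 2)
        let s ← partition3 p l
        if k < s.1.length then select d fuel s.1 k
        else if k < s.1.length + s.2.1.length then pure p
        else select d fuel s.2.2 (k - (s.1.length + s.2.1.length))

/-! #### Doubling searches

`test` is a test that succeeds exactly on an initial segment of the list `r`; each search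
returns the length of this initial segment. -/

/-- Binary search, the answer being known to lie between `lo` and `hi`. -/
def binarySearch (test : Fin n → Comp n Bool) (r : List (Fin n)) :
    (fuel lo hi : ℕ) → Comp n ℕ
  | 0, lo, _ => pure lo
  | fuel + 1, lo, hi =>
      if lo < hi then
        match r[(lo + hi) / 2]? with
        | none => pure lo
        | some x => do
            let b ← test x
            if b then binarySearch test r fuel ((lo + hi) / 2 + 1) hi
            else binarySearch test r fuel lo ((lo + hi) / 2)
      else pure lo

/-- Doubling search from the left end; `w` is the current step width. -/
def doublingFrom (test : Fin n → Comp n Bool) (r : List (Fin n)) :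
    (fuel w lo : ℕ) → Comp n ℕ
  | 0, _, lo => pure lo
  | fuel + 1, w, lo =>
      match r[lo + w - 1]? with
      | none => binarySearch test r r.length lo r.length
      | some x => do
          let b ← test x
          if b then doublingFrom test r fuel (2 * w) (lo + w)
          else binarySearch test r r.length lo (lo + w - 1)

def doublingSearch (test : Fin n → Comp n Bool) (r : List (Fin n)) : Comp n ℕ :=
  doublingFrom test r (r.length + 1) 1 0

/-- Doubling searches from both ends in parallel: they alternate, until one of them has
enclosed the answer (which then is found by binary search) or they meet. -/
def doublingBothFrom (test : Fin n → Comp n Bool) (r : List (Fin n)) :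
    (fuel w lo hi : ℕ) → Comp n ℕ
  | 0, _, lo, _ => pure lo
  | fuel + 1, w, lo, hi =>
      if lo + 2 * w ≤ hi then
        match r[lo + w - 1]?, r[hi - w]? with
        | some x, some y => do
            let b ← test x
            if b then do
              let b' ← test y
              if b' then binarySearch test r r.length (hi - w + 1) hi
              else doublingBothFrom test r fuel (2 * w) (lo + w) (hi - w)
            else binarySearch test r r.length lo (lo + w - 1)
        | _, _ => pure lo
      else binarySearch test r r.length lo hi

def doublingSearchBothEnds (test : Fin n → Comp n Bool) (r : List (Fin n)) : Comp n ℕ :=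
  doublingBothFrom test r (r.length + 1) 1 0 r.length

/-- Test whether comparing an element with the one at position `p` has outcome `o`. -/
def outcomeIs (o : Ordering) (p x : Fin n) : Comp n Bool := do
  let o' ← Comp.compareAt x p
  pure (decide (o' = o))

/-- Split a run by the value of the element at position `p`, into the parts that are smaller
than, equal to, and larger than this value. -/
def splitRun (p : Fin n) (r : List (Fin n)) :
    Comp n (List (Fin n) × List (Fin n) × List (Fin n)) := do
  let k ← doublingSearchBothEnds (outcomeIs Ordering.lt p) r
  let e ← doublingSearch (outcomeIs Ordering.eq p) (r.drop k)
  pure (r.take k, (r.drop k).take e, (r.drop k).drop e)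

def splitRuns (p : Fin n) :
    List (List (Fin n)) → Comp n (List (List (Fin n) × List (Fin n) × List (Fin n)))
  | [] => pure []
  | r :: rs => do
      let s ← splitRun p r
      let ss ← splitRuns p rs
      pure (s :: ss)

/-- An extreme element of a list by a linear scan: the maximum for `o = gt`, the minimum for
`o = lt`; `none` for the empty list. -/
def extremum (o : Ordering) : List (Fin n) → Comp n (Option (Fin n))
  | [] => pure none
  | x :: t => do
      match ← extremum o t with
      | none => pure (some x)
      | some y => do
          let o' ← Comp.compareAt x y
          pure (some (if o' = o then x else y))

/-- The recursive part of Quick Synergy Sort, on the list of the (nonempty) runs. -/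
def sortRuns : (fuel : ℕ) → (runs : List (List (Fin n))) → Comp n (List (Fin n))
  | 0, _ => pure []
  | fuel + 1, runs =>
      match runs.filterMap (fun r => r[r.length / 2]?) with
      | [] => pure []
      | d :: ds => do
          -- the median `μ` of the middles
          let μ ← select d (ds.length + 1) (d :: ds) (ds.length / 2)
          -- the run that contains (the position of) `μ`, before and after it; the other runs
          let own := (runs.filter (fun r => μ ∈ r)).flatten
          let before := own.takeWhile (fun x => x ≠ μ)
          let after := own.drop (before.length + 1)
          let parts ← splitRuns μ (runs.filter (fun r => μ ∉ r))
          -- largest element below `μ`, and smallest element above `μ`, in the other runs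
          let maxL ← extremum Ordering.gt (parts.filterMap (fun s => s.1.getLast?))
          let minR ← extremum Ordering.lt (parts.filterMap (fun s => s.2.2.head?))
          -- searches in the run of `μ`, starting at the position of `μ`
          let kL ← match maxL with
            | none => pure before.length
            | some x => doublingSearch (outcomeIs Ordering.gt x) before.reverse
          let kR ← match minR with
            | none => pure after.length
            | some x => doublingSearch (outcomeIs Ordering.lt x) after
          let c := before.length - kL
          let left ← sortRuns fuel
            ((before.take c :: parts.map (fun s => s.1)).filter (fun r => r ≠ []))
          let right ← sortRuns fuel
            ((after.drop kR :: parts.map (fun s => s.2.2)).filter (fun r => r ≠ []))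
          pure (left ++ before.drop c ++ [μ] ++ (parts.map (fun s => s.2.1)).flatten
            ++ after.take kR ++ right)

end QuickSynergy

/-- Quick Synergy Sort on arrays with `n` entries. -/
def quickSynergySort (n : ℕ) : Comp n (List (Fin n)) := do
  let runs ← QuickSynergy.detectRuns (List.finRange n)
  QuickSynergy.sortRuns n runs

/-! ### Runs, blocks, and the partition of the output -/

section Parameters

variable {α : Type*} [LinearOrder α]

/-- `L` cuts the array `a` into consecutive nonempty nondecreasing pieces. -/
def IsRunDecomposition {n : ℕ} (a : Fin n → α) (L : List (List α)) : Prop :=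
  L.flatten = List.ofFn a ∧ ∀ r ∈ L, r ≠ [] ∧ r.Pairwise (· ≤ ·)

/-- `L` lists the maximal nondecreasing pieces of the array `a`: moreover, the last entry of each
piece is larger than the first entry of the next one. -/
def IsMaximalRunDecomposition {n : ℕ} (a : Fin n → α) (L : List (List α)) : Prop :=
  IsRunDecomposition a L ∧
    L.IsChain (fun r s => ∀ x ∈ r.getLast?, ∀ y ∈ s.head?, y < x)

/-- The runs in which the value `v` occurs. -/
def holders (L : List (List α)) (v : α) : Finset (Fin L.length) :=
  Finset.univ.filter (fun j => v ∈ L.get j)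

/-- The partition of the output, in increasing order; each member is the list of its distinct
values. Neighbouring values belong to the same member if and only if both occur in one and the
same single run. So a value which occurs in several runs forms a member by itself, and every other
member is a maximal interval of values that occur in one run only. -/
def outputPartition (L : List (List α)) : List (List α) :=
  (L.flatten.toFinset.sort (· ≤ ·)).splitBy
    (fun u v => decide (holders L u = holders L v ∧ (holders L u).card = 1))

/-- The value `m` of a member of the partition: the number of runs that meet it. -/
def memberValue (L : List (List α)) (V : List α) : ℕ :=
  L.countP (fun r => r.any (fun x => decide (x ∈ V)))

/-- The sizes of the blocks that form a member of the partition: in each run that meets the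
member, the elements with a value in this member form one block. -/
def memberBlocks (L : List (List α)) (V : List α) : List ℕ :=
  (L.map (fun r => r.countP (fun x => decide (x ∈ V)))).filter (fun k => 0 < k)

/-- The values `m_1, …, m_χ` of the members of the partition, in the order of the output. -/
def partitionValues (L : List (List α)) : List ℕ :=
  (outputPartition L).map (memberValue L)

/-- The sizes `g_1, …, g_δ` of all blocks, in the order of the output. -/
def blockSizes (L : List (List α)) : List ℕ :=
  (outputPartition L).flatMap (memberBlocks L)

/-- The runs `L` have the parameters: `ρ` runs, block sizes `g`, partition values `m`. -/
def HasParameters (L : List (List α)) (ρ : ℕ) (g m : List ℕ) : Prop :=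
  L.length = ρ ∧ blockSizes L = g ∧ partitionValues L = m

end Parameters

/-- `n + ∑ log g_i + ∑ log (ρ choose m_i)`, with logarithms to base 2. -/
noncomputable def synergyBound (n ρ : ℕ) (g m : List ℕ) : ℝ :=
  n + (g.map (fun k => Real.logb 2 k)).sum + (m.map (fun k => Real.logb 2 (ρ.choose k))).sum

/-! The block sizes are positive and add up to `n`, so the sum of their logarithms is at most `n`,
and the bound is of the order of `n` plus the sum of the logarithms of the binomial coefficients.
Both directions are proved for this quantity.

Upper bound. A round on `k` runs costs `O(k)` for the selection and the extrema, and in addition the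
doubling searches (`exists_round`). It is paid for by a potential with three parts. The part `5l - 3
log(l + 1)` of a run of length `l` pays for the searches: cutting a run increases the sum of the
logarithms by about the logarithm of the smaller piece (`logb_split_le`). The part `c(2l - 1)` drops
by at least `c` whenever a run is really cut; so if at least an eighth of the runs are cut, it pays
for the `O(k)`. The last part is the sum of `log(k / t)` over the blocks, where `t` is the number of
runs that meet the member of the block. If fewer runs are cut, then, `μ` being the median of the
middles, each subproblem has at most `5k/8` runs, while both together have at least `7k/8` runs and
hence at least as many blocks; each of these logarithms drops by at least 1/2, which again pays for
the `O(k)` (`blockPotential_drop`, `round_potential`).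

The last part is nonnegative because no recursive call separates a member of the output partition
(`IsNode.left`, `IsNode.right`). This is the purpose of `max_ℓ` and `min_r`: the run of `μ` is not
cut at `μ`, where it could split an interval member, but at the nearest elements of other runs. At
the root, the last part is at most the sum of the `log (ρ choose m)` plus `n`, since `m log(ρ / m) ≤
log (ρ choose m)` (`mul_logb_sub_le`). An arbitrary decomposition refines the one into maximal runs
(`exists_subset_of_isChain`), so counting with maximal runs only makes `k` and `t` smaller, which
costs no more than the extra `n`.

Lower bound. Any sorting algorithm needs `n - 1` comparisons on every array, as otherwise the
compared pairs do not connect the positions (`le_cost_of_sorts`). For the binomial coefficients,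
every member is realised by one value, and the set of runs that contain it is varied. A family of
such arrays with the same multiset of entries has at most `3 ^ h * 2 ^ n` members if all of them are
sorted with at most `h` comparisons (`exists_card_le_pow_cost`). The sets may be chosen almost
freely: a set of size 1 must differ from its predecessor, so that neighbouring members do not merge,
and all runs must be nonempty. These conditions cost only a factor `2 ^ O(n)` (`many_cover`). For
maximal runs, each run must moreover have an element above some element of the next run. If there
are at least `2ρ` blocks, an initial part of the sequence can be made to reach every run that is
needed early, and the rest every run that is needed late, again at the cost of `2 ^ O(ρ)`
(`many_descends`). -/

namespace Comp

/-! ### Results and costs of composed algorithms. -/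

variable {n : ℕ} {β γ : Type} {α : Type*} [LinearOrder α] (a : Fin n → α)

@[simp] theorem eval_pure (b : β) : eval a (pure b : Comp n β) = b := rfl

@[simp] theorem cost_pure (b : β) : cost a (pure b : Comp n β) = 0 := rfl

@[simp] theorem eval_bind (x : Comp n β) (f : β → Comp n γ) :
    eval a (x >>= f) = eval a (f (eval a x)) := by
  change eval a (bind x f) = _
  induction x with
  | ret b => rfl
  | query i j next ih => exact ih _

@[simp] theorem cost_bind (x : Comp n β) (f : β → Comp n γ) :
    cost a (x >>= f) = cost a x + cost a (f (eval a x)) := by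
  change cost a (bind x f) = _
  induction x with
  | ret b => simp [bind, cost, eval]
  | query i j next ih =>
    simp only [bind, cost, eval, ih]
    omega

@[simp] theorem eval_compareAt (i j : Fin n) : eval a (compareAt i j) = compare (a i) (a j) := rfl

@[simp] theorem cost_compareAt (i j : Fin n) : cost a (compareAt i j) = 1 := rfl

end Comp

namespace QuickSynergy

open Comp

/-! ### Thresholds and counting in sorted lists. -/

section Lists

variable {β : Type*}

/-- A predicate that is inherited by earlier entries holds exactly on an initial segment. -/
theorem exists_threshold (P : β → Prop) [DecidablePred P] (r : List β)
    (h : r.Pairwise (fun x y => P y → P x)) :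
    ∃ K ≤ r.length, ∀ i (hi : i < r.length), P r[i] ↔ i < K := by
  induction r with
  | nil => exact ⟨0, le_rfl, by simp⟩
  | cons x t ih =>
    rw [List.pairwise_cons] at h
    obtain ⟨K, hK, hP⟩ := ih h.2
    by_cases hx : P x
    · refine ⟨K + 1, by simpa using hK, fun i hi => ?_⟩
      cases i with
      | zero => simpa using hx
      | succ i => simpa using hP i (by simpa using hi)
    · refine ⟨0, by simp, fun i hi => ?_⟩
      cases i with
      | zero => simpa using hx
      | succ i =>
        simp only [List.getElem_cons_succ, not_lt_zero, iff_false]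
        exact fun hp => hx (h.1 _ (List.getElem_mem _) hp)

theorem countP_gt_of_sorted {α : Type*} [LinearOrder α] (f : β → α) (s : List β)
    (h : s.Pairwise (fun x y => f x ≤ f y)) (v : α) (i : ℕ) (hi : i < s.length) (hv : f s[i] ≤ v) :
    i < s.countP (fun x => f x ≤ v) := by
  have h1 : (s.take (i + 1)).countP (fun x => f x ≤ v) = (s.take (i + 1)).length := by
    rw [List.countP_eq_length]
    intro x hx
    obtain ⟨j, hj, rfl⟩ := List.mem_iff_getElem.1 hx
    simp only [List.length_take, lt_inf_iff] at hj
    simp only [List.getElem_take, decide_eq_true_eq]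
    rcases Nat.lt_or_ge j i with hji | hji
    · exact (List.pairwise_iff_getElem.1 h j i _ _ hji).trans hv
    · have : j = i := by omega
      subst this; exact hv
  have h2 := (List.take_sublist (i + 1) s).countP_le (p := fun x => decide (f x ≤ v))
  rw [h1, List.length_take] at h2
  omega

theorem le_countP_of_sorted {α : Type*} [LinearOrder α] (f : β → α) (s : List β)
    (h : s.Pairwise (fun x y => f x ≤ f y)) (v : α) (i : ℕ) (hi : i < s.length) (hv : v ≤ f s[i]) :
    s.length - i ≤ s.countP (fun x => v ≤ f x) := by
  have h1 : (s.drop i).countP (fun x => v ≤ f x) = (s.drop i).length := by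
    rw [List.countP_eq_length]
    intro x hx
    obtain ⟨j, hj, rfl⟩ := List.mem_iff_getElem.1 hx
    simp only [List.length_drop] at hj
    simp only [List.getElem_drop, decide_eq_true_eq]
    rcases Nat.eq_zero_or_pos j with hji | hji
    · subst hji; exact hv
    · exact hv.trans (List.pairwise_iff_getElem.1 h i (i + j) _ _ (by omega))
  have h2 := (List.drop_sublist i s).countP_le (p := fun x => decide (v ≤ f x))
  rw [h1, List.length_drop] at h2
  exact h2

theorem countP_lt_add_countP_ge {α : Type*} [LinearOrder α] (f : β → α) (s : List β) (v : α) :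
    s.countP (fun x => f x < v) + s.countP (fun x => v ≤ f x) = s.length := by
  rw [List.length_eq_countP_add_countP (p := fun x => decide (f x < v))]
  simp

theorem countP_le_add_countP_gt {α : Type*} [LinearOrder α] (f : β → α) (s : List β) (v : α) :
    s.countP (fun x => f x ≤ v) + s.countP (fun x => v < f x) = s.length := by
  rw [List.length_eq_countP_add_countP (p := fun x => decide (f x ≤ v))]
  simp

end Lists

variable {n : ℕ} {α : Type*} [LinearOrder α] (a : Fin n → α)

/-! ### Selection in linear time by medians of five. -/

theorem insertSorted_spec (x : Fin n) (l : List (Fin n)) :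
    ((insertSorted x l).eval a).Perm (x :: l) ∧
    (l.Pairwise (fun x y => a x ≤ a y) →
      ((insertSorted x l).eval a).Pairwise (fun x y => a x ≤ a y)) ∧
    (insertSorted x l).cost a ≤ l.length := by
  induction l with
  | nil => simp [insertSorted]
  | cons y t ih =>
    obtain ⟨h1, h2, h3⟩ := ih
    rw [insertSorted]
    simp only [eval_bind, eval_compareAt, cost_bind, cost_compareAt, List.length_cons]
    by_cases h : compare (a x) (a y) = Ordering.gt
    · simp only [h, if_true, eval_bind, cost_bind, eval_pure, cost_pure]
      refine ⟨(h1.cons y).trans (List.Perm.swap _ _ _), fun hl => ?_, by omega⟩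
      rw [List.pairwise_cons] at hl ⊢
      refine ⟨fun z hz => ?_, h2 hl.2⟩
      rcases List.mem_cons.1 (h1.subset hz) with rfl | hz
      · exact (compare_gt_iff_gt.1 h).le
      · exact hl.1 z hz
    · simp only [h, if_false, eval_pure, cost_pure]
      refine ⟨List.Perm.refl _, fun hl => ?_, by omega⟩
      have hxy : a x ≤ a y := by
        rw [compare_gt_iff_gt] at h
        exact not_lt.1 h
      rw [List.pairwise_cons]
      refine ⟨fun z hz => ?_, hl⟩
      rcases List.mem_cons.1 hz with rfl | hz
      · exact hxy
      · exact hxy.trans ((List.pairwise_cons.1 hl).1 z hz)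

theorem insertionSort_spec (l : List (Fin n)) :
    ((insertionSort l).eval a).Perm l ∧
    ((insertionSort l).eval a).Pairwise (fun x y => a x ≤ a y) ∧
    (insertionSort l).cost a ≤ l.length * l.length := by
  induction l with
  | nil => simp [insertionSort]
  | cons x t ih =>
    obtain ⟨h1, h2, h3⟩ := ih
    obtain ⟨g1, g2, g3⟩ := insertSorted_spec a x ((insertionSort t).eval a)
    rw [insertionSort]
    simp only [eval_bind, cost_bind, List.length_cons]
    refine ⟨g1.trans (h1.cons x), g2 h2, ?_⟩
    rw [h1.length_eq] at g3
    nlinarith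

theorem partition3_spec (p : Fin n) (l : List (Fin n)) :
    (partition3 p l).eval a = (l.filter (fun x => a x < a p), l.filter (fun x => a x = a p),
      l.filter (fun x => a p < a x)) ∧ (partition3 p l).cost a = l.length := by
  induction l with
  | nil => simp [partition3]
  | cons x t ih =>
    rw [partition3]
    simp only [eval_bind, eval_compareAt, cost_bind, cost_compareAt, List.length_cons, ih.1, ih.2]
    rcases lt_trichotomy (a x) (a p) with h | h | h
    · rw [compare_lt_iff_lt.2 h]
      simp [h, h.ne, h.le]
      omega
    · rw [compare_eq_iff_eq.2 h]
      simp [h]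
      omega
    · rw [compare_gt_iff_gt.2 h]
      simp [h, h.ne', h.le]
      omega

/-- The medians of the groups of five: their number, the cost of computing them, and how well
their ranks control the ranks in the whole list. -/
theorem groupMedians_spec (l : List (Fin n)) :
    (∀ x ∈ (groupMedians (groupsOfFive l)).eval a, x ∈ l) ∧
    5 * ((groupMedians (groupsOfFive l)).eval a).length ≤ l.length + 4 ∧
    l.length ≤ 5 * ((groupMedians (groupsOfFive l)).eval a).length ∧
    (∀ v, 3 * ((groupMedians (groupsOfFive l)).eval a).countP (fun x => a x ≤ v) ≤
      l.countP (fun x => a x ≤ v) + 3) ∧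
    (∀ v, 3 * ((groupMedians (groupsOfFive l)).eval a).countP (fun x => v ≤ a x) ≤
      l.countP (fun x => v ≤ a x) + 3) ∧
    (groupMedians (groupsOfFive l)).cost a ≤ 5 * l.length := by
  -- The median of a full group has three elements of the group on either side, itself included. The
  -- last, incomplete group contributes at most one median, which the additive 3 absorbs.
  have key : ∀ g : List (Fin n), g ≠ [] → ∃ x ∈ g,
      (((insertionSort g).eval a)[((insertionSort g).eval a).length / 2]?).toList = [x] ∧
      (∀ v, a x ≤ v → g.length / 2 < g.countP (fun x => a x ≤ v)) ∧
      (∀ v, v ≤ a x → g.length - g.length / 2 ≤ g.countP (fun x => v ≤ a x)) := by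
    intro g hg
    obtain ⟨h1, h2, h3⟩ := insertionSort_spec a g
    have hpos : 0 < g.length := List.length_pos_iff.2 hg
    have hlt : g.length / 2 < ((insertionSort g).eval a).length := by rw [h1.length_eq]; omega
    refine ⟨((insertionSort g).eval a)[g.length / 2], h1.subset (List.getElem_mem _), ?_, ?_, ?_⟩
    · simp only [h1.length_eq]
      rw [List.getElem?_eq_getElem hlt]
      rfl
    · intro v hv
      have := countP_gt_of_sorted a _ h2 v _ hlt hv
      rwa [h1.countP_eq] at this
    · intro v hv
      have := le_countP_of_sorted a _ h2 v _ hlt hv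
      rwa [h1.countP_eq, h1.length_eq] at this
  have small : ∀ g : List (Fin n), g ≠ [] → g.length < 5 → groupsOfFive g = [g] →
    (∀ x ∈ (groupMedians (groupsOfFive g)).eval a, x ∈ g) ∧
    5 * ((groupMedians (groupsOfFive g)).eval a).length ≤ g.length + 4 ∧
    g.length ≤ 5 * ((groupMedians (groupsOfFive g)).eval a).length ∧
    (∀ v, 3 * ((groupMedians (groupsOfFive g)).eval a).countP (fun x => a x ≤ v) ≤
      g.countP (fun x => a x ≤ v) + 3) ∧
    (∀ v, 3 * ((groupMedians (groupsOfFive g)).eval a).countP (fun x => v ≤ a x) ≤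
      g.countP (fun x => v ≤ a x) + 3) ∧
    (groupMedians (groupsOfFive g)).cost a ≤ 5 * g.length := by
    intro g hg hg5 hgg
    obtain ⟨x, hx, hs, -, -⟩ := key g hg
    have hpos : 0 < g.length := List.length_pos_iff.2 hg
    have hc := (insertionSort_spec a g).2.2
    rw [hgg]
    simp only [groupMedians, eval_bind, cost_bind, eval_pure, cost_pure, hs, List.append_nil]
    refine ⟨by simpa using hx, by simp; omega, by simp; omega, fun v => ?_, fun v => ?_, by nlinarith⟩
    · have := List.countP_le_length (p := fun x => decide (a x ≤ v)) (l := [x])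
      simp only [List.length_singleton] at this
      omega
    · have := List.countP_le_length (p := fun x => decide (v ≤ a x)) (l := [x])
      simp only [List.length_singleton] at this
      omega
  induction l using groupsOfFive.induct with
  | case1 x₁ x₂ x₃ x₄ x₅ t ih =>
    obtain ⟨i1, i2, i3, i4, i5, i6⟩ := ih
    obtain ⟨x, hx, hs, hle, hge⟩ := key [x₁, x₂, x₃, x₄, x₅] (by simp)
    have hc := (insertionSort_spec a [x₁, x₂, x₃, x₄, x₅]).2.2
    simp only [List.length_cons, List.length_nil] at hle hge hc
    have hsplit : x₁ :: x₂ :: x₃ :: x₄ :: x₅ :: t = [x₁, x₂, x₃, x₄, x₅] ++ t := rfl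
    have hlen : (x₁ :: x₂ :: x₃ :: x₄ :: x₅ :: t).length = t.length + 5 := rfl
    rw [groupsOfFive, hlen]
    simp only [groupMedians, eval_bind, cost_bind, eval_pure, cost_pure, hs]
    rw [hsplit]
    simp only [List.countP_append, List.mem_append, List.length_append, List.length_singleton,
      List.mem_singleton]
    refine ⟨?_, by omega, by omega, fun v => ?_, fun v => ?_, by omega⟩
    · rintro y (rfl | hy)
      · exact Or.inl hx
      · exact Or.inr (i1 y hy)
    · have h4 := i4 v
      by_cases hv : a x ≤ v
      · have := hle v hv
        simp only [List.countP_singleton, hv, decide_true, if_true]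
        omega
      · simp only [List.countP_singleton, hv, decide_false, Bool.false_eq_true, if_false]
        omega
    · have h4 := i5 v
      by_cases hv : v ≤ a x
      · have := hge v hv
        simp only [List.countP_singleton, hv, decide_true, if_true]
        omega
      · simp only [List.countP_singleton, hv, decide_false, Bool.false_eq_true, if_false]
        omega
  | case2 => simp [groupsOfFive, groupMedians]
  | case3 l h1 h2 =>
    have hlen : l.length < 5 := by
      match l, h1 with
      | [], _ => simp
      | [_], _ => simp
      | [_, _], _ => simp
      | [_, _, _], _ => simp
      | [_, _, _, _], _ => simp
      | x₁ :: x₂ :: x₃ :: x₄ :: x₅ :: t, h => exact (h _ _ _ _ _ _ rfl).elim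
    refine small l h2 hlen ?_
    match l, h1, h2 with
    | [], _, h => exact (h rfl).elim
    | [_], _, _ => rfl
    | [_, _], _, _ => rfl
    | [_, _, _], _, _ => rfl
    | [_, _, _, _], _, _ => rfl
    | x₁ :: x₂ :: x₃ :: x₄ :: x₅ :: t, h, _ => exact (h _ _ _ _ _ _ rfl).elim

theorem countP_filter_lt (l : List (Fin n)) (v w : α) (h : v ≤ w) :
    (l.filter (fun x => a x < w)).countP (fun x => a x < v) = l.countP (fun x => a x < v) := by
  rw [List.countP_filter]
  refine List.countP_congr fun x _ => ?_
  simp only [Bool.and_eq_true, decide_eq_true_eq, and_iff_left_iff_imp]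
  exact fun hx => hx.trans_le h

/-- `p` has rank `k` in the list `l`. -/
def HasRank (l : List (Fin n)) (k : ℕ) (p : Fin n) : Prop :=
  p ∈ l ∧ l.countP (fun x => a x < a p) ≤ k ∧ k < l.countP (fun x => a x ≤ a p)

theorem hasRank_of_lt {l : List (Fin n)} {k : ℕ} {p q : Fin n}
    (h : HasRank a (l.filter (fun x => a x < a p)) k q) : HasRank a l k q := by
  obtain ⟨h1, h2, h3⟩ := h
  simp only [List.mem_filter, decide_eq_true_eq] at h1
  refine ⟨h1.1, ?_, ?_⟩
  · rwa [countP_filter_lt a l _ _ h1.2.le] at h2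
  · exact h3.trans_le (List.filter_sublist.countP_le)

theorem countP_add_countP_filter_gt (l : List (Fin n)) (p : Fin n) (P : Fin n → Bool)
    (hP : ∀ x, a x ≤ a p → P x = true) :
    l.countP P = (l.filter (fun x => a x < a p)).length + (l.filter (fun x => a x = a p)).length +
      (l.filter (fun x => a p < a x)).countP P := by
  induction l with
  | nil => simp
  | cons x t ih =>
    rcases lt_trichotomy (a x) (a p) with h | h | h
    · simp [h, h.ne, h.le, hP x h.le, ih]
      omega
    · simp [h, hP x h.le, ih]
      omega
    · simp only [List.countP_cons, List.filter_cons, h.not_gt, h.ne', decide_false, h, decide_true,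
        if_true, ih, Bool.false_eq_true, if_false]
      omega

theorem hasRank_of_gt {l : List (Fin n)} {k : ℕ} {p q : Fin n}
    (hk : (l.filter (fun x => a x < a p)).length + (l.filter (fun x => a x = a p)).length ≤ k)
    (h : HasRank a (l.filter (fun x => a p < a x))
      (k - ((l.filter (fun x => a x < a p)).length + (l.filter (fun x => a x = a p)).length)) q) :
    HasRank a l k q := by
  obtain ⟨h1, h2, h3⟩ := h
  simp only [List.mem_filter, decide_eq_true_eq] at h1
  refine ⟨h1.1, ?_, ?_⟩
  · rw [countP_add_countP_filter_gt a l p]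
    · omega
    · intro x hx
      simpa using hx.trans_lt h1.2
  · rw [countP_add_countP_filter_gt a l p]
    · omega
    · intro x hx
      simpa using hx.trans h1.2.le

theorem hasRank_of_eq {l : List (Fin n)} {k : ℕ} {p : Fin n} (hp : p ∈ l)
    (hk : (l.filter (fun x => a x < a p)).length ≤ k)
    (hk' : k < (l.filter (fun x => a x < a p)).length +
      (l.filter (fun x => a x = a p)).length) : HasRank a l k p := by
  refine ⟨hp, ?_, ?_⟩
  · rwa [List.countP_eq_length_filter]
  · rw [countP_add_countP_filter_gt a l p _ (fun x hx => by simpa using hx)]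
    omega

theorem filter_length_add (l : List (Fin n)) (p : Fin n) :
    (l.filter (fun x => a x < a p)).length + (l.filter (fun x => a x = a p)).length +
      (l.filter (fun x => a p < a x)).length = l.length := by
  have := countP_add_countP_filter_gt a l p (fun _ => true) (fun _ _ => rfl)
  simp only [List.countP_true] at this
  omega

theorem one_le_filter_eq {l : List (Fin n)} {p : Fin n} (hp : p ∈ l) :
    1 ≤ (l.filter (fun x => a x = a p)).length :=
  List.length_pos_iff.2 (List.ne_nil_of_mem (List.mem_filter.2 ⟨hp, by simp⟩))

theorem select_hasRank (d : Fin n) : ∀ (fuel : ℕ) (l : List (Fin n)) (k : ℕ), l.length ≤ fuel →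
    k < l.length → HasRank a l k ((select d fuel l k).eval a) := by
  intro fuel
  induction fuel with
  | zero => intro l k hl hk; omega
  | succ fuel ih =>
    intro l k hl hk
    rw [select]
    split_ifs with h5
    · obtain ⟨h1, h2, h3⟩ := insertionSort_spec a l
      have hk' : k < ((insertionSort l).eval a).length := by rwa [h1.length_eq]
      simp only [eval_bind, eval_pure]
      rw [List.getD_eq_getElem _ _ hk']
      refine ⟨h1.subset (List.getElem_mem _), ?_, ?_⟩
      · have := le_countP_of_sorted a _ h2 _ _ hk' le_rfl
        rw [h1.countP_eq, h1.length_eq] at this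
        have h4 := countP_lt_add_countP_ge a l (a ((insertionSort l).eval a)[k])
        omega
      · have := countP_gt_of_sorted a _ h2 _ _ hk' le_rfl
        rwa [h1.countP_eq] at this
    · simp only [eval_bind]
      obtain ⟨g1, g2, g3, g4, g5, g6⟩ := groupMedians_spec a l
      set ms := (groupMedians (groupsOfFive l)).eval a
      have hp := ih ms (ms.length / 2) (by omega) (by omega)
      set p := (select d fuel ms (ms.length / 2)).eval a
      have hpl : p ∈ l := g1 _ hp.1
      have hlen := filter_length_add a l p
      have hone := one_le_filter_eq a hpl
      rw [(partition3_spec a p l).1]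
      split_ifs with hk1 hk2
      · exact hasRank_of_lt a (ih _ _ (by omega) hk1)
      · exact hasRank_of_eq a hpl (not_lt.1 hk1) hk2
      · exact hasRank_of_gt a (not_lt.1 hk2) (ih _ _ (by dsimp only at *; omega) (by dsimp only at *; omega))

/-- Only for short lists: there the additive constants in the rank estimates leave no geometric
decrease. That both recursive calls are on strictly shorter lists suffices for an exponential bound.
-/
theorem select_cost_le_exp (d : Fin n) : ∀ (fuel : ℕ) (l : List (Fin n)) (k : ℕ),
    l.length ≤ fuel → k < l.length → (select d fuel l k).cost a ≤ 6 * 4 ^ l.length := by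
  intro fuel
  induction fuel with
  | zero => intro l k hl hk; omega
  | succ fuel ih =>
    intro l k hl hk
    have hpow : l.length < 4 ^ l.length := Nat.lt_pow_self (by norm_num)
    rw [select]
    split_ifs with h5
    · obtain ⟨h1, h2, h3⟩ := insertionSort_spec a l
      simp only [cost_bind, cost_pure]
      nlinarith
    · simp only [cost_bind]
      obtain ⟨g1, g2, g3, g4, g5, g6⟩ := groupMedians_spec a l
      set ms := (groupMedians (groupsOfFive l)).eval a
      have hp := select_hasRank a d fuel ms (ms.length / 2) (by omega) (by omega)
      have hc := ih ms (ms.length / 2) (by omega) (by omega)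
      set p := (select d fuel ms (ms.length / 2)).eval a
      have hpl : p ∈ l := g1 _ hp.1
      have hlen := filter_length_add a l p
      have hone := one_le_filter_eq a hpl
      have hmono : ∀ m, m + 1 ≤ l.length → 4 * 4 ^ m ≤ 4 ^ l.length := fun m hm => by
        rw [← pow_succ']; exact Nat.pow_le_pow_right (by norm_num) hm
      have hm := hmono ms.length (by omega)
      have hpow' : 2 * l.length ≤ 4 ^ l.length := by
        have h4 : l.length - 1 < 4 ^ (l.length - 1) := Nat.lt_pow_self (by norm_num)
        have := hmono (l.length - 1) (by omega)
        omega
      rw [(partition3_spec a p l).1, (partition3_spec a p l).2]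
      split_ifs with hk1 hk2
      · have := ih (l.filter (fun x => a x < a p)) k (by omega) hk1
        have h6 := hmono _ (show (l.filter (fun x => a x < a p)).length + 1 ≤ l.length by omega)
        dsimp only
        omega
      · simp only [cost_pure]
        omega
      · have := ih (l.filter (fun x => a p < a x)) (k - ((l.filter (fun x => a x < a p)).length +
          (l.filter (fun x => a x = a p)).length)) (by omega) (by dsimp only at *; omega)
        have h6 := hmono _ (show (l.filter (fun x => a p < a x)).length + 1 ≤ l.length by omega)
        dsimp only
        omega

theorem select_cost_le (d : Fin n) : ∀ (fuel : ℕ) (l : List (Fin n)) (k : ℕ),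
    l.length ≤ fuel → k < l.length → (select d fuel l k).cost a ≤ 6 * 4 ^ 60 * l.length := by
  obtain ⟨K, hK⟩ : ∃ K, K = 6 * 4 ^ 60 := ⟨_, rfl⟩
  have hK1 : 1000 ≤ K := by rw [hK]; norm_num
  intro fuel
  induction fuel with
  | zero => intro l k hl hk; omega
  | succ fuel ih =>
    intro l k hl hk
    -- Up to length 60 the exponential bound is a constant, which is the factor of the linear bound.
    by_cases h60 : l.length ≤ 60
    · have h1 := select_cost_le_exp a d (fuel + 1) l k hl hk
      have h2 : 4 ^ l.length ≤ 4 ^ 60 := Nat.pow_le_pow_right (by norm_num) h60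
      nlinarith
    rw [← hK] at ih ⊢
    rw [select, if_neg (by omega)]
    simp only [cost_bind]
    obtain ⟨g1, g2, g3, g4, g5, g6⟩ := groupMedians_spec a l
    set ms := (groupMedians (groupsOfFive l)).eval a
    have hp := select_hasRank a d fuel ms (ms.length / 2) (by omega) (by omega)
    have hc := ih ms (ms.length / 2) (by omega) (by omega)
    set p := (select d fuel ms (ms.length / 2)).eval a
    have hpl : p ∈ l := g1 _ hp.1
    have hlen := filter_length_add a l p
    have hone := one_le_filter_eq a hpl
    have h4 := g4 (a p)
    have h5 := g5 (a p)
    have h6 := countP_lt_add_countP_ge a l (a p)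
    have h7 := countP_le_add_countP_gt a l (a p)
    have h8 := countP_lt_add_countP_ge a ms (a p)
    obtain ⟨-, hr1, hr2⟩ := hp
    rw [List.countP_eq_length_filter] at h6
    rw [List.countP_eq_length_filter (p := fun x => decide (a p < a x))] at h7
    -- There are at most `(len + 4) / 5` medians, and at most 7/10 of the list (plus 3) lies
    -- strictly on one side of the pivot. Together this is 9/10 of the length plus a constant;
    -- beyond length 60 the remaining tenth pays for the constant and for the linear work.
    have final : ∀ m, 10 * m ≤ 7 * l.length + 30 →
        5 * l.length + (K * ms.length + (l.length + K * m)) ≤ K * l.length := by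
      intro m hm
      have : 10 * (ms.length + m) ≤ 9 * l.length + 38 := by omega
      have h9 := Nat.mul_le_mul_left K this
      have h10 : 38 * K + 60 * l.length ≤ K * l.length := by
        obtain ⟨r, hr⟩ := Nat.exists_eq_add_of_lt (not_le.1 h60)
        have h11 : 60 * r ≤ K * r := Nat.mul_le_mul_right r (by omega)
        rw [hr, show K * (60 + r + 1) = 61 * K + K * r by ring]
        omega
      linarith
    rw [(partition3_spec a p l).1, (partition3_spec a p l).2]
    split_ifs with hk1 hk2
    · have h11 := ih (l.filter (fun x => a x < a p)) k (by omega) hk1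
      have := final _ (show 10 * (l.filter (fun x => a x < a p)).length ≤ _ by omega)
      dsimp only
      omega
    · have := final 0 (by omega)
      simp only [cost_pure]
      omega
    · have h11 := ih (l.filter (fun x => a p < a x)) (k - ((l.filter (fun x => a x < a p)).length +
          (l.filter (fun x => a x = a p)).length)) (by omega) (by dsimp only at *; omega)
      have := final _ (show 10 * (l.filter (fun x => a p < a x)).length ≤ _ by omega)
      dsimp only
      omega

end QuickSynergy


/-! ### Doubling searches, the split of a run, extrema, and detection of runs. -/

namespace QuickSynergy

open Comp

variable {n : ℕ} {α : Type*} [LinearOrder α] (a : Fin n → α)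

section Search

variable {test : Fin n → Comp n Bool} {P : Fin n → Prop} [DecidablePred P] {r : List (Fin n)} {K : ℕ}

theorem binarySearch_eval (htest : ∀ x, (test x).eval a = decide (P x))
    (hP : ∀ i (hi : i < r.length), P r[i] ↔ i < K) :
    ∀ fuel lo hi, lo ≤ K → K ≤ hi → hi ≤ r.length → hi - lo ≤ fuel →
      (binarySearch test r fuel lo hi).eval a = K := by
  intro fuel
  induction fuel with
  | zero =>
    intro lo hi h1 h2 h3 h4
    simp only [binarySearch, eval_pure]
    omega
  | succ fuel ih =>
    intro lo hi h1 h2 h3 h4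
    rw [binarySearch]
    split_ifs with h
    · have hm : (lo + hi) / 2 < r.length := by omega
      rw [List.getElem?_eq_getElem hm]
      simp only [eval_bind, htest, hP _ hm, decide_eq_true_eq]
      split_ifs with hK
      · exact ih _ _ (by omega) h2 h3 (by omega)
      · exact ih _ _ h1 (by omega) (by omega) (by omega)
    · simp only [eval_pure]
      omega

theorem binarySearch_cost (hcost : ∀ x, (test x).cost a = 1) :
    ∀ fuel lo hi s, hi - lo < 2 ^ s → (binarySearch test r fuel lo hi).cost a ≤ s := by
  intro fuel
  induction fuel with
  | zero => intro lo hi s _; simp [binarySearch]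
  | succ fuel ih =>
    intro lo hi s hs
    rw [binarySearch]
    split_ifs with h
    · cases s with
      | zero => simp at hs; omega
      | succ s =>
        rw [pow_succ] at hs
        cases hr : r[(lo + hi) / 2]? with
        | none => simp
        | some x =>
          simp only [cost_bind, hcost]
          split_ifs
          · have := ih ((lo + hi) / 2 + 1) hi s (by omega)
            omega
          · have := ih lo ((lo + hi) / 2) s (by omega)
            omega
    · simp

theorem binarySearch_cost_linear (hcost : ∀ x, (test x).cost a = 1) (fuel lo hi : ℕ) :
    (binarySearch test r fuel lo hi).cost a ≤ hi - lo :=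
  binarySearch_cost a hcost fuel lo hi _ (Nat.lt_pow_self (by norm_num))

/-- The invariant `w = lo + 1` says that the next step is as wide as everything already passed. So
the final binary search may be bounded by the width of its interval, and the cost is still linear in
the answer. -/
theorem doublingFrom_spec (htest : ∀ x, (test x).eval a = decide (P x))
    (hcost : ∀ x, (test x).cost a = 1) (hP : ∀ i (hi : i < r.length), P r[i] ↔ i < K)
    (hK : K ≤ r.length) :
    ∀ fuel w lo, w = lo + 1 → lo ≤ K → r.length + 1 ≤ fuel + lo →
      (doublingFrom test r fuel w lo).eval a = K ∧
      (doublingFrom test r fuel w lo).cost a + lo ≤ 2 * K + 1 := by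
  intro fuel
  induction fuel with
  | zero => intro w lo hw h1 h2; omega
  | succ fuel ih =>
    intro w lo hw h1 h2
    rw [doublingFrom]
    rcases Nat.lt_or_ge (lo + w - 1) r.length with h | h
    · rw [List.getElem?_eq_getElem h]
      simp only [eval_bind, cost_bind, htest, hcost, hP _ h, decide_eq_true_eq]
      split_ifs with hlt
      · obtain ⟨h3, h4⟩ := ih (2 * w) (lo + w) (by omega) (by omega) (by omega)
        exact ⟨h3, by omega⟩
      · refine ⟨binarySearch_eval a htest hP _ _ _ h1 (by omega) (by omega) (by omega), ?_⟩
        have := binarySearch_cost_linear a (r := r) hcost r.length lo (lo + w - 1)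
        omega
    · rw [List.getElem?_eq_none h]
      refine ⟨binarySearch_eval a htest hP _ _ _ h1 (by omega) (by omega) (by omega), ?_⟩
      have := binarySearch_cost_linear a (r := r) hcost r.length lo r.length
      simp only
      omega

theorem doublingSearch_spec (htest : ∀ x, (test x).eval a = decide (P x))
    (hcost : ∀ x, (test x).cost a = 1) (hP : ∀ i (hi : i < r.length), P r[i] ↔ i < K)
    (hK : K ≤ r.length) :
    (doublingSearch test r).eval a = K ∧ (doublingSearch test r).cost a ≤ 2 * K + 1 :=
  doublingFrom_spec a htest hcost hP hK _ _ _ (by omega) (by omega) (by omega)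

/-- Round `j` makes at most two tests and is reached only if `2 ^ j - 1` elements at either end have
been ruled out; with `J` the last round, the final binary search takes at most `J + 1` tests. The
term `2 * j` carries the tests of earlier rounds through the induction. -/
theorem doublingBothFrom_spec (htest : ∀ x, (test x).eval a = decide (P x))
    (hcost : ∀ x, (test x).cost a = 1) (hP : ∀ i (hi : i < r.length), P r[i] ↔ i < K) :
    ∀ fuel j lo hi, lo + 1 = 2 ^ j → lo ≤ K → K ≤ hi → hi + lo = r.length → hi - lo < fuel →
      (doublingBothFrom test r fuel (2 ^ j) lo hi).eval a = K ∧
      ∃ J, j ≤ J ∧ 2 ^ J ≤ min K (r.length - K) + 1 ∧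
        (doublingBothFrom test r fuel (2 ^ j) lo hi).cost a + 2 * j ≤ 3 * J + 2 := by
  intro fuel
  induction fuel with
  | zero => intro j lo hi h0 h1 h2 h3 h4; omega
  | succ fuel ih =>
    intro j lo hi h0 h1 h2 h3 h4
    rw [doublingBothFrom]
    split_ifs with h
    · have hlo : lo + 2 ^ j - 1 < r.length := by omega
      have hhi : hi - 2 ^ j < r.length := by omega
      rw [List.getElem?_eq_getElem hlo, List.getElem?_eq_getElem hhi]
      simp only [eval_bind, cost_bind, htest, hcost, hP _ hlo, decide_eq_true_eq]
      split_ifs with hx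
      · simp only [eval_bind, cost_bind, htest, hcost, hP _ hhi, decide_eq_true_eq]
        split_ifs with hy
        · refine ⟨binarySearch_eval a htest hP _ _ _ (by omega) h2 (by omega) (by omega),
            j, le_rfl, by omega, ?_⟩
          have := binarySearch_cost a (r := r) hcost r.length (hi - 2 ^ j + 1) hi j (by omega)
          omega
        · obtain ⟨h5, J, h6, h7, h8⟩ := ih (j + 1) (lo + 2 ^ j) (hi - 2 ^ j)
            (by rw [pow_succ]; omega) (by omega) (by omega) (by omega) (by omega)
          rw [pow_succ'] at h5 h8
          exact ⟨h5, J, by omega, h7, by omega⟩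
      · refine ⟨binarySearch_eval a htest hP _ _ _ h1 (by omega) (by omega) (by omega),
          j, le_rfl, by omega, ?_⟩
        have := binarySearch_cost a (r := r) hcost r.length lo (lo + 2 ^ j - 1) j (by omega)
        omega
    · refine ⟨binarySearch_eval a htest hP _ _ _ h1 h2 (by omega) (by omega), j, le_rfl,
        by omega, ?_⟩
      have := binarySearch_cost a (r := r) hcost r.length lo hi (j + 1) (by rw [pow_succ]; omega)
      omega

theorem doublingSearchBothEnds_spec (htest : ∀ x, (test x).eval a = decide (P x))
    (hcost : ∀ x, (test x).cost a = 1) (hP : ∀ i (hi : i < r.length), P r[i] ↔ i < K)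
    (hK : K ≤ r.length) :
    (doublingSearchBothEnds test r).eval a = K ∧
      (doublingSearchBothEnds test r).cost a ≤ 3 * Nat.log 2 (min K (r.length - K) + 1) + 2 := by
  obtain ⟨h1, J, -, h2, h3⟩ := doublingBothFrom_spec a htest hcost hP (r.length + 1) 0 0 r.length
    (by simp) (by omega) hK (by omega) (by omega)
  rw [doublingSearchBothEnds]
  refine ⟨h1, ?_⟩
  have := Nat.le_log_of_pow_le one_lt_two h2
  simp only [pow_zero] at h3
  omega

end Search

theorem outcomeIs_eval (o : Ordering) (p x : Fin n) :
    (outcomeIs o p x).eval a = decide (compare (a x) (a p) = o) := by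
  simp only [outcomeIs, eval_bind, eval_compareAt, eval_pure]
  exact decide_eq_decide.2 Iff.rfl

theorem outcomeIs_cost (o : Ordering) (p x : Fin n) : (outcomeIs o p x).cost a = 1 := by
  simp [outcomeIs]

/-- The search for the elements equal to the pivot may be linear in their number, because these
elements leave the recursion. -/
theorem splitRun_spec (p : Fin n) (r : List (Fin n)) (hr : r.Pairwise (fun x y => a x ≤ a y)) :
    ∃ l e g, (splitRun p r).eval a = (l, e, g) ∧ l ++ (e ++ g) = r ∧
      (∀ x ∈ l, a x < a p) ∧ (∀ x ∈ e, a x = a p) ∧ (∀ x ∈ g, a p < a x) ∧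
      (splitRun p r).cost a ≤
        3 * Nat.log 2 (min l.length (e.length + g.length) + 1) + 2 * e.length + 3 := by
  obtain ⟨K, hK, hP⟩ := exists_threshold (fun x => compare (a x) (a p) = Ordering.lt) r
    (hr.imp (fun {x y} hxy h => by
      rw [compare_lt_iff_lt] at h ⊢
      exact hxy.trans_lt h))
  obtain ⟨h1, h2⟩ := doublingSearchBothEnds_spec a (outcomeIs_eval a _ p) (outcomeIs_cost a _ p) hP hK
  have hge : ∀ x ∈ r.drop K, a p ≤ a x := by
    intro x hx
    obtain ⟨i, hi, rfl⟩ := List.mem_iff_getElem.1 hx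
    rw [List.length_drop] at hi
    rw [List.getElem_drop]
    have := (hP (K + i) (by omega)).not.2 (by omega)
    rwa [compare_lt_iff_lt, not_lt] at this
  obtain ⟨E, hE, hQ⟩ := exists_threshold (fun x => compare (a x) (a p) = Ordering.eq) (r.drop K)
    ((List.Pairwise.drop (i := K) hr).imp_of_mem (fun {x y} hx hy hxy h => by
      rw [compare_eq_iff_eq] at h ⊢
      exact le_antisymm (hxy.trans h.le) (hge x hx)))
  obtain ⟨g1, g2⟩ := doublingSearch_spec a (outcomeIs_eval a _ p) (outcomeIs_cost a _ p) hQ hE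
  refine ⟨r.take K, (r.drop K).take E, (r.drop K).drop E, ?_, ?_, ?_, ?_, ?_, ?_⟩
  · simp only [splitRun, eval_bind, eval_pure, h1, g1]
  · rw [List.take_append_drop, List.take_append_drop]
  · intro x hx
    obtain ⟨i, hi, rfl⟩ := List.mem_iff_getElem.1 hx
    rw [List.length_take] at hi
    rw [List.getElem_take]
    exact compare_lt_iff_lt.1 ((hP i (by omega)).2 (by omega))
  · intro x hx
    obtain ⟨i, hi, rfl⟩ := List.mem_iff_getElem.1 hx
    rw [List.length_take] at hi
    rw [List.getElem_take]
    exact compare_eq_iff_eq.1 ((hQ i (by omega)).2 (by omega))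
  · intro x hx
    refine lt_of_le_of_ne (hge x (List.drop_subset _ _ hx)) ?_
    obtain ⟨i, hi, rfl⟩ := List.mem_iff_getElem.1 hx
    rw [List.length_drop] at hi
    rw [List.getElem_drop]
    have := (hQ (E + i) (by omega)).not.2 (by omega)
    rw [compare_eq_iff_eq] at this
    exact fun h => this h.symm
  · simp only [splitRun, cost_bind, cost_pure, h1, g1, List.length_take, List.length_drop]
    rw [List.length_drop] at hE
    rw [min_eq_left hK, min_eq_left hE]
    have : E + (r.length - K - E) = r.length - K := by omega
    rw [this]
    omega

/-- The bound for the cost of splitting a run. -/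
def splitCost (s : List (Fin n) × List (Fin n) × List (Fin n)) : ℕ :=
  3 * Nat.log 2 (min s.1.length (s.2.1.length + s.2.2.length) + 1) + 2 * s.2.1.length + 3

theorem splitRuns_spec (p : Fin n) (rs : List (List (Fin n)))
    (hr : ∀ r ∈ rs, r.Pairwise (fun x y => a x ≤ a y)) :
    ((splitRuns p rs).eval a).map (fun s => s.1 ++ (s.2.1 ++ s.2.2)) = rs ∧
      (∀ s ∈ (splitRuns p rs).eval a, (∀ x ∈ s.1, a x < a p) ∧ (∀ x ∈ s.2.1, a x = a p) ∧
        ∀ x ∈ s.2.2, a p < a x) ∧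
      (splitRuns p rs).cost a ≤ (((splitRuns p rs).eval a).map splitCost).sum := by
  induction rs with
  | nil => simp [splitRuns]
  | cons r rs ih =>
    obtain ⟨h1, h2, h3⟩ := ih (fun r hr' => hr r (List.mem_cons_of_mem _ hr'))
    obtain ⟨l, e, g, g1, g2, g3, g4, g5, g6⟩ := splitRun_spec a p r (hr r List.mem_cons_self)
    simp only [splitRuns, eval_bind, eval_pure, cost_bind, cost_pure, g1, List.map_cons, h1, g2,
      List.mem_cons, List.sum_cons, true_and]
    refine ⟨?_, ?_⟩
    · rintro s (rfl | hs)
      · exact ⟨g3, g4, g5⟩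
      · exact h2 s hs
    · simp only [splitCost] at h3 ⊢
      omega

theorem extremum_gt_spec (l : List (Fin n)) :
    (extremum Ordering.gt l).cost a ≤ l.length ∧
    (match (extremum Ordering.gt l).eval a with
      | none => l = []
      | some x => x ∈ l ∧ ∀ y ∈ l, a y ≤ a x) := by
  induction l with
  | nil => simp [extremum]
  | cons x t ih =>
    obtain ⟨h1, h2⟩ := ih
    rw [extremum]
    simp only [eval_bind, cost_bind, List.length_cons]
    cases h : (extremum Ordering.gt t).eval a with
    | none =>
      rw [h] at h2
      simp only at h2
      subst h2
      simp [extremum]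
    | some y =>
      rw [h] at h2
      simp only [eval_bind, eval_compareAt, eval_pure, cost_bind, cost_compareAt, cost_pure]
      refine ⟨by omega, ?_⟩
      by_cases hc : compare (a x) (a y) = Ordering.gt
      · simp only [hc, if_true]
        rw [compare_gt_iff_gt] at hc
        refine ⟨List.mem_cons_self, fun z hz => ?_⟩
        rcases List.mem_cons.1 hz with rfl | hz
        · exact le_rfl
        · exact (h2.2 z hz).trans hc.le
      · simp only [hc, if_false]
        rw [compare_gt_iff_gt, not_lt] at hc
        refine ⟨List.mem_cons_of_mem _ h2.1, fun z hz => ?_⟩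
        rcases List.mem_cons.1 hz with rfl | hz
        · exact hc
        · exact h2.2 z hz

theorem extremum_lt_spec (l : List (Fin n)) :
    (extremum Ordering.lt l).cost a ≤ l.length ∧
    (match (extremum Ordering.lt l).eval a with
      | none => l = []
      | some x => x ∈ l ∧ ∀ y ∈ l, a x ≤ a y) := by
  induction l with
  | nil => simp [extremum]
  | cons x t ih =>
    obtain ⟨h1, h2⟩ := ih
    rw [extremum]
    simp only [eval_bind, cost_bind, List.length_cons]
    cases h : (extremum Ordering.lt t).eval a with
    | none =>
      rw [h] at h2
      simp only at h2
      subst h2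
      simp [extremum]
    | some y =>
      rw [h] at h2
      simp only [eval_bind, eval_compareAt, eval_pure, cost_bind, cost_compareAt, cost_pure]
      refine ⟨by omega, ?_⟩
      by_cases hc : compare (a x) (a y) = Ordering.lt
      · simp only [hc, if_true]
        rw [compare_lt_iff_lt] at hc
        refine ⟨List.mem_cons_self, fun z hz => ?_⟩
        rcases List.mem_cons.1 hz with rfl | hz
        · exact le_rfl
        · exact hc.le.trans (h2.2 z hz)
      · simp only [hc, if_false]
        rw [compare_lt_iff_lt, not_lt] at hc
        refine ⟨List.mem_cons_of_mem _ h2.1, fun z hz => ?_⟩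
        rcases List.mem_cons.1 hz with rfl | hz
        · exact hc
        · exact h2.2 z hz

/-- The linear scan finds the maximal runs. -/
theorem detectRuns_spec (l : List (Fin n)) :
    ((detectRuns l).eval a).flatten = l ∧
    (∀ r ∈ (detectRuns l).eval a, r ≠ [] ∧ r.IsChain (fun x y => a x ≤ a y)) ∧
    ((detectRuns l).eval a).IsChain
      (fun r s => ∀ x ∈ r.getLast?, ∀ y ∈ s.head?, a y < a x) ∧
    (detectRuns l).cost a ≤ l.length := by
  induction l using detectRuns.induct with
  | case1 => simp [detectRuns]
  | case2 i => simp [detectRuns]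
  | case3 i j t ih =>
    rw [detectRuns]
    simp only [eval_bind, cost_bind, eval_compareAt, cost_compareAt]
    obtain ⟨h1, h2, h3, h4⟩ := ih
    generalize hrs : (detectRuns (j :: t)).eval a = rs at *
    match rs, h1, h2, h3 with
    | [], h1, _, _ => simp at h1
    | [] :: rs, _, h2, _ => exact absurd rfl (h2 [] List.mem_cons_self).1
    | (j' :: t') :: rs, h1, h2, h3 =>
      obtain rfl : j' = j := by simpa using congrArg List.head? h1
      by_cases hc : compare (a i) (a j') = Ordering.gt
      · simp only [hc, eval_pure, cost_pure]
        refine ⟨by simpa using h1, ?_, ?_, by simp at h4 ⊢; omega⟩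
        · intro r hr
          rcases List.mem_cons.1 hr with rfl | hr
          · simp
          · exact h2 r hr
        · rw [List.isChain_cons_cons]
          exact ⟨by simpa [compare_gt_iff_gt] using hc, h3⟩
      · have hc' := hc
        rw [compare_gt_iff_gt, not_lt] at hc'
        suffices hs : ((i :: j' :: t') :: rs).flatten = i :: j' :: t ∧
            (∀ r ∈ (i :: j' :: t') :: rs, r ≠ [] ∧ r.IsChain (fun x y => a x ≤ a y)) ∧
            ((i :: j' :: t') :: rs).IsChain
              (fun r s => ∀ x ∈ r.getLast?, ∀ y ∈ s.head?, a y < a x) ∧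
            1 + ((detectRuns (j' :: t)).cost a + 0) ≤ (i :: j' :: t).length by
          generalize compare (a i) (a j') = o at *
          cases o with
          | lt => exact hs
          | eq => exact hs
          | gt => exact absurd rfl hc
        refine ⟨by simpa using h1, ?_, ?_, by simp at h4 ⊢; omega⟩
        · intro r hr
          rcases List.mem_cons.1 hr with rfl | hr
          · exact ⟨by simp, List.isChain_cons_cons.2 ⟨hc', (h2 _ List.mem_cons_self).2⟩⟩
          · exact h2 r (List.mem_cons_of_mem _ hr)
        · cases rs with
          | nil => simp
          | cons s rs =>
            rw [List.isChain_cons_cons] at h3 ⊢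
            exact ⟨by simpa using h3.1, h3.2⟩

end QuickSynergy


/-! ### One round of the recursion. -/

namespace QuickSynergy

open Comp

variable {n : ℕ} {α : Type*} [LinearOrder α] (a : Fin n → α)

/-- The search for `max_ℓ` in the part of its run before `μ`. -/
def leftCut (maxL : Option (Fin n)) (before : List (Fin n)) : Comp n ℕ :=
  match maxL with
  | none => pure before.length
  | some x => doublingSearch (outcomeIs Ordering.gt x) before.reverse

/-- The search for `min_r` in the part of its run after `μ`. -/
def rightCut (minR : Option (Fin n)) (after : List (Fin n)) : Comp n ℕ :=
  match minR with
  | none => pure after.length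
  | some x => doublingSearch (outcomeIs Ordering.lt x) after

/-- The sublists on which the algorithm recurses. -/
def nonemptyParts (r : List (Fin n)) (rs : List (List (Fin n))) : List (List (Fin n)) :=
  (r :: rs).filter (fun r => r ≠ [])

/-- The part of a round that follows the splitting of the runs. -/
def finishRound (fuel : ℕ) (μ : Fin n) (before after : List (Fin n))
    (parts : List (List (Fin n) × List (Fin n) × List (Fin n))) : Comp n (List (Fin n)) := do
  let maxL ← extremum Ordering.gt (parts.filterMap (fun s => s.1.getLast?))
  let minR ← extremum Ordering.lt (parts.filterMap (fun s => s.2.2.head?))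
  let kL ← leftCut maxL before
  let kR ← rightCut minR after
  let left ← sortRuns fuel
    (nonemptyParts (before.take (before.length - kL)) (parts.map (fun s => s.1)))
  let right ← sortRuns fuel (nonemptyParts (after.drop kR) (parts.map (fun s => s.2.2)))
  pure (left ++ before.drop (before.length - kL) ++ [μ] ++ (parts.map (fun s => s.2.1)).flatten
    ++ after.take kR ++ right)

theorem sortRuns_succ (fuel : ℕ) (runs : List (List (Fin n))) (d : Fin n) (ds : List (Fin n))
    (h : runs.filterMap (fun r => r[r.length / 2]?) = d :: ds) :
    sortRuns (fuel + 1) runs = (do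
      let μ ← select d (ds.length + 1) (d :: ds) (ds.length / 2)
      let parts ← splitRuns μ (runs.filter (fun r => μ ∉ r))
      finishRound fuel μ
        ((runs.filter (fun r => μ ∈ r)).flatten.takeWhile (fun x => x ≠ μ))
        ((runs.filter (fun r => μ ∈ r)).flatten.drop
          (((runs.filter (fun r => μ ∈ r)).flatten.takeWhile (fun x => x ≠ μ)).length + 1))
        parts) := by
  rw [sortRuns, h]
  dsimp only
  congr 1
  funext μ
  congr 1
  funext parts
  rw [finishRound]
  congr 1
  funext maxL
  congr 1
  funext minR
  cases maxL <;> cases minR <;> rfl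

/-- The outcome of the searches of a round: `R₁` and `R₄` are the parts of the run of `μ` on which
the algorithm recurses, and `R₂` and `R₃` are the elements between them and `μ`. -/
structure IsRound (runs : List (List (Fin n))) (μ : Fin n) (R₁ R₂ R₃ R₄ : List (Fin n))
    (parts : List (List (Fin n) × List (Fin n) × List (Fin n))) : Prop where
  perm : runs.Perm
    ((R₁ ++ (R₂ ++ μ :: (R₃ ++ R₄))) :: parts.map (fun s => s.1 ++ (s.2.1 ++ s.2.2)))
  split : ∀ s ∈ parts, (∀ x ∈ s.1, a x < a μ) ∧ (∀ x ∈ s.2.1, a x = a μ) ∧ ∀ x ∈ s.2.2, a μ < a x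
  exists_le : ∀ x ∈ R₁, ∃ s ∈ parts, ∃ z ∈ s.1, a x ≤ a z
  lt_of_mem : ∀ x ∈ R₂, ∀ s ∈ parts, ∀ z ∈ s.1, a z < a x
  gt_of_mem : ∀ x ∈ R₃, ∀ s ∈ parts, ∀ z ∈ s.2.2, a x < a z
  exists_ge : ∀ x ∈ R₄, ∃ s ∈ parts, ∃ z ∈ s.2.2, a z ≤ a x
  few_left : 2 * parts.countP (fun s => s.2.1 = [] ∧ s.2.2 = []) ≤ runs.length
  few_right : 2 * parts.countP (fun s => s.1 = [] ∧ s.2.1 = []) ≤ runs.length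

theorem leftCut_spec (maxL : Option (Fin n)) (u : List (Fin n))
    (hu : u.Pairwise (fun x y => a x ≤ a y)) :
    (leftCut maxL u).eval a ≤ u.length ∧
    (leftCut maxL u).cost a ≤ 2 * (leftCut maxL u).eval a + 1 ∧
    (∀ y ∈ u.take (u.length - (leftCut maxL u).eval a), ∃ x ∈ maxL, a y ≤ a x) ∧
    (∀ y ∈ u.drop (u.length - (leftCut maxL u).eval a), ∀ x ∈ maxL, a x < a y) := by
  cases maxL with
  | none => simp [leftCut]
  | some x =>
    obtain ⟨K, hK, hP⟩ := exists_threshold (fun y => compare (a y) (a x) = Ordering.gt) u.reverse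
      (List.pairwise_reverse.2 (hu.imp (fun {y z} hyz h => by
        rw [compare_gt_iff_gt] at h ⊢
        exact h.trans_le hyz)))
    obtain ⟨h1, h2⟩ := doublingSearch_spec a (outcomeIs_eval a _ x) (outcomeIs_cost a _ x) hP hK
    rw [List.length_reverse] at hK
    have hv : (leftCut (some x) u).eval a = K := h1
    rw [hv]
    refine ⟨hK, h2, fun y hy => ⟨x, rfl, ?_⟩, fun y hy z hz => ?_⟩
    · obtain ⟨i, hi, rfl⟩ := List.mem_iff_getElem.1 hy
      rw [List.length_take] at hi
      have := hP (u.length - 1 - i) (by rw [List.length_reverse]; omega)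
      rw [List.getElem_reverse, compare_gt_iff_gt] at this
      rw [List.getElem_take, ← not_lt]
      have h3 : u.length - 1 - (u.length - 1 - i) = i := by omega
      simp only [h3] at this
      exact this.not.2 (by omega)
    · obtain rfl : x = z := by simpa using hz
      obtain ⟨i, hi, rfl⟩ := List.mem_iff_getElem.1 hy
      rw [List.length_drop] at hi
      have := hP (u.length - 1 - (u.length - K + i)) (by rw [List.length_reverse]; omega)
      rw [List.getElem_reverse, compare_gt_iff_gt] at this
      rw [List.getElem_drop]
      have h3 : u.length - 1 - (u.length - 1 - (u.length - K + i)) = u.length - K + i := by omega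
      simp only [h3] at this
      exact this.2 (by omega)

theorem rightCut_spec (minR : Option (Fin n)) (u : List (Fin n))
    (hu : u.Pairwise (fun x y => a x ≤ a y)) :
    (rightCut minR u).eval a ≤ u.length ∧
    (rightCut minR u).cost a ≤ 2 * (rightCut minR u).eval a + 1 ∧
    (∀ y ∈ u.take ((rightCut minR u).eval a), ∀ x ∈ minR, a y < a x) ∧
    (∀ y ∈ u.drop ((rightCut minR u).eval a), ∃ x ∈ minR, a x ≤ a y) := by
  cases minR with
  | none => simp [rightCut]
  | some x =>
    obtain ⟨K, hK, hP⟩ := exists_threshold (fun y => compare (a y) (a x) = Ordering.lt) u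
      (hu.imp (fun {y z} hyz h => by
        rw [compare_lt_iff_lt] at h ⊢
        exact hyz.trans_lt h))
    obtain ⟨h1, h2⟩ := doublingSearch_spec a (outcomeIs_eval a _ x) (outcomeIs_cost a _ x) hP hK
    have hv : (rightCut (some x) u).eval a = K := h1
    rw [hv]
    refine ⟨hK, h2, fun y hy z hz => ?_, fun y hy => ⟨x, rfl, ?_⟩⟩
    · obtain rfl : x = z := by simpa using hz
      obtain ⟨i, hi, rfl⟩ := List.mem_iff_getElem.1 hy
      rw [List.length_take] at hi
      rw [List.getElem_take]
      exact compare_lt_iff_lt.1 ((hP i (by omega)).2 (by omega))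
    · obtain ⟨i, hi, rfl⟩ := List.mem_iff_getElem.1 hy
      rw [List.length_drop] at hi
      rw [List.getElem_drop]
      have := (hP (K + i) (by omega)).not.2 (by omega)
      rwa [compare_lt_iff_lt, not_lt] at this

/-- A run all of whose elements satisfy a predicate also has its middle there. Applied to the two
sides of `μ`, this bounds the number of runs that lie entirely on one side. -/
theorem middles_spec (runs : List (List (Fin n))) (h : ∀ r ∈ runs, r ≠ []) :
    (runs.filterMap (fun r => r[r.length / 2]?)).length = runs.length ∧
    (∀ x ∈ runs.filterMap (fun r => r[r.length / 2]?), ∃ r ∈ runs, x ∈ r) ∧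
    ∀ P : Fin n → Bool, runs.countP (fun r => r.all P) ≤
      (runs.filterMap (fun r => r[r.length / 2]?)).countP P := by
  induction runs with
  | nil => simp
  | cons r rs ih =>
    obtain ⟨h1, h2, h3⟩ := ih (fun r hr => h r (List.mem_cons_of_mem _ hr))
    have hpos : r.length / 2 < r.length := by
      have := List.length_pos_iff.2 (h r List.mem_cons_self)
      omega
    rw [List.filterMap_cons_some (f := fun r : List (Fin n) => r[r.length / 2]?)
      (List.getElem?_eq_getElem hpos)]
    refine ⟨by simpa using h1, ?_, fun P => ?_⟩
    · intro x hx
      rcases List.mem_cons.1 hx with rfl | hx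
      · exact ⟨r, List.mem_cons_self, List.getElem_mem _⟩
      · obtain ⟨s, hs, hxs⟩ := h2 x hx
        exact ⟨s, List.mem_cons_of_mem _ hs, hxs⟩
    · rw [List.countP_cons, List.countP_cons]
      have := h3 P
      split_ifs with h4 h5
      · omega
      · exact absurd (List.all_eq_true.1 h4 _ (List.getElem_mem _)) h5
      · omega
      · omega

theorem length_filterMap_le {β γ : Type*} (f : β → Option γ) (l : List β) :
    (l.filterMap f).length ≤ l.length := List.length_filterMap_le f l

theorem finishRound_spec (fuel : ℕ) (μ : Fin n) (u v : List (Fin n))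
    (parts : List (List (Fin n) × List (Fin n) × List (Fin n)))
    (hu : u.Pairwise (fun x y => a x ≤ a y)) (hv : v.Pairwise (fun x y => a x ≤ a y))
    (hparts : ∀ s ∈ parts, s.1.Pairwise (fun x y => a x ≤ a y) ∧
      s.2.2.Pairwise (fun x y => a x ≤ a y)) :
    ∃ R₁ R₂ R₃ R₄, u = R₁ ++ R₂ ∧ v = R₃ ++ R₄ ∧
      (∀ x ∈ R₁, ∃ s ∈ parts, ∃ z ∈ s.1, a x ≤ a z) ∧
      (∀ x ∈ R₂, ∀ s ∈ parts, ∀ z ∈ s.1, a z < a x) ∧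
      (∀ x ∈ R₃, ∀ s ∈ parts, ∀ z ∈ s.2.2, a x < a z) ∧
      (∀ x ∈ R₄, ∃ s ∈ parts, ∃ z ∈ s.2.2, a z ≤ a x) ∧
      (finishRound fuel μ u v parts).eval a =
        (sortRuns fuel (nonemptyParts R₁ (parts.map (fun s => s.1)))).eval a ++ R₂ ++ [μ] ++
        (parts.map (fun s => s.2.1)).flatten ++ R₃ ++
        (sortRuns fuel (nonemptyParts R₄ (parts.map (fun s => s.2.2)))).eval a ∧
      (finishRound fuel μ u v parts).cost a ≤
        (sortRuns fuel (nonemptyParts R₁ (parts.map (fun s => s.1)))).cost a +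
        (sortRuns fuel (nonemptyParts R₄ (parts.map (fun s => s.2.2)))).cost a +
        2 * parts.length + 2 * (R₂.length + R₃.length) + 2 := by
  obtain ⟨m1, m2⟩ := extremum_gt_spec a (parts.filterMap (fun s => s.1.getLast?))
  obtain ⟨m3, m4⟩ := extremum_lt_spec a (parts.filterMap (fun s => s.2.2.head?))
  have l1 := length_filterMap_le (fun s => s.1.getLast?) parts
  have l2 := length_filterMap_le (fun s => s.2.2.head?) parts
  rw [finishRound]
  simp only [eval_bind, cost_bind, eval_pure, cost_pure]
  set maxL := (extremum Ordering.gt (parts.filterMap (fun s => s.1.getLast?))).eval a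
  set minR := (extremum Ordering.lt (parts.filterMap (fun s => s.2.2.head?))).eval a
  obtain ⟨c1, c2, c3, c4⟩ := leftCut_spec a maxL u hu
  obtain ⟨d1, d2, d3, d4⟩ := rightCut_spec a minR v hv
  have hmax : ∀ x ∈ maxL, ∃ s ∈ parts, x ∈ s.1 := by
    intro x hx
    rw [Option.mem_def] at hx
    rw [hx] at m2
    obtain ⟨s, hs, hxs⟩ := List.mem_filterMap.1 m2.1
    exact ⟨s, hs, List.mem_of_getLast? hxs⟩
  -- The scan looks only at the last elements of the lower parts, which dominate these parts because
  -- the runs are sorted.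
  have hmax' : ∀ s ∈ parts, ∀ z ∈ s.1, ∃ x ∈ maxL, a z ≤ a x := by
    intro s hs z hz
    have hne : s.1 ≠ [] := List.ne_nil_of_mem hz
    have hmem : s.1.getLast hne ∈ parts.filterMap (fun s => s.1.getLast?) :=
      List.mem_filterMap.2 ⟨s, hs, List.getLast?_eq_some_getLast hne⟩
    have hz' : a z ≤ a (s.1.getLast hne) := by
      have hp := (hparts s hs).1
      rw [← List.dropLast_append_getLast hne] at hz hp
      rcases List.mem_append.1 hz with hz | hz
      · exact (List.pairwise_append.1 hp).2.2 z hz _ (List.mem_singleton_self _)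
      · rw [List.mem_singleton.1 hz]
    cases hm : maxL with
    | none => rw [hm] at m2; simp only at m2; rw [m2] at hmem; simp at hmem
    | some x => rw [hm] at m2; exact ⟨x, rfl, hz'.trans (m2.2 _ hmem)⟩
  have hmin : ∀ x ∈ minR, ∃ s ∈ parts, x ∈ s.2.2 := by
    intro x hx
    rw [Option.mem_def] at hx
    rw [hx] at m4
    obtain ⟨s, hs, hxs⟩ := List.mem_filterMap.1 m4.1
    exact ⟨s, hs, List.mem_of_head? hxs⟩
  have hmin' : ∀ s ∈ parts, ∀ z ∈ s.2.2, ∃ x ∈ minR, a x ≤ a z := by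
    intro s hs z hz
    have hne : s.2.2 ≠ [] := List.ne_nil_of_mem hz
    have hmem : s.2.2.head hne ∈ parts.filterMap (fun s => s.2.2.head?) :=
      List.mem_filterMap.2 ⟨s, hs, List.head?_eq_some_head hne⟩
    have hz' : a (s.2.2.head hne) ≤ a z := by
      have hp := (hparts s hs).2
      rw [← List.cons_head_tail hne] at hz hp
      rcases List.mem_cons.1 hz with hz | hz
      · rw [hz]
      · exact (List.pairwise_cons.1 hp).1 z hz
    cases hm : minR with
    | none => rw [hm] at m4; simp only at m4; rw [m4] at hmem; simp at hmem
    | some x => rw [hm] at m4; exact ⟨x, rfl, (m4.2 _ hmem).trans hz'⟩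
  refine ⟨_, _, _, _, (List.take_append_drop _ u).symm, (List.take_append_drop _ v).symm,
    ?_, ?_, ?_, ?_, rfl, ?_⟩
  · intro x hx
    obtain ⟨y, hy, hxy⟩ := c3 x hx
    obtain ⟨s, hs, hys⟩ := hmax y hy
    exact ⟨s, hs, y, hys, hxy⟩
  · intro x hx s hs z hz
    obtain ⟨y, hy, hzy⟩ := hmax' s hs z hz
    exact hzy.trans_lt (c4 x hx y hy)
  · intro x hx s hs z hz
    obtain ⟨y, hy, hzy⟩ := hmin' s hs z hz
    exact (d3 x hx y hy).trans_le hzy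
  · intro x hx
    obtain ⟨y, hy, hxy⟩ := d4 x hx
    obtain ⟨s, hs, hys⟩ := hmin y hy
    exact ⟨s, hs, y, hys, hxy⟩
  · rw [List.length_drop, List.length_take, min_eq_left d1]
    omega

/-- The runs of a subproblem: nonempty sorted lists without common elements. -/
structure IsRuns (runs : List (List (Fin n))) : Prop where
  ne_nil : ∀ r ∈ runs, r ≠ []
  sorted : ∀ r ∈ runs, r.Pairwise (fun x y => a x ≤ a y)
  nodup : runs.flatten.Nodup

theorem sortRuns_nil (fuel : ℕ) : sortRuns fuel ([] : List (List (Fin n))) = pure [] := by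
  cases fuel <;> rfl

/-- This is the interface to the algorithm: correctness and cost are derived from it alone. The 2
added to the selection constant covers the two linear scans and the initial tests in the run of `μ`.
-/
theorem exists_round (fuel : ℕ) (runs : List (List (Fin n))) (h : IsRuns a runs)
    (hne : runs ≠ []) :
    ∃ μ R₁ R₂ R₃ R₄ parts, IsRound a runs μ R₁ R₂ R₃ R₄ parts ∧
      (sortRuns (fuel + 1) runs).eval a =
        (sortRuns fuel (nonemptyParts R₁ (parts.map (fun s => s.1)))).eval a ++ R₂ ++ [μ] ++
        (parts.map (fun s => s.2.1)).flatten ++ R₃ ++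
        (sortRuns fuel (nonemptyParts R₄ (parts.map (fun s => s.2.2)))).eval a ∧
      (sortRuns (fuel + 1) runs).cost a ≤
        (sortRuns fuel (nonemptyParts R₁ (parts.map (fun s => s.1)))).cost a +
        (sortRuns fuel (nonemptyParts R₄ (parts.map (fun s => s.2.2)))).cost a +
        (parts.map splitCost).sum + (6 * 4 ^ 60 + 2) * runs.length +
        2 * (R₂.length + R₃.length) := by
  obtain ⟨K, hK⟩ : ∃ K, K = 6 * 4 ^ 60 := ⟨_, rfl⟩
  obtain ⟨m1, m2, m3⟩ := middles_spec runs h.ne_nil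
  generalize hmids : runs.filterMap (fun r => r[r.length / 2]?) = mids at m1 m2 m3
  match mids, hmids with
  | [], _ => exact absurd (List.length_eq_zero_iff.1 m1.symm) hne
  | d :: ds, hmids =>
    rw [sortRuns_succ fuel runs d ds hmids]
    simp only [eval_bind, cost_bind]
    rw [List.length_cons] at m1
    have hrank := select_hasRank a d (ds.length + 1) (d :: ds) (ds.length / 2) (by simp)
      (by simp; omega)
    have hcost := select_cost_le a d (ds.length + 1) (d :: ds) (ds.length / 2) (by simp)
      (by simp; omega)
    rw [← hK] at hcost ⊢
    generalize (select d (ds.length + 1) (d :: ds) (ds.length / 2)).eval a = μ at hrank ⊢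
    obtain ⟨hμ, hr1, hr2⟩ := hrank
    obtain ⟨R, hR, hμR⟩ := m2 μ hμ
    obtain ⟨s, t, hst⟩ := List.append_of_mem hR
    have hnd := h.nodup
    rw [hst, List.flatten_append, List.flatten_cons, List.nodup_append', List.nodup_append'] at hnd
    -- Positions are not repeated, so exactly one run contains the position `μ`, even if its value
    -- occurs in several runs.
    obtain ⟨-, ⟨hRnd, -, hdis⟩, hdis'⟩ := hnd
    have hs : ∀ r ∈ s, μ ∉ r := fun r hr hμr =>
      hdis' (List.mem_flatten.2 ⟨r, hr, hμr⟩) (List.mem_append_left _ hμR)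
    have ht : ∀ r ∈ t, μ ∉ r := fun r hr hμr =>
      hdis hμR (List.mem_flatten.2 ⟨r, hr, hμr⟩)
    have hf1 : runs.filter (fun r => μ ∈ r) = [R] := by
      rw [hst, List.filter_append, List.filter_cons_of_pos (by simpa using hμR),
        List.filter_eq_nil_iff.2 (by simpa using hs), List.filter_eq_nil_iff.2 (by simpa using ht)]
      rfl
    have hf2 : runs.filter (fun r => μ ∉ r) = s ++ t := by
      rw [hst, List.filter_append, List.filter_cons_of_neg (by simpa using hμR),
        List.filter_eq_self.2 (by simpa using hs), List.filter_eq_self.2 (by simpa using ht)]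
    obtain ⟨u, v, huv⟩ := List.append_of_mem hμR
    have hu : ∀ x ∈ u, x ≠ μ := by
      rintro x hx rfl
      rw [huv, List.nodup_append'] at hRnd
      exact hRnd.2.2 hx List.mem_cons_self
    have htake : R.takeWhile (fun x => x ≠ μ) = u := by
      rw [huv, List.takeWhile_append_of_pos (by simpa using hu)]
      simp
    have hdrop : R.drop (u.length + 1) = v := by
      rw [huv, ← List.drop_drop]
      simp
    have hRs := h.sorted R hR
    rw [huv, List.pairwise_append, List.pairwise_cons] at hRs
    have hsort : ∀ r ∈ s ++ t, r.Pairwise (fun x y => a x ≤ a y) := by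
      intro r hr
      refine h.sorted r ?_
      rw [hst]
      simp only [List.mem_append, List.mem_cons] at hr ⊢
      tauto
    obtain ⟨p1, p2, p3⟩ := splitRuns_spec a μ (s ++ t) hsort
    rw [hf1, hf2, List.flatten_singleton, htake, hdrop]
    set parts := (splitRuns μ (s ++ t)).eval a with hparts
    have hps : ∀ q ∈ parts, q.1.Pairwise (fun x y => a x ≤ a y) ∧
        q.2.2.Pairwise (fun x y => a x ≤ a y) := by
      intro q hq
      have hmem : q.1 ++ (q.2.1 ++ q.2.2) ∈ s ++ t := by
        rw [← p1]
        exact List.mem_map.2 ⟨q, hq, rfl⟩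
      have := hsort _ hmem
      rw [List.pairwise_append, List.pairwise_append] at this
      exact ⟨this.1, this.2.1.2.1⟩
    obtain ⟨R₁, R₂, R₃, R₄, f1, f2, f3, f4, f5, f6, f7, f8⟩ :=
      finishRound_spec a fuel μ u v parts hRs.1 hRs.2.1.2 hps
    have hperm : runs.Perm
        ((R₁ ++ (R₂ ++ μ :: (R₃ ++ R₄))) :: parts.map (fun s => s.1 ++ (s.2.1 ++ s.2.2))) := by
      rw [p1, ← List.append_assoc, ← f1, ← f2, ← huv, hst]
      exact List.perm_middle
    have hplen : parts.length + 1 = runs.length := by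
      have := hperm.length_eq
      simpa using this.symm
    -- Runs lying wholly on one side of `μ` are at most as many as the middles on this side, and `μ`
    -- is the median of the middles.
    have hcount : ∀ (P : Fin n → Bool) (Q : List (Fin n) × List (Fin n) × List (Fin n) → Bool),
        (∀ q ∈ parts, Q q = true → ∀ x ∈ q.1 ++ (q.2.1 ++ q.2.2), P x = true) →
        parts.countP Q ≤ (d :: ds).countP P := by
      intro P Q hPQ
      refine le_trans ?_ (m3 P)
      rw [hperm.countP_eq, List.countP_cons, List.countP_map]
      refine le_trans (List.countP_mono_left fun q hq hQ => ?_) (Nat.le_add_right _ _)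
      simpa only [Function.comp_apply, List.all_eq_true] using hPQ q hq hQ
    refine ⟨μ, R₁, R₂, R₃, R₄, parts, ⟨hperm, p2, f3, f4, f5, f6, ?_, ?_⟩, f7, ?_⟩
    · have := hcount (fun x => a x < a μ) (fun s => s.2.1 = [] ∧ s.2.2 = []) (by
        intro q hq hQ x hx
        simp only [decide_eq_true_eq] at hQ ⊢
        rw [hQ.1, hQ.2] at hx
        exact (p2 q hq).1 x (by simpa using hx))
      omega
    · have := hcount (fun x => a μ < a x) (fun s => s.1 = [] ∧ s.2.1 = []) (by
        intro q hq hQ x hx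
        simp only [decide_eq_true_eq] at hQ ⊢
        rw [hQ.1, hQ.2] at hx
        exact (p2 q hq).2.2 x (by simpa using hx))
      have h9 := countP_le_add_countP_gt a (d :: ds) (a μ)
      rw [List.length_cons] at h9
      omega
    · rw [List.length_cons] at hcost
      rw [← m1] at hplen ⊢
      rw [add_mul]
      omega

end QuickSynergy


/-! ### Correctness of the recursion. -/

namespace QuickSynergy

open Comp

variable {n : ℕ} {α : Type*} [LinearOrder α] {a : Fin n → α}

theorem flatten_nonemptyParts (r : List (Fin n)) (rs : List (List (Fin n))) :
    (nonemptyParts r rs).flatten = r ++ rs.flatten := by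
  rw [nonemptyParts, ← List.flatten_cons]
  generalize r :: rs = l
  induction l with
  | nil => rfl
  | cons x t ih =>
    by_cases hx : x = []
    · rw [List.filter_cons_of_neg (by simpa using hx), ih, hx]; rfl
    · rw [List.filter_cons_of_pos (by simpa using hx), List.flatten_cons, ih]; rfl

theorem flatten_parts_perm (parts : List (List (Fin n) × List (Fin n) × List (Fin n))) :
    ((parts.map (fun s => s.1 ++ (s.2.1 ++ s.2.2))).flatten).Perm
      ((parts.map (fun s => s.1)).flatten ++ ((parts.map (fun s => s.2.1)).flatten ++
        (parts.map (fun s => s.2.2)).flatten)) := by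
  simp only [← List.flatMap_def]
  exact (List.flatMap_append_perm _ _ _).symm.trans
    ((List.flatMap_append_perm _ _ _).symm.append_left _)

variable {runs : List (List (Fin n))} {μ : Fin n} {R₁ R₂ R₃ R₄ : List (Fin n)}
  {parts : List (List (Fin n) × List (Fin n) × List (Fin n))}

namespace IsRound

theorem flatten_perm (h : IsRound a runs μ R₁ R₂ R₃ R₄ parts) :
    runs.flatten.Perm ((nonemptyParts R₁ (parts.map (fun s => s.1))).flatten ++
      ((R₂ ++ [μ] ++ (parts.map (fun s => s.2.1)).flatten ++ R₃) ++
        (nonemptyParts R₄ (parts.map (fun s => s.2.2))).flatten)) := by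
  refine h.perm.flatten.trans ?_
  rw [List.flatten_cons, flatten_nonemptyParts, flatten_nonemptyParts]
  refine ((flatten_parts_perm parts).append_left _).trans ?_
  rw [List.perm_iff_count]
  intro x
  simp only [List.count_append, List.count_cons, List.count_nil]
  omega

theorem mem_runs (h : IsRound a runs μ R₁ R₂ R₃ R₄ parts) {s} (hs : s ∈ parts) :
    s.1 ++ (s.2.1 ++ s.2.2) ∈ runs :=
  h.perm.symm.subset (List.mem_cons_of_mem _ (List.mem_map.2 ⟨s, hs, rfl⟩))

theorem own_mem_runs (h : IsRound a runs μ R₁ R₂ R₃ R₄ parts) :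
    R₁ ++ (R₂ ++ μ :: (R₃ ++ R₄)) ∈ runs :=
  h.perm.symm.subset List.mem_cons_self

theorem own_sorted (h : IsRound a runs μ R₁ R₂ R₃ R₄ parts) (hr : IsRuns a runs) :
    (R₁.Pairwise (fun x y => a x ≤ a y) ∧ R₂.Pairwise (fun x y => a x ≤ a y) ∧
      R₃.Pairwise (fun x y => a x ≤ a y) ∧ R₄.Pairwise (fun x y => a x ≤ a y)) ∧
    (∀ x ∈ R₁, a x ≤ a μ) ∧ (∀ x ∈ R₂, a x ≤ a μ) ∧ (∀ x ∈ R₃, a μ ≤ a x) ∧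
    (∀ x ∈ R₄, a μ ≤ a x) ∧ (∀ x ∈ R₁, ∀ y ∈ R₂, a x ≤ a y) ∧
    (∀ x ∈ R₃, ∀ y ∈ R₄, a x ≤ a y) := by
  have := hr.sorted _ h.own_mem_runs
  simp only [List.pairwise_append, List.pairwise_cons, List.mem_append, List.mem_cons] at this
  obtain ⟨h1, ⟨h2, ⟨h3, h4, h5, h6⟩, h7⟩, h8⟩ := this
  exact ⟨⟨h1, h2, h4, h5⟩, fun x hx => h8 x hx μ (by simp), fun x hx => h7 x hx μ (by simp),
    fun x hx => h3 x (Or.inl hx), fun x hx => h3 x (Or.inr hx),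
    fun x hx y hy => h8 x hx y (Or.inl hy), h6⟩

theorem mem_left_iff (x : Fin n) : x ∈ (nonemptyParts R₁ (parts.map (fun s => s.1))).flatten ↔
    x ∈ R₁ ∨ ∃ s ∈ parts, x ∈ s.1 := by
  rw [flatten_nonemptyParts, List.mem_append, ← List.flatMap_def, List.mem_flatMap]

theorem mem_right_iff (x : Fin n) : x ∈ (nonemptyParts R₄ (parts.map (fun s => s.2.2))).flatten ↔
    x ∈ R₄ ∨ ∃ s ∈ parts, x ∈ s.2.2 := by
  rw [flatten_nonemptyParts, List.mem_append, ← List.flatMap_def, List.mem_flatMap]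

theorem mem_middle_iff (x : Fin n) :
    x ∈ R₂ ++ [μ] ++ (parts.map (fun s => s.2.1)).flatten ++ R₃ ↔
    x ∈ R₂ ∨ x = μ ∨ (∃ s ∈ parts, x ∈ s.2.1) ∨ x ∈ R₃ := by
  simp only [List.mem_append, List.mem_singleton, ← List.flatMap_def, List.mem_flatMap, or_assoc]

theorem mem_flatten_iff (h : IsRound a runs μ R₁ R₂ R₃ R₄ parts) (x : Fin n) :
    x ∈ runs.flatten ↔ (x ∈ R₁ ∨ ∃ s ∈ parts, x ∈ s.1) ∨
      (x ∈ R₂ ∨ x = μ ∨ (∃ s ∈ parts, x ∈ s.2.1) ∨ x ∈ R₃) ∨ (x ∈ R₄ ∨ ∃ s ∈ parts, x ∈ s.2.2) := by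
  rw [h.flatten_perm.mem_iff, List.mem_append, List.mem_append, mem_left_iff, mem_right_iff,
    mem_middle_iff]

/-- The left subproblem consists of the elements that are at most `max_ℓ`. -/
theorem mem_left_iff_le (h : IsRound a runs μ R₁ R₂ R₃ R₄ parts) (hr : IsRuns a runs) {x : Fin n}
    (hx : x ∈ runs.flatten) : x ∈ (nonemptyParts R₁ (parts.map (fun s => s.1))).flatten ↔
      ∃ s ∈ parts, ∃ z ∈ s.1, a x ≤ a z := by
  obtain ⟨-, -, o2, o3, o4, -, -⟩ := h.own_sorted hr
  constructor
  · rw [mem_left_iff]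
    rintro (hx | ⟨s, hs, hx⟩)
    · exact h.exists_le x hx
    · exact ⟨s, hs, x, hx, le_rfl⟩
  · rintro ⟨s, hs, z, hz, hxz⟩
    have hzμ := (h.split s hs).1 z hz
    have hxμ := hxz.trans_lt hzμ
    rw [mem_left_iff]
    rcases (h.mem_flatten_iff x).1 hx with hx | (hx | rfl | ⟨t, ht, hx⟩ | hx) | hx | ⟨t, ht, hx⟩
    · exact hx
    · exact absurd hxz (h.lt_of_mem x hx s hs z hz).not_ge
    · exact absurd hxμ (lt_irrefl _)
    · exact absurd ((h.split t ht).2.1 x hx) hxμ.ne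
    · exact absurd (o3 x hx) hxμ.not_ge
    · exact absurd (o4 x hx) hxμ.not_ge
    · exact absurd ((h.split t ht).2.2 x hx) hxμ.not_gt

theorem mem_right_iff_ge (h : IsRound a runs μ R₁ R₂ R₃ R₄ parts) (hr : IsRuns a runs) {x : Fin n}
    (hx : x ∈ runs.flatten) : x ∈ (nonemptyParts R₄ (parts.map (fun s => s.2.2))).flatten ↔
      ∃ s ∈ parts, ∃ z ∈ s.2.2, a z ≤ a x := by
  obtain ⟨-, o1, o2, o3, o4, -, -⟩ := h.own_sorted hr
  constructor
  · rw [mem_right_iff]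
    rintro (hx | ⟨s, hs, hx⟩)
    · exact h.exists_ge x hx
    · exact ⟨s, hs, x, hx, le_rfl⟩
  · rintro ⟨s, hs, z, hz, hxz⟩
    have hzμ := (h.split s hs).2.2 z hz
    have hxμ := hzμ.trans_le hxz
    rw [mem_right_iff]
    rcases (h.mem_flatten_iff x).1 hx with (hx | ⟨t, ht, hx⟩) | (hx | rfl | ⟨t, ht, hx⟩ | hx) | hx
    · exact absurd (o1 x hx) hxμ.not_ge
    · exact absurd ((h.split t ht).1 x hx) hxμ.not_gt
    · exact absurd (o2 x hx) hxμ.not_ge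
    · exact absurd hxμ (lt_irrefl _)
    · exact absurd ((h.split t ht).2.1 x hx) hxμ.ne'
    · exact absurd hxz (h.gt_of_mem x hx s hs z hz).not_ge
    · exact hx

theorem isRuns_left (h : IsRound a runs μ R₁ R₂ R₃ R₄ parts) (hr : IsRuns a runs) :
    IsRuns a (nonemptyParts R₁ (parts.map (fun s => s.1))) := by
  refine ⟨fun r hr => ?_, fun r hr' => ?_, ?_⟩
  · rw [nonemptyParts, List.mem_filter] at hr
    simpa using hr.2
  · rw [nonemptyParts, List.mem_filter, List.mem_cons, List.mem_map] at hr'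
    rcases hr'.1 with rfl | ⟨s, hs, rfl⟩
    · exact (h.own_sorted hr).1.1
    · exact (List.pairwise_append.1 (hr.sorted _ (h.mem_runs hs))).1
  · exact (List.nodup_append'.1 (h.flatten_perm.nodup_iff.1 hr.nodup)).1

theorem isRuns_right (h : IsRound a runs μ R₁ R₂ R₃ R₄ parts) (hr : IsRuns a runs) :
    IsRuns a (nonemptyParts R₄ (parts.map (fun s => s.2.2))) := by
  refine ⟨fun r hr => ?_, fun r hr' => ?_, ?_⟩
  · rw [nonemptyParts, List.mem_filter] at hr
    simpa using hr.2
  · rw [nonemptyParts, List.mem_filter, List.mem_cons, List.mem_map] at hr'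
    rcases hr'.1 with rfl | ⟨s, hs, rfl⟩
    · exact (h.own_sorted hr).1.2.2.2
    · exact (List.pairwise_append.1 (List.pairwise_append.1
        (hr.sorted _ (h.mem_runs hs))).2.1).2.1
  · exact (List.nodup_append'.1 (List.nodup_append'.1
      (h.flatten_perm.nodup_iff.1 hr.nodup)).2.1).2.1

/-- At least `μ` itself leaves the recursion, so a fuel equal to the number of elements suffices. -/
theorem length_add_length_lt (h : IsRound a runs μ R₁ R₂ R₃ R₄ parts) :
    (nonemptyParts R₁ (parts.map (fun s => s.1))).flatten.length +
      (nonemptyParts R₄ (parts.map (fun s => s.2.2))).flatten.length < runs.flatten.length := by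
  have := h.flatten_perm.length_eq
  simp only [List.length_append, List.length_singleton] at this
  omega

end IsRound

theorem sortRuns_correct : ∀ (fuel : ℕ) (runs : List (List (Fin n))), IsRuns a runs →
    runs.flatten.length ≤ fuel → ((sortRuns fuel runs).eval a).Perm runs.flatten ∧
      ((sortRuns fuel runs).eval a).Pairwise (fun x y => a x ≤ a y) := by
  intro fuel
  induction fuel with
  | zero =>
    intro runs hr hlen
    have : runs.flatten = [] := List.length_eq_zero_iff.1 (by omega)
    simp [sortRuns, this]
  | succ fuel ih =>
    intro runs hr hlen
    by_cases hne : runs = []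
    · subst hne
      simp [sortRuns_nil]
    obtain ⟨μ, R₁, R₂, R₃, R₄, parts, h, heval, -⟩ := exists_round a fuel runs hr hne
    have hlt := h.length_add_length_lt
    obtain ⟨l1, l2⟩ := ih _ (h.isRuns_left hr) (by omega)
    obtain ⟨r1, r2⟩ := ih _ (h.isRuns_right hr) (by omega)
    rw [heval]
    set Lo := (sortRuns fuel (nonemptyParts R₁ (parts.map (fun s => s.1)))).eval a
    set Hi := (sortRuns fuel (nonemptyParts R₄ (parts.map (fun s => s.2.2)))).eval a
    have hassoc : Lo ++ R₂ ++ [μ] ++ (parts.map (fun s => s.2.1)).flatten ++ R₃ ++ Hi =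
        Lo ++ ((R₂ ++ [μ] ++ (parts.map (fun s => s.2.1)).flatten ++ R₃) ++ Hi) := by
      simp only [List.append_assoc]
    rw [hassoc]
    refine ⟨(l1.append (r1.append_left _)).trans h.flatten_perm.symm, ?_⟩
    obtain ⟨⟨-, s2, s3, -⟩, o1, o2, o3, o4, o5, o6⟩ := h.own_sorted hr
    have hLo : ∀ x ∈ Lo, (x ∈ R₁ ∨ ∃ s ∈ parts, x ∈ s.1) ∧ a x ≤ a μ := by
      intro x hx
      have := (IsRound.mem_left_iff x).1 (l1.subset hx)
      refine ⟨this, ?_⟩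
      rcases this with hx | ⟨s, hs, hx⟩
      · exact o1 x hx
      · exact ((h.split s hs).1 x hx).le
    have hHi : ∀ x ∈ Hi, (x ∈ R₄ ∨ ∃ s ∈ parts, x ∈ s.2.2) ∧ a μ ≤ a x := by
      intro x hx
      have := (IsRound.mem_right_iff x).1 (r1.subset hx)
      refine ⟨this, ?_⟩
      rcases this with hx | ⟨s, hs, hx⟩
      · exact o4 x hx
      · exact ((h.split s hs).2.2 x hx).le
    have heq : ∀ x ∈ (parts.map (fun s => s.2.1)).flatten, a x = a μ := by
      intro x hx
      simp only [List.mem_flatten, List.mem_map] at hx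
      obtain ⟨_, ⟨s, hs, rfl⟩, hx⟩ := hx
      exact (h.split s hs).2.1 x hx
    rw [List.pairwise_append, List.pairwise_append]
    -- The order inside the middle section comes from the run of `μ`. Against the two recursive
    -- results one compares `R₂` with everything below through `max_ℓ`, and `R₃` with everything
    -- above through `min_r`; all other pairs are separated by `μ`.
    refine ⟨l2, ⟨?_, r2, ?_⟩, ?_⟩
    · simp only [List.pairwise_append, List.pairwise_singleton, List.mem_append,
        List.mem_singleton, true_and]
      refine ⟨⟨⟨s2, ?_⟩, ?_, ?_⟩, s3, ?_⟩
      · rintro x hx _ rfl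
        exact o2 x hx
      · exact List.pairwise_of_forall_mem_list fun x hx y hy => by rw [heq x hx, heq y hy]
      · rintro x (hx | rfl) y hy
        · rw [heq y hy]; exact o2 x hx
        · rw [heq y hy]
      · rintro x ((hx | rfl) | hx) y hy
        · exact (o2 x hx).trans (o3 y hy)
        · exact o3 y hy
        · rw [heq x hx]; exact o3 y hy
    · intro x hx y hy
      rcases (IsRound.mem_middle_iff x).1 hx with hx | rfl | ⟨s, hs, hx⟩ | hx
      · exact (o2 x hx).trans (hHi y hy).2
      · exact (hHi y hy).2
      · rw [(h.split s hs).2.1 x hx]; exact (hHi y hy).2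
      · rcases (hHi y hy).1 with hy | ⟨s, hs, hy⟩
        · exact o6 x hx y hy
        · exact (h.gt_of_mem x hx s hs y hy).le
    · intro x hx y hy
      rcases List.mem_append.1 hy with hy | hy
      · rcases (IsRound.mem_middle_iff y).1 hy with hy | rfl | ⟨s, hs, hy⟩ | hy
        · rcases (hLo x hx).1 with hx | ⟨s, hs, hx⟩
          · exact o5 x hx y hy
          · exact (h.lt_of_mem y hy s hs x hx).le
        · exact (hLo x hx).2
        · rw [(h.split s hs).2.1 y hy]; exact (hLo x hx).2
        · exact (hLo x hx).2.trans (o3 y hy)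
      · exact (hLo x hx).2.trans (hHi y hy).2

theorem isRuns_detectRuns (a : Fin n → α) :
    IsRuns a ((detectRuns (List.finRange n)).eval a) := by
  obtain ⟨h1, h2, -, -⟩ := detectRuns_spec a (List.finRange n)
  refine ⟨fun r hr => (h2 r hr).1, fun r hr => ?_, ?_⟩
  · have : IsTrans (Fin n) (fun x y => a x ≤ a y) := ⟨fun _ _ _ h h' => h.trans h'⟩
    exact List.isChain_iff_pairwise.1 (h2 r hr).2
  · rw [h1]
    exact List.nodup_finRange n

end QuickSynergy

theorem quickSynergySort_sorts (n : ℕ) (α : Type*) [LinearOrder α] :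
    (quickSynergySort n).Sorts α := by
  intro a
  have hr := QuickSynergy.isRuns_detectRuns a
  have hf := (QuickSynergy.detectRuns_spec a (List.finRange n)).1
  rw [quickSynergySort, Comp.eval_bind]
  obtain ⟨h1, h2⟩ := QuickSynergy.sortRuns_correct n _ hr (by rw [hf, List.length_finRange])
  rw [hf] at h1
  exact ⟨h1, List.pairwise_map.2 h2⟩


/-! ### The potential and its decrease, numerically. -/

namespace QuickSynergy

open Comp

section Potential

theorem logb_add_le (c p q : ℕ) :
    Real.logb 2 ((c + p + q : ℕ) + 1) ≤ Real.logb 2 (c + 1) + p + Real.logb 2 (q + 1) := by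
  have h1 : c + p + q + 1 ≤ (c + 1) * 2 ^ p * (q + 1) := by
    have : p + 1 ≤ 2 ^ p := Nat.lt_pow_self (by norm_num)
    have h2 : c + p + q + 1 ≤ (c + 1) * (p + 1) * (q + 1) := by
      nlinarith [Nat.zero_le (c * p), Nat.zero_le (c * q), Nat.zero_le (p * q),
        Nat.zero_le (c * p * q)]
    exact h2.trans (by gcongr)
  have h2 : ((c + p + q : ℕ) + 1 : ℝ) ≤ (c + 1) * 2 ^ p * (q + 1) := by exact_mod_cast h1
  calc Real.logb 2 ((c + p + q : ℕ) + 1) ≤ Real.logb 2 ((c + 1) * 2 ^ p * (q + 1)) :=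
        Real.logb_le_logb_of_le one_lt_two (by positivity) h2
    _ = _ := by
      rw [Real.logb_mul (by positivity) (by positivity), Real.logb_mul (by positivity)
        (by positivity), Real.logb_pow, Real.logb_self_eq_one one_lt_two, mul_one]

/-- For `e = 0` this is `(l + g + 1)(min(l, g) + 1) ≤ 2(l + 1)(g + 1)`. The elements equal to the
pivot are absorbed by `e + g + 1 ≤ 2 ^ e (g + 1)`. -/
theorem logb_split_le (l e g : ℕ) :
    Real.logb 2 ((l + e + g : ℕ) + 1) + Nat.log 2 (min l (e + g) + 1) ≤
      1 + e + Real.logb 2 (l + 1) + Real.logb 2 (g + 1) := by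
  set J := Nat.log 2 (min l (e + g) + 1)
  have hJ : 2 ^ J ≤ min l (e + g) + 1 := Nat.pow_log_le_self 2 (by omega)
  have h1 : (l + e + g + 1) * 2 ^ J ≤ 2 * 2 ^ e * (l + 1) * (g + 1) := by
    have h2 : e + g + 1 ≤ 2 ^ e * (g + 1) := by
      have : e + 1 ≤ 2 ^ e := Nat.lt_pow_self (by norm_num)
      nlinarith
    calc (l + e + g + 1) * 2 ^ J ≤ (l + e + g + 1) * (min l (e + g) + 1) := by gcongr
      _ ≤ 2 * ((l + 1) * (e + g + 1)) := by
        rcases le_total l (e + g) with h | h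
        · rw [min_eq_left h]; nlinarith
        · rw [min_eq_right h]; nlinarith
      _ ≤ 2 * ((l + 1) * (2 ^ e * (g + 1))) := by gcongr
      _ = _ := by ring
  have h2 : ((l + e + g : ℕ) + 1 : ℝ) * 2 ^ J ≤ 2 * 2 ^ e * (l + 1) * (g + 1) := by
    exact_mod_cast h1
  have h3 := Real.logb_le_logb_of_le one_lt_two (by positivity) h2
  rw [Real.logb_mul (by positivity) (by positivity), Real.logb_mul (by positivity) (by positivity),
    Real.logb_mul (by positivity) (by positivity), Real.logb_mul (by positivity) (by positivity),
    Real.logb_pow, Real.logb_pow, Real.logb_self_eq_one one_lt_two] at h3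
  linarith

/-- The contribution of a run to the potential. -/
noncomputable def runPotential (c : ℝ) (k : ℕ) : ℝ :=
  5 * k - 3 * Real.logb 2 (k + 1) + c * ((2 * k - 1 : ℕ) : ℝ)

/-- Empty pieces, which the algorithm discards, carry no potential; this needs the truncated
subtraction in `2 * k - 1`. -/
theorem runPotential_zero (c : ℝ) : runPotential c 0 = 0 := by simp [runPotential]

theorem runPotential_nonneg {c : ℝ} (hc : 0 ≤ c) (k : ℕ) : 0 ≤ runPotential c k := by
  have h1 := logb_add_le 0 k 0
  simp only [zero_add, add_zero, Nat.cast_zero, Real.logb_one] at h1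
  have h2 : (0 : ℝ) ≤ c * ((2 * k - 1 : ℕ) : ℝ) := by positivity
  have h3 : (0 : ℝ) ≤ k := by positivity
  rw [runPotential]
  linarith

theorem runPotential_le {c : ℝ} (hc : 0 ≤ c) (k : ℕ) : runPotential c k ≤ (5 + 2 * c) * k := by
  have h1 : 0 ≤ Real.logb 2 ((k : ℝ) + 1) := Real.logb_nonneg one_lt_two (by simp)
  have h2 : ((2 * k - 1 : ℕ) : ℝ) ≤ 2 * k := by
    have : 2 * k - 1 ≤ 2 * k := by omega
    exact_mod_cast this
  rw [runPotential]
  nlinarith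

/-- By `logb_split_le`, the terms `5k - 3 log(k + 1)` release all of the search cost except 6: the
search has an additive 3, and the estimate loses 3 times 1. Unless the run passes whole to one side,
the sum of the `2k - 1` drops by at least one. -/
theorem runPotential_split {c : ℝ} (hc : 0 ≤ c) {n : ℕ}
    (s : List (Fin n) × List (Fin n) × List (Fin n)) (hs : s.1 ++ (s.2.1 ++ s.2.2) ≠ []) :
    (splitCost s : ℝ) + c * (if (s.2.1 = [] ∧ s.2.2 = []) ∨ (s.1 = [] ∧ s.2.1 = []) then 0 else 1)
      + runPotential c s.1.length + runPotential c s.2.2.length ≤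
      runPotential c (s.1 ++ (s.2.1 ++ s.2.2)).length + 6 := by
  obtain ⟨l, e, g⟩ := s
  have h1 := logb_split_le l.length e.length g.length
  have hpos : 0 < l.length + (e.length + g.length) := by
    have := List.length_pos_iff.2 hs
    simpa using this
  have h2 : (if (e = [] ∧ g = []) ∨ (l = [] ∧ e = []) then 0 else 1) +
      (2 * l.length - 1) + (2 * g.length - 1) ≤ 2 * (l.length + (e.length + g.length)) - 1 := by
    simp only [← List.length_eq_zero_iff]
    split_ifs <;> omega
  have h3 : (if (e = [] ∧ g = []) ∨ (l = [] ∧ e = []) then (0 : ℝ) else 1) +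
      ((2 * l.length - 1 : ℕ) : ℝ) + ((2 * g.length - 1 : ℕ) : ℝ) ≤
      ((2 * (l.length + (e.length + g.length)) - 1 : ℕ) : ℝ) := by exact_mod_cast h2
  have h4 := mul_le_mul_of_nonneg_left h3 hc
  simp only [runPotential, splitCost, List.length_append]
  push_cast at h1 h4 ⊢
  rw [show (l.length : ℝ) + (e.length + g.length) = l.length + e.length + g.length by ring]
  linarith

/-- The run of `μ` always counts as cut, since it loses `μ`. The searches in it are linear in the
parts that leave the recursion, and of the 5 per removed element at most 3 are lost in the
logarithms. -/
theorem runPotential_own {c : ℝ} (hc : 0 ≤ c) {n : ℕ} (R₁ R₂ R₃ R₄ : List (Fin n)) (μ : Fin n) :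
    2 * ((R₂.length : ℝ) + R₃.length) + c + runPotential c R₁.length + runPotential c R₄.length ≤
      runPotential c (R₁ ++ (R₂ ++ μ :: (R₃ ++ R₄))).length := by
  have h1 := logb_add_le R₁.length (R₂.length + 1 + R₃.length) R₄.length
  have h2 : 1 + (2 * R₁.length - 1) + (2 * R₄.length - 1) ≤
      2 * (R₁.length + (R₂.length + (R₃.length + R₄.length + 1))) - 1 := by omega
  have h3 : 1 + ((2 * R₁.length - 1 : ℕ) : ℝ) + ((2 * R₄.length - 1 : ℕ) : ℝ) ≤
      ((2 * (R₁.length + (R₂.length + (R₃.length + R₄.length + 1))) - 1 : ℕ) : ℝ) := by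
    exact_mod_cast h2
  have h4 := mul_le_mul_of_nonneg_left h3 hc
  simp only [runPotential, List.length_append, List.length_cons]
  push_cast at h1 h4 ⊢
  rw [show (R₁.length : ℝ) + (R₂.length + (R₃.length + R₄.length + 1)) =
    R₁.length + (R₂.length + 1 + R₃.length) + R₄.length by ring]
  linarith

theorem half_le_logb_sub {k m : ℕ} (hm : 0 < m) (h : 8 * m ≤ 5 * k) :
    1 / 2 ≤ Real.logb 2 k - Real.logb 2 m := by
  have hm' : (0 : ℝ) < m := by exact_mod_cast hm
  have hk' : (0 : ℝ) < k := by
    have : 0 < k := by omega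
    exact_mod_cast this
  have h1 : 2 * m ^ 2 ≤ k ^ 2 := by nlinarith
  have h2 : (2 : ℝ) * m ^ 2 ≤ k ^ 2 := by exact_mod_cast h1
  have h3 := Real.logb_le_logb_of_le one_lt_two (by positivity) h2
  rw [Real.logb_mul (by positivity) (by positivity), Real.logb_pow, Real.logb_pow,
    Real.logb_self_eq_one one_lt_two] at h3
  push_cast at h3
  linarith

/-- If few runs are cut, the number of runs in both subproblems is so much smaller that the
decrease of the logarithms pays for the round. -/
theorem blockPotential_drop {ι : Type*} [DecidableEq ι] (B BL BR : Finset ι) (w : ι → ℝ)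
    (k kL kR iL iR s : ℕ) (K : ℝ) (hK : 0 ≤ K) (hBL : BL ⊆ B) (hBR : BR ⊆ B)
    (hdis : Disjoint BL BR) (hw : ∀ p ∈ B, w p ≤ Real.logb 2 k)
    (hL : kL ≤ BL.card) (hR : kR ≤ BR.card) (hL0 : kL = 0 → BL = ∅) (hR0 : kR = 0 → BR = ∅)
    (hkL : kL ≤ iL + s) (hkR : kR ≤ iR + s) (hiL : iL ≤ kL) (hiR : iR ≤ kR)
    (hiL' : 2 * iL ≤ k) (hiR' : 2 * iR ≤ k) (hkLk : kL ≤ k) (hkRk : kR ≤ k)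
    (hk : k ≤ iL + iR + s) :
    K * k + 3 * K * (∑ p ∈ BL, (Real.logb 2 kL - w p)) + 3 * K * (∑ p ∈ BR, (Real.logb 2 kR - w p))
      ≤ 8 * K * s + 3 * K * ∑ p ∈ B, (Real.logb 2 k - w p) := by
  have hsplit : (∑ p ∈ BL, (Real.logb 2 k - w p)) + (∑ p ∈ BR, (Real.logb 2 k - w p)) ≤
      ∑ p ∈ B, (Real.logb 2 k - w p) := by
    rw [← Finset.sum_union hdis]
    exact Finset.sum_le_sum_of_subset_of_nonneg (Finset.union_subset hBL hBR)
      fun p hp _ => sub_nonneg.2 (hw p hp)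
  -- A subproblem has at least as many blocks as runs, and each block gains the same amount `log k -
  -- log m`.
  have hside : ∀ (C : Finset ι) (m : ℕ) (t : ℝ), (m = 0 → C = ∅) → m ≤ C.card → 0 ≤ t →
      (0 < m → t ≤ Real.logb 2 k - Real.logb 2 m) →
      (∑ p ∈ C, (Real.logb 2 m - w p)) + t * m ≤ ∑ p ∈ C, (Real.logb 2 k - w p) := by
    intro C m t h0 hm ht hlog
    rcases Nat.eq_zero_or_pos m with rfl | hpos
    · simp [h0 rfl]
    · have h1 : ∑ p ∈ C, (Real.logb 2 k - w p) =
          ∑ p ∈ C, (Real.logb 2 m - w p) + C.card * (Real.logb 2 k - Real.logb 2 m) := by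
        rw [← nsmul_eq_mul, ← Finset.sum_const, ← Finset.sum_add_distrib]
        exact Finset.sum_congr rfl fun p _ => by ring
      have h2 : t * m ≤ C.card * (Real.logb 2 k - Real.logb 2 m) := by
        have h3 : (m : ℝ) ≤ C.card := by exact_mod_cast hm
        have := hlog hpos
        have h4 : (0 : ℝ) ≤ m := by positivity
        nlinarith
      linarith
  have hmono : ∀ m : ℕ, m ≤ k → 0 < m → (0 : ℝ) ≤ Real.logb 2 k - Real.logb 2 m :=
    fun m hm hpos => sub_nonneg.2 (Real.logb_le_logb_of_le one_lt_two (by exact_mod_cast hpos)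
      (by exact_mod_cast hm))
  -- If an eighth of the runs are cut, the term `8 * K * s` pays for the round. Otherwise both sides
  -- have at most `k/2 + k/8` runs and together at least `7k/8`, so the logarithms release at least
  -- `3K · (1/2) · (7k/8) ≥ Kk`.
  by_cases hs : k ≤ 8 * s
  · have h1 := hside BL kL 0 hL0 hL le_rfl (hmono kL hkLk)
    have h2 := hside BR kR 0 hR0 hR le_rfl (hmono kR hkRk)
    have h3 : (k : ℝ) ≤ 8 * s := by exact_mod_cast hs
    have h4 := mul_le_mul_of_nonneg_left h3 hK
    have h5 := mul_le_mul_of_nonneg_left (add_le_add h1 h2) hK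
    have h6 := mul_le_mul_of_nonneg_left hsplit hK
    linarith
  · have h1 := hside BL kL (1 / 2) hL0 hL (by norm_num)
      (fun h => half_le_logb_sub h (by omega))
    have h2 := hside BR kR (1 / 2) hR0 hR (by norm_num)
      (fun h => half_le_logb_sub h (by omega))
    have h3 : 7 * k ≤ 8 * (kL + kR) := by omega
    have h3' : 7 * (k : ℝ) ≤ 8 * (kL + kR) := by exact_mod_cast h3
    have h4 := mul_le_mul_of_nonneg_left h3' hK
    have h5 := mul_le_mul_of_nonneg_left (add_le_add h1 h2) hK
    have h6 := mul_le_mul_of_nonneg_left hsplit hK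
    have h7 : 0 ≤ K * s := by positivity
    have h8 : 0 ≤ K * k := by positivity
    linarith

end Potential

/-! ### Subproblems that consist of complete members, and the total cost. -/

variable {n : ℕ} {α : Type*} [LinearOrder α] {a : Fin n → α} {κ ri : Fin n → ℕ}

/-- The runs of a subproblem, all of whose elements come in complete classes of `κ`; the runs are
parts of different runs in the sense of `ri`. -/
structure IsNode (a : Fin n → α) (κ ri : Fin n → ℕ) (runs : List (List (Fin n))) : Prop
    extends IsRuns a runs where
  same : ∀ r ∈ runs, ∀ x ∈ r, ∀ y ∈ r, ri x = ri y
  diff : runs.Pairwise (fun r s => ∀ x ∈ r, ∀ y ∈ s, ri x ≠ ri y)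
  closed : ∀ x ∈ runs.flatten, ∀ y, κ y = κ x → y ∈ runs.flatten

/-- The blocks of a subproblem. -/
def blocks (κ ri : Fin n → ℕ) (runs : List (List (Fin n))) : Finset (ℕ × ℕ) :=
  runs.flatten.toFinset.image (fun x => (κ x, ri x))

theorem mem_blocks {runs : List (List (Fin n))} {p : ℕ × ℕ} :
    p ∈ blocks κ ri runs ↔ ∃ x ∈ runs.flatten, (κ x, ri x) = p := by
  simp only [blocks, Finset.mem_image, List.mem_toFinset]

/-- The number of runs that meet a class. -/
def classRuns (κ ri : Fin n → ℕ) (c : ℕ) : ℕ :=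
  ((Finset.univ.filter (fun x => κ x = c)).image ri).card

namespace IsNode

variable {runs : List (List (Fin n))}

theorem exists_key (h : IsNode a κ ri runs) : ∃ f : List (Fin n) → ℕ,
    (∀ r ∈ runs, ∀ x ∈ r, ri x = f r) ∧ (runs.map f).Nodup := by
  refine ⟨fun r => (r.head?.map ri).getD 0, fun r hr x hx => ?_, ?_⟩
  · cases r with
    | nil => simp at hx
    | cons y t => simpa using h.same _ hr x hx y List.mem_cons_self
  · rw [List.Nodup, List.pairwise_map]
    refine h.diff.imp_of_mem fun {r s} hr hs hrs => ?_
    match r, s, h.ne_nil r hr, h.ne_nil s hs with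
    | x :: r, y :: s, _, _ => simpa using hrs x List.mem_cons_self y List.mem_cons_self

theorem length_le_card_blocks (h : IsNode a κ ri runs) :
    runs.length ≤ (blocks κ ri runs).card := by
  obtain ⟨f, hf, hnd⟩ := h.exists_key
  rw [← List.length_map (f := f), ← List.toFinset_card_of_nodup hnd]
  refine le_trans (Finset.card_le_card ?_) (Finset.card_image_le (f := Prod.snd))
  intro j hj
  rw [List.mem_toFinset, List.mem_map] at hj
  obtain ⟨r, hr, rfl⟩ := hj
  obtain ⟨x, hx⟩ := List.exists_mem_of_ne_nil r (h.ne_nil r hr)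
  exact Finset.mem_image.2 ⟨(κ x, ri x),
    mem_blocks.2 ⟨x, List.mem_flatten.2 ⟨r, hr, hx⟩, rfl⟩, hf r hr x hx⟩

/-- Here `closed` is needed: the whole class lies in the subproblem, so the runs that meet it are
all still present. This keeps the block part of the potential nonnegative. -/
theorem classRuns_le (h : IsNode a κ ri runs) {p : ℕ × ℕ} (hp : p ∈ blocks κ ri runs) :
    0 < classRuns κ ri p.1 ∧ classRuns κ ri p.1 ≤ runs.length := by
  obtain ⟨x, hx, rfl⟩ := mem_blocks.1 hp
  refine ⟨Finset.card_pos.2 ⟨ri x, Finset.mem_image_of_mem _ (by simp)⟩, ?_⟩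
  obtain ⟨f, hf, hnd⟩ := h.exists_key
  rw [← List.length_map (f := f), ← List.toFinset_card_of_nodup hnd]
  refine Finset.card_le_card fun j hj => ?_
  simp only [Finset.mem_image, Finset.mem_filter, Finset.mem_univ, true_and] at hj
  obtain ⟨y, hy, rfl⟩ := hj
  obtain ⟨r, hr, hyr⟩ := List.mem_flatten.1 (h.closed x hx y hy)
  rw [List.mem_toFinset, List.mem_map]
  exact ⟨r, hr, (hf r hr y hyr).symm⟩

theorem logb_classRuns_le (h : IsNode a κ ri runs) {p : ℕ × ℕ} (hp : p ∈ blocks κ ri runs) :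
    Real.logb 2 (classRuns κ ri p.1) ≤ Real.logb 2 runs.length := by
  obtain ⟨h1, h2⟩ := h.classRuns_le hp
  exact Real.logb_le_logb_of_le one_lt_two (by exact_mod_cast h1) (by exact_mod_cast h2)

variable {μ : Fin n} {R₁ R₂ R₃ R₄ : List (Fin n)}
  {parts : List (List (Fin n) × List (Fin n) × List (Fin n))}

theorem diff_parts (h : IsNode a κ ri runs) (hr : IsRound a runs μ R₁ R₂ R₃ R₄ parts) :
    (∀ s ∈ parts, ∀ z ∈ s.1 ++ (s.2.1 ++ s.2.2), ∀ w ∈ R₁ ++ (R₂ ++ μ :: (R₃ ++ R₄)),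
      ri z ≠ ri w) ∧
    parts.Pairwise (fun s t => ∀ x ∈ s.1 ++ (s.2.1 ++ s.2.2), ∀ y ∈ t.1 ++ (t.2.1 ++ t.2.2),
      ri x ≠ ri y) := by
  have := (hr.perm.pairwise_iff (fun {r s} hrs x hx y hy => (hrs y hy x hx).symm)).1 h.diff
  rw [List.pairwise_cons, List.pairwise_map] at this
  exact ⟨fun s hs z hz w hw => (this.1 _ (List.mem_map.2 ⟨s, hs, rfl⟩) w hw z hz).symm, this.2⟩

/-- Suppose that a class has `x` inside the left subproblem and `y` outside. Some `z` below `μ` in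
another run than that of `μ` has its value between theirs, so by monotonicity it is in the same
class, and by `hri` in the run of `y`. Then `y` is not in the run of `μ`, so its value is at least
that of `μ`, and `μ` falls into the class as well. But `z` and `μ` have different values and
different runs, against `hri`. -/
theorem left (hκ : ∀ x y, a x ≤ a y → κ x ≤ κ y)
    (hri : ∀ x y, κ x = κ y → a x ≠ a y → ri x = ri y)
    (h : IsNode a κ ri runs) (hr : IsRound a runs μ R₁ R₂ R₃ R₄ parts) :
    IsNode a κ ri (nonemptyParts R₁ (parts.map (fun s => s.1))) := by
  obtain ⟨hd1, hd2⟩ := h.diff_parts hr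
  refine ⟨hr.isRuns_left h.toIsRuns, ?_, ?_, ?_⟩
  · intro r hr' x hx y hy
    rw [nonemptyParts, List.mem_filter, List.mem_cons, List.mem_map] at hr'
    rcases hr'.1 with rfl | ⟨s, hs, rfl⟩
    · exact h.same _ hr.own_mem_runs x (List.mem_append_left _ hx) y (List.mem_append_left _ hy)
    · exact h.same _ (hr.mem_runs hs) x (List.mem_append_left _ hx) y (List.mem_append_left _ hy)
  · refine List.Pairwise.filter _ ?_
    rw [List.pairwise_cons, List.pairwise_map]
    refine ⟨?_, hd2.imp fun {s t} hst x hx y hy => hst x (List.mem_append_left _ hx) y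
      (List.mem_append_left _ hy)⟩
    intro r hr' x hx y hy
    obtain ⟨s, hs, rfl⟩ := List.mem_map.1 hr'
    exact (hd1 s hs y (List.mem_append_left _ hy) x (List.mem_append_left _ hx)).symm
  · intro x hx y hxy
    have hx' : x ∈ runs.flatten := hr.flatten_perm.symm.subset (List.mem_append_left _ hx)
    have hy' := h.closed x hx' y hxy
    rw [hr.mem_left_iff_le h.toIsRuns hx'] at hx
    obtain ⟨s, hs, z, hz, hxz⟩ := hx
    by_contra hy
    have hzy : a z < a y := by
      by_contra hzy
      exact hy ((hr.mem_left_iff_le h.toIsRuns hy').2 ⟨s, hs, z, hz, not_lt.1 hzy⟩)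
    have hκz : κ z = κ y := le_antisymm (hκ _ _ hzy.le) (hxy ▸ hκ _ _ hxz)
    have hrizy := hri z y hκz hzy.ne
    have hzs : z ∈ s.1 ++ (s.2.1 ++ s.2.2) := List.mem_append_left _ hz
    have hzμ := (hr.split s hs).1 z hz
    rw [IsRound.mem_left_iff] at hy
    have hown : y ∉ R₁ ++ (R₂ ++ μ :: (R₃ ++ R₄)) := fun hy => hd1 s hs z hzs y hy hrizy
    have hμy : a μ ≤ a y := by
      simp only [List.mem_append, List.mem_cons, not_or] at hown
      rcases (hr.mem_flatten_iff y).1 hy' with hy' | (hy' | hy' | ⟨t, ht, hy'⟩ | hy') |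
        hy' | ⟨t, ht, hy'⟩
      · exact absurd hy' hy
      · exact absurd hy' hown.2.1
      · exact absurd hy' hown.2.2.1
      · exact ((hr.split t ht).2.1 y hy').ge
      · exact absurd hy' hown.2.2.2.1
      · exact absurd hy' hown.2.2.2.2
      · exact ((hr.split t ht).2.2 y hy').le
    have hκμ : κ z = κ μ := le_antisymm (hκ _ _ hzμ.le) (hκz ▸ hκ _ _ hμy)
    exact hd1 s hs z hzs μ (by simp) (hri z μ hκμ hzμ.ne)

theorem right (hκ : ∀ x y, a x ≤ a y → κ x ≤ κ y)
    (hri : ∀ x y, κ x = κ y → a x ≠ a y → ri x = ri y)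
    (h : IsNode a κ ri runs) (hr : IsRound a runs μ R₁ R₂ R₃ R₄ parts) :
    IsNode a κ ri (nonemptyParts R₄ (parts.map (fun s => s.2.2))) := by
  obtain ⟨hd1, hd2⟩ := h.diff_parts hr
  refine ⟨hr.isRuns_right h.toIsRuns, ?_, ?_, ?_⟩
  · intro r hr' x hx y hy
    rw [nonemptyParts, List.mem_filter, List.mem_cons, List.mem_map] at hr'
    rcases hr'.1 with rfl | ⟨s, hs, rfl⟩
    · exact h.same _ hr.own_mem_runs x (by simp [hx]) y (by simp [hy])
    · exact h.same _ (hr.mem_runs hs) x (by simp [hx]) y (by simp [hy])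
  · refine List.Pairwise.filter _ ?_
    rw [List.pairwise_cons, List.pairwise_map]
    refine ⟨?_, hd2.imp fun {s t} hst x hx y hy => hst x (by simp [hx]) y (by simp [hy])⟩
    intro r hr' x hx y hy
    obtain ⟨s, hs, rfl⟩ := List.mem_map.1 hr'
    exact (hd1 s hs y (by simp [hy]) x (by simp [hx])).symm
  · intro x hx y hxy
    have hx' : x ∈ runs.flatten := hr.flatten_perm.symm.subset
      (List.mem_append_right _ (List.mem_append_right _ hx))
    have hy' := h.closed x hx' y hxy
    rw [hr.mem_right_iff_ge h.toIsRuns hx'] at hx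
    obtain ⟨s, hs, z, hz, hxz⟩ := hx
    by_contra hy
    have hzy : a y < a z := by
      by_contra hzy
      exact hy ((hr.mem_right_iff_ge h.toIsRuns hy').2 ⟨s, hs, z, hz, not_lt.1 hzy⟩)
    have hκz : κ z = κ y := le_antisymm (hxy ▸ hκ _ _ hxz) (hκ _ _ hzy.le)
    have hrizy := hri z y hκz hzy.ne'
    have hzs : z ∈ s.1 ++ (s.2.1 ++ s.2.2) := by simp [hz]
    have hzμ := (hr.split s hs).2.2 z hz
    rw [IsRound.mem_right_iff] at hy
    have hown : y ∉ R₁ ++ (R₂ ++ μ :: (R₃ ++ R₄)) := fun hy => hd1 s hs z hzs y hy hrizy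
    have hμy : a y ≤ a μ := by
      simp only [List.mem_append, List.mem_cons, not_or] at hown
      rcases (hr.mem_flatten_iff y).1 hy' with (hy' | ⟨t, ht, hy'⟩) |
        (hy' | hy' | ⟨t, ht, hy'⟩ | hy') | hy'
      · exact absurd hy' hown.1
      · exact ((hr.split t ht).1 y hy').le
      · exact absurd hy' hown.2.1
      · exact absurd hy' hown.2.2.1
      · exact ((hr.split t ht).2.1 y hy').le
      · exact absurd hy' hown.2.2.2.1
      · exact absurd hy' hy
    have hκμ : κ z = κ μ := le_antisymm (hκz ▸ hκ _ _ hμy) (hκ _ _ hzμ.le)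
    exact hd1 s hs z hzs μ (by simp) (hri z μ hκμ hzμ.ne')

end IsNode

/-- The potential of a subproblem. -/
noncomputable def potential (K : ℝ) (κ ri : Fin n → ℕ) (runs : List (List (Fin n))) : ℝ :=
  (runs.map (fun r => runPotential (8 * K) r.length)).sum +
    3 * K * ∑ p ∈ blocks κ ri runs,
      (Real.logb 2 runs.length - Real.logb 2 (classRuns κ ri p.1))

theorem potential_nonneg {K : ℝ} (hK : 0 ≤ K) {runs : List (List (Fin n))}
    (h : IsNode a κ ri runs) : 0 ≤ potential K κ ri runs := by
  refine add_nonneg (List.sum_nonneg ?_) (mul_nonneg (by positivity) (Finset.sum_nonneg ?_))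
  · intro x hx
    obtain ⟨r, -, rfl⟩ := List.mem_map.1 hx
    exact runPotential_nonneg (by positivity) _
  · intro p hp
    exact sub_nonneg.2 (h.logb_classRuns_le hp)

theorem sum_nonemptyParts (f : ℕ → ℝ) (hf : f 0 = 0) (r : List (Fin n))
    (rs : List (List (Fin n))) :
    ((nonemptyParts r rs).map (fun r => f r.length)).sum =
      f r.length + (rs.map (fun r => f r.length)).sum := by
  rw [nonemptyParts, ← List.sum_cons, ← List.map_cons (f := fun r : List (Fin n) => f r.length)]
  generalize r :: rs = l
  induction l with
  | nil => rfl
  | cons x t ih =>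
    by_cases hx : x = []
    · rw [List.filter_cons_of_neg (by simpa using hx), ih, hx]
      simp [hf]
    · rw [List.filter_cons_of_pos (by simpa using hx), List.map_cons, List.sum_cons, ih]
      simp

theorem length_nonemptyParts (r : List (Fin n)) (rs : List (List (Fin n))) :
    (nonemptyParts r rs).length ≤ rs.countP (fun r => r ≠ []) + 1 ∧
    rs.countP (fun r => r ≠ []) ≤ (nonemptyParts r rs).length := by
  rw [nonemptyParts, ← List.countP_eq_length_filter, List.countP_cons]
  split_ifs <;> constructor <;> omega

theorem blocks_eq_empty {runs : List (List (Fin n))} (h : runs.length = 0) :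
    blocks κ ri runs = ∅ := by
  rw [List.length_eq_zero_iff.1 h]
  rfl

theorem round_potential (hκ : ∀ x y, a x ≤ a y → κ x ≤ κ y)
    (hri : ∀ x y, κ x = κ y → a x ≠ a y → ri x = ri y) {K : ℝ} (hK : 6 ≤ K)
    {runs : List (List (Fin n))} {μ : Fin n} {R₁ R₂ R₃ R₄ : List (Fin n)}
    {parts : List (List (Fin n) × List (Fin n) × List (Fin n))}
    (h : IsNode a κ ri runs) (hr : IsRound a runs μ R₁ R₂ R₃ R₄ parts) :
    potential K κ ri (nonemptyParts R₁ (parts.map (fun s => s.1))) +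
      potential K κ ri (nonemptyParts R₄ (parts.map (fun s => s.2.2))) +
      ((parts.map splitCost).sum : ℕ) + (K - 6) * runs.length + 2 * (R₂.length + R₃.length) ≤
      potential K κ ri runs := by
  have hL := h.left hκ hri hr
  have hR := h.right hκ hri hr
  -- The runs that pass whole to one side. All the others are cut, and so is the run of `μ`, which
  -- the `+ 1` in `cut` accounts for.
  set intact : List (Fin n) × List (Fin n) × List (Fin n) → Bool :=
    fun s => (s.2.1 = [] ∧ s.2.2 = []) ∨ (s.1 = [] ∧ s.2.1 = []) with hintact
  set cut := parts.countP (fun s => !(intact s)) + 1 with hcut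
  have hplen : parts.length + 1 = runs.length := by
    have := hr.perm.length_eq
    simpa using this.symm
  have hne : ∀ s ∈ parts, s.1 ++ (s.2.1 ++ s.2.2) ≠ [] := fun s hs => h.ne_nil _ (hr.mem_runs hs)
  -- the runs
  have hsum : ∀ l : List (List (Fin n) × List (Fin n) × List (Fin n)),
      (∀ s ∈ l, s.1 ++ (s.2.1 ++ s.2.2) ≠ []) →
      ((l.map splitCost).sum : ℝ) + 8 * K * l.countP (fun s => !(intact s)) +
        ((l.map (fun s => s.1)).map (fun r => runPotential (8 * K) r.length)).sum +
        ((l.map (fun s => s.2.2)).map (fun r => runPotential (8 * K) r.length)).sum ≤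
        ((l.map (fun s => s.1 ++ (s.2.1 ++ s.2.2))).map
          (fun r => runPotential (8 * K) r.length)).sum + 6 * l.length := by
    intro l
    induction l with
    | nil => simp
    | cons s l ih =>
      intro hl
      have h1 := ih (fun t ht => hl t (List.mem_cons_of_mem _ ht))
      have h2 := runPotential_split (c := 8 * K) (by linarith) s (hl s List.mem_cons_self)
      have h3 : (if (!intact s) = true then (1 : ℝ) else 0) = (if (s.2.1 = [] ∧ s.2.2 = []) ∨
          (s.1 = [] ∧ s.2.1 = []) then (0 : ℝ) else 1) := by
        by_cases hs : (s.2.1 = [] ∧ s.2.2 = []) ∨ (s.1 = [] ∧ s.2.1 = [])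
        · rw [show intact s = true from decide_eq_true hs, if_pos hs]
          rfl
        · rw [show intact s = false from decide_eq_false hs, if_neg hs]
          rfl
      simp only [List.map_cons, List.sum_cons, List.length_cons, List.countP_cons]
      push_cast at h1 ⊢
      rw [h3]
      linarith
  have hsum' := hsum parts hne
  have hown := runPotential_own (c := 8 * K) (by linarith) R₁ R₂ R₃ R₄ μ
  have hruns : (runs.map (fun r => runPotential (8 * K) r.length)).sum =
      runPotential (8 * K) (R₁ ++ (R₂ ++ μ :: (R₃ ++ R₄))).length +
      ((parts.map (fun s => s.1 ++ (s.2.1 ++ s.2.2))).map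
          (fun r => runPotential (8 * K) r.length)).sum := by
    rw [(hr.perm.map _).sum_eq, List.map_cons, List.sum_cons]
  -- the blocks
  obtain ⟨l1, l2⟩ := length_nonemptyParts R₁ (parts.map (fun s => s.1))
  obtain ⟨r1, r2⟩ := length_nonemptyParts R₄ (parts.map (fun s => s.2.2))
  rw [List.countP_map] at l1 l2 r1 r2
  have hcount : ∀ l : List (List (Fin n) × List (Fin n) × List (Fin n)),
      (∀ s ∈ l, s.1 ++ (s.2.1 ++ s.2.2) ≠ []) →
      l.countP ((fun r : List (Fin n) => decide (r ≠ [])) ∘ fun s => s.1) ≤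
        l.countP (fun s => s.2.1 = [] ∧ s.2.2 = []) + l.countP (fun s => !(intact s)) ∧
      l.countP ((fun r : List (Fin n) => decide (r ≠ [])) ∘ fun s => s.2.2) ≤
        l.countP (fun s => s.1 = [] ∧ s.2.1 = []) + l.countP (fun s => !(intact s)) ∧
      l.countP (fun s => s.2.1 = [] ∧ s.2.2 = []) ≤
        l.countP ((fun r : List (Fin n) => decide (r ≠ [])) ∘ fun s => s.1) ∧
      l.countP (fun s => s.1 = [] ∧ s.2.1 = []) ≤
        l.countP ((fun r : List (Fin n) => decide (r ≠ [])) ∘ fun s => s.2.2) ∧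
      l.length ≤ l.countP (fun s => s.2.1 = [] ∧ s.2.2 = []) +
        l.countP (fun s => s.1 = [] ∧ s.2.1 = []) + l.countP (fun s => !(intact s)) := by
    intro l
    induction l with
    | nil => simp
    | cons s l ih =>
      intro hl
      obtain ⟨c1, c2, c3, c4, c5⟩ := ih (fun t ht => hl t (List.mem_cons_of_mem _ ht))
      have hs := hl s List.mem_cons_self
      obtain ⟨x, y, z⟩ := s
      simp only [List.countP_cons, hintact, Function.comp_apply, List.length_cons]
      by_cases hx : x = [] <;> by_cases hy : y = [] <;> by_cases hz : z = [] <;>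
        simp [hx, hy, hz] at hs ⊢ <;> simp [hintact] at c1 c2 c3 c4 c5 <;> omega
  obtain ⟨c1, c2, c3, c4, c5⟩ := hcount parts hne
  have m1 := List.countP_le_length (l := parts)
    (p := (fun r : List (Fin n) => decide (r ≠ [])) ∘ fun s => s.1)
  have m2 := List.countP_le_length (l := parts)
    (p := (fun r : List (Fin n) => decide (r ≠ [])) ∘ fun s => s.2.2)
  have hperm := hr.flatten_perm
  have hnd := hperm.nodup_iff.1 h.nodup
  have hdrop := blockPotential_drop (blocks κ ri runs)
    (blocks κ ri (nonemptyParts R₁ (parts.map (fun s => s.1))))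
    (blocks κ ri (nonemptyParts R₄ (parts.map (fun s => s.2.2))))
    (fun p => Real.logb 2 (classRuns κ ri p.1)) runs.length
    (nonemptyParts R₁ (parts.map (fun s => s.1))).length
    (nonemptyParts R₄ (parts.map (fun s => s.2.2))).length
    (parts.countP (fun s => s.2.1 = [] ∧ s.2.2 = []))
    (parts.countP (fun s => s.1 = [] ∧ s.2.1 = [])) cut K (by linarith)
    (fun p hp => by
      obtain ⟨x, hx, rfl⟩ := mem_blocks.1 hp
      exact mem_blocks.2 ⟨x, hperm.symm.subset (List.mem_append_left _ hx), rfl⟩)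
    (fun p hp => by
      obtain ⟨x, hx, rfl⟩ := mem_blocks.1 hp
      exact mem_blocks.2 ⟨x, hperm.symm.subset
        (List.mem_append_right _ (List.mem_append_right _ hx)), rfl⟩)
    (by
      rw [Finset.disjoint_left]
      intro p hp hp'
      obtain ⟨x, hx, rfl⟩ := mem_blocks.1 hp
      obtain ⟨y, hy, hxy⟩ := mem_blocks.1 hp'
      -- A class that meets the left subproblem lies in it entirely, so no block is counted on both
      -- sides.
      exact (List.nodup_append'.1 hnd).2.2 (hL.closed x hx y (congrArg Prod.fst hxy))
        (List.mem_append_right _ hy))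
    (fun p hp => h.logb_classRuns_le hp) hL.length_le_card_blocks hR.length_le_card_blocks
    blocks_eq_empty blocks_eq_empty (by omega) (by omega) (by omega) (by omega) hr.few_left
    hr.few_right (by omega) (by omega) (by omega)
  rw [potential, potential, potential, sum_nonemptyParts _ (runPotential_zero _),
    sum_nonemptyParts _ (runPotential_zero _), hruns]
  have hcut' : (cut : ℝ) = (parts.countP (fun s => !(intact s)) : ℝ) + 1 := by
    rw [hcut]; push_cast; ring
  have hplen' : (parts.length : ℝ) + 1 = runs.length := by exact_mod_cast hplen
  rw [hcut'] at hdrop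
  linarith

theorem sortRuns_cost_le (hκ : ∀ x y, a x ≤ a y → κ x ≤ κ y)
    (hri : ∀ x y, κ x = κ y → a x ≠ a y → ri x = ri y) :
    ∀ (fuel : ℕ) (runs : List (List (Fin n))), IsNode a κ ri runs →
      ((sortRuns fuel runs).cost a : ℝ) ≤ potential (6 * 4 ^ 60 + 8) κ ri runs := by
  intro fuel
  induction fuel with
  | zero =>
    intro runs h
    simpa [sortRuns] using potential_nonneg (by norm_num) h
  | succ fuel ih =>
    intro runs h
    by_cases hne : runs = []
    · rw [hne, sortRuns_nil, cost_pure, Nat.cast_zero, ← hne]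
      exact potential_nonneg (by norm_num) h
    obtain ⟨μ, R₁, R₂, R₃, R₄, parts, hr, -, hcost⟩ := exists_round a fuel runs h.toIsRuns hne
    have h1 := ih _ (h.left hκ hri hr)
    have h2 := ih _ (h.right hκ hri hr)
    -- The value of `K` is such that `K - 6` is the cost per run `6 * 4 ^ 60 + 2` of a round; the 6
    -- is what each split leaves unpaid.
    have h3 := round_potential hκ hri (K := 6 * 4 ^ 60 + 8) (by norm_num) h hr
    have h4 : ((sortRuns (fuel + 1) runs).cost a : ℝ) ≤
        (sortRuns fuel (nonemptyParts R₁ (parts.map (fun s => s.1)))).cost a +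
        (sortRuns fuel (nonemptyParts R₄ (parts.map (fun s => s.2.2)))).cost a +
        ((parts.map splitCost).sum : ℕ) + (6 * 4 ^ 60 + 2) * runs.length +
        2 * (R₂.length + R₃.length) := by exact_mod_cast hcost
    generalize (4 : ℝ) ^ 60 = X at *
    linarith

end QuickSynergy


/-! ### Comparison of two decompositions of a list, and double counting. -/

section Lists

variable {β γ : Type*}

theorem exists_lift_flatten (f : β → γ) (L : List (List γ)) (l : List β)
    (h : L.flatten = l.map f) :
    ∃ L' : List (List β), L'.flatten = l ∧ L'.map (List.map f) = L := by
  induction L generalizing l with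
  | nil => exact ⟨[], by simpa using h.symm, rfl⟩
  | cons r L ih =>
    rw [List.flatten_cons] at h
    obtain ⟨l₁, l₂, rfl, h1, h2⟩ := List.map_eq_append_iff.1 h.symm
    obtain ⟨L', h3, h4⟩ := ih l₂ h2.symm
    exact ⟨l₁ :: L', by rw [List.flatten_cons, h3], by rw [List.map_cons, h1, h4]⟩

/-- If consecutive pieces of a list are separated by failures of `R`, then every piece along
which `R` holds is contained in one of them. -/
theorem exists_subset_of_isChain (R : β → β → Prop) (L rs : List (List β))
    (h : L.flatten = rs.flatten) (hL : ∀ s ∈ L, s.IsChain R) (hne : ∀ r ∈ rs, r ≠ [])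
    (hrs : rs.IsChain (fun r s => ∀ x ∈ r.getLast?, ∀ y ∈ s.head?, ¬ R x y)) :
    ∀ s ∈ L, s ≠ [] → ∃ r ∈ rs, s ⊆ r := by
  induction L generalizing rs with
  | nil => simp
  | cons s L ih =>
    have hL' : ∀ s ∈ L, s.IsChain R := fun t ht => hL t (List.mem_cons_of_mem _ ht)
    cases rs with
    | nil =>
      intro t ht htne
      have : t ⊆ (s :: L).flatten := fun x hx => List.mem_flatten.2 ⟨t, ht, hx⟩
      rw [h] at this
      exact absurd (List.eq_nil_of_subset_nil this) htne
    | cons r rs =>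
      have hr := hne r List.mem_cons_self
      have hne' : ∀ r ∈ rs, r ≠ [] := fun t ht => hne t (List.mem_cons_of_mem _ ht)
      rw [List.flatten_cons, List.flatten_cons, List.append_eq_append_iff] at h
      -- Either `s` fits into `r`, and the induction continues with the rest `r₂` as the first
      -- piece, or `s` is `r` followed by `s₂`. In the latter case a nonempty `s₂` would make `R`
      -- hold across the boundary after `r`.
      rcases h with ⟨r₂, h1, h2⟩ | ⟨s₂, h1, h2⟩
      · have key : ∀ t ∈ L, t ≠ [] → ∃ r' ∈ r :: rs, t ⊆ r' := by
          by_cases h3 : r₂ = []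
          · subst h3
            intro t ht htne
            obtain ⟨r', hr', htr⟩ := ih rs (by simpa using h2) hL' hne' hrs.tail t ht htne
            exact ⟨r', List.mem_cons_of_mem _ hr', htr⟩
          · have hchain : (r₂ :: rs).IsChain
                (fun r s => ∀ x ∈ r.getLast?, ∀ y ∈ s.head?, ¬ R x y) := by
              cases rs with
              | nil => simp
              | cons q rs =>
                rw [List.isChain_cons_cons] at hrs ⊢
                refine ⟨fun x hx => hrs.1 x ?_, hrs.2⟩
                rw [h1, Option.mem_def, List.getLast?_append, Option.mem_def.1 hx]
                rfl
            intro t ht htne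
            obtain ⟨r', hr', htr⟩ := ih (r₂ :: rs) (by rw [List.flatten_cons, h2]) hL'
              (fun q hq => by
                rcases List.mem_cons.1 hq with rfl | hq
                · exact h3
                · exact hne' q hq) hchain t ht htne
            rcases List.mem_cons.1 hr' with rfl | hr'
            · refine ⟨r, List.mem_cons_self, fun x hx => ?_⟩
              rw [h1]
              exact List.mem_append_right _ (htr hx)
            · exact ⟨r', List.mem_cons_of_mem _ hr', htr⟩
        intro t ht htne
        rcases List.mem_cons.1 ht with rfl | ht
        · exact ⟨r, List.mem_cons_self, by rw [h1]; exact List.subset_append_left _ _⟩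
        · exact key t ht htne
      · by_cases h3 : s₂ = []
        · subst h3
          rw [List.append_nil] at h1
          intro t ht htne
          rcases List.mem_cons.1 ht with rfl | ht
          · exact ⟨r, List.mem_cons_self, by rw [h1]; exact List.Subset.refl _⟩
          · obtain ⟨r', hr', htr⟩ := ih rs (by simpa using h2.symm) hL' hne' hrs.tail t ht htne
            exact ⟨r', List.mem_cons_of_mem _ hr', htr⟩
        · exfalso
          have hs := hL s List.mem_cons_self
          rw [h1, List.isChain_append] at hs
          match rs, s₂, h3, h2, hrs, hne' with
          | [], y :: s₂, _, h2, _, _ => simp at h2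
          | [] :: rs, _, _, _, _, hne' => exact hne' [] List.mem_cons_self rfl
          | (y' :: q) :: rs, y :: s₂, _, h2, hrs, _ =>
            obtain rfl : y' = y := by
              have := congrArg List.head? h2
              simpa using this
            rw [List.isChain_cons_cons] at hrs
            have hx := List.getLast?_eq_some_getLast hr
            exact hrs.1 _ hx y' rfl (hs.2.2 _ hx y' rfl)

/-- Disjoint lists can be told apart by labels of their elements. -/
theorem exists_label [DecidableEq β] (rs : List (List β)) (h : rs.flatten.Nodup) :
    ∃ f : β → ℕ, (∀ r ∈ rs, ∀ x ∈ r, ∀ y ∈ r, f x = f y) ∧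
      rs.Pairwise (fun r s => ∀ x ∈ r, ∀ y ∈ s, f x ≠ f y) := by
  induction rs with
  | nil => exact ⟨fun _ => 0, by simp, by simp⟩
  | cons r rs ih =>
    rw [List.flatten_cons, List.nodup_append'] at h
    obtain ⟨f, h1, h2⟩ := ih h.2.1
    have hout : ∀ s ∈ rs, ∀ x ∈ s, x ∉ r := fun s hs x hx hxr =>
      h.2.2 hxr (List.mem_flatten.2 ⟨s, hs, hx⟩)
    refine ⟨fun x => if x ∈ r then 0 else f x + 1, fun s hs x hx y hy => ?_, ?_⟩
    · rcases List.mem_cons.1 hs with rfl | hs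
      · simp [hx, hy]
      · simp [hout s hs x hx, hout s hs y hy, h1 s hs x hx y hy]
    · rw [List.pairwise_cons]
      refine ⟨fun s hs x hx y hy => by simp [hx, hout s hs y hy], ?_⟩
      refine h2.imp_of_mem fun {s t} hs ht hst x hx y hy => ?_
      simpa [hout s hs x hx, hout t ht y hy] using hst x hx y hy

theorem sum_le_sum_of_subset_toFinset (f : ℕ → ℝ) (hf : ∀ c, 0 ≤ f c) (l : List ℕ)
    (S : Finset ℕ) (h : S ⊆ l.toFinset) : ∑ c ∈ S, f c ≤ (l.map f).sum := by
  induction l generalizing S with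
  | nil =>
    rw [List.toFinset_nil, Finset.subset_empty] at h
    simp [h]
  | cons c t ih =>
    have h1 : S.erase c ⊆ t.toFinset := by
      rw [List.toFinset_cons] at h
      intro x hx
      rw [Finset.mem_erase] at hx
      exact (Finset.mem_insert.1 (h hx.2)).resolve_left hx.1
    have h2 := ih _ h1
    rw [List.map_cons, List.sum_cons]
    by_cases hc : c ∈ S
    · rw [← Finset.add_sum_erase S f hc]
      linarith
    · rw [Finset.erase_eq_of_notMem hc] at h2
      have := hf c
      linarith

theorem sum_countP_swap (l : List β) (m : List γ) (p : β → γ → Bool) :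
    (l.map (fun x => m.countP (p x))).sum = (m.map (fun y => l.countP (fun x => p x y))).sum := by
  induction l with
  | nil => simp
  | cons x l ih =>
    simp only [List.map_cons, List.sum_cons, ih, List.countP_cons]
    rw [List.sum_map_add, add_comm]
    congr 1
    clear ih
    induction m with
    | nil => rfl
    | cons y m ihm => rw [List.countP_cons, List.map_cons, List.sum_cons, ihm, add_comm]

end Lists

/-! ### Members and blocks of the output partition. -/

section OutputPartition

variable {α : Type*} [LinearOrder α] (L : List (List α))

theorem flatten_outputPartition :
    (outputPartition L).flatten = L.flatten.toFinset.sort (· ≤ ·) :=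
  List.flatten_splitBy _ _

theorem ne_nil_of_mem_outputPartition {V : List α} (hV : V ∈ outputPartition L) : V ≠ [] :=
  List.ne_nil_of_mem_splitBy hV

theorem mem_flatten_outputPartition {x : α} :
    x ∈ (outputPartition L).flatten ↔ x ∈ L.flatten := by
  rw [flatten_outputPartition, Finset.mem_sort, List.mem_toFinset]

theorem sorted_outputPartition :
    (∀ V ∈ outputPartition L, V.Pairwise (· < ·)) ∧
      (outputPartition L).Pairwise (fun V W => ∀ x ∈ V, ∀ y ∈ W, x < y) := by
  rw [← List.pairwise_flatten, flatten_outputPartition]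
  exact (Finset.sortedLT_sort _).pairwise

/-- The relation between neighbours is symmetric and transitive, so it extends from neighbours to
all pairs of distinct values of a member. -/
theorem holders_of_mem_outputPartition {V : List α} (hV : V ∈ outputPartition L) {u v : α}
    (hu : u ∈ V) (hv : v ∈ V) (huv : u ≠ v) :
    holders L u = holders L v ∧ (holders L u).card = 1 := by
  have h := List.isChain_of_mem_splitBy hV
  simp only [decide_eq_true_eq] at h
  have : IsTrans α (fun u v => holders L u = holders L v ∧ (holders L u).card = 1) :=
    ⟨fun _ _ _ h h' => ⟨h.1.trans h'.1, h.2⟩⟩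
  have : Std.Symm (fun u v => holders L u = holders L v ∧ (holders L u).card = 1) :=
    ⟨fun _ _ h => ⟨h.1.symm, h.1 ▸ h.2⟩⟩
  exact (List.isChain_iff_pairwise.1 h).forall hu hv huv

theorem memberValue_pos {V : List α} (hV : V ∈ outputPartition L) : 0 < memberValue L V := by
  obtain ⟨x, hx⟩ := List.exists_mem_of_ne_nil V (ne_nil_of_mem_outputPartition L hV)
  have hxL := (mem_flatten_outputPartition L).1 (List.mem_flatten.2 ⟨V, hV, hx⟩)
  obtain ⟨r, hr, hxr⟩ := List.mem_flatten.1 hxL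
  exact List.countP_pos_iff.2 ⟨r, hr, List.any_eq_true.2 ⟨x, hxr, by simpa using hx⟩⟩

theorem memberValue_le (V : List α) : memberValue L V ≤ L.length := List.countP_le_length

theorem length_memberBlocks (V : List α) : (memberBlocks L V).length = memberValue L V := by
  rw [memberBlocks, memberValue, ← List.countP_eq_length_filter, List.countP_map]
  refine List.countP_congr fun r _ => ?_
  simp [List.countP_pos_iff]

theorem length_blockSizes : (blockSizes L).length = (partitionValues L).sum := by
  rw [blockSizes, List.length_flatMap, partitionValues]
  simp only [length_memberBlocks]

theorem blockSizes_pos : ∀ k ∈ blockSizes L, 0 < k := by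
  intro k hk
  rw [blockSizes, List.mem_flatMap] at hk
  obtain ⟨V, -, hk⟩ := hk
  rw [memberBlocks, List.mem_filter] at hk
  simpa using hk.2

theorem partitionValues_mem {k : ℕ} (hk : k ∈ partitionValues L) : 1 ≤ k ∧ k ≤ L.length := by
  obtain ⟨V, hV, rfl⟩ := List.mem_map.1 hk
  exact ⟨memberValue_pos L hV, memberValue_le L V⟩

theorem countP_outputPartition {x : α} (hx : x ∈ L.flatten) :
    (outputPartition L).countP (fun V => decide (x ∈ V)) = 1 := by
  have hmem := (mem_flatten_outputPartition L).2 hx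
  have hnd : (outputPartition L).flatten.Nodup := by
    rw [flatten_outputPartition]
    exact Finset.sort_nodup _ _
  have h1 := List.count_eq_one_of_mem hnd hmem
  rw [List.count_flatten] at h1
  rw [← h1]
  clear h1
  have hnd' := (List.nodup_flatten.1 hnd).1
  generalize outputPartition L = P at hnd'
  induction P with
  | nil => rfl
  | cons V P ih =>
    rw [List.countP_cons, List.map_cons, List.sum_cons,
      ih (fun W hW => hnd' W (List.mem_cons_of_mem _ hW)),
      List.Nodup.count (hnd' V List.mem_cons_self)]
    simp only [decide_eq_true_eq]
    omega

/-- Double counting of pairs of an element and a member that contains its value; every value is in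
exactly one member. -/
theorem sum_blockSizes : (blockSizes L).sum = L.flatten.length := by
  have h1 : ∀ V, (memberBlocks L V).sum = L.flatten.countP (fun x => decide (x ∈ V)) := by
    intro V
    rw [memberBlocks, List.countP_flatten]
    induction L with
    | nil => rfl
    | cons r L ih =>
      rw [List.map_cons]
      by_cases h : 0 < r.countP (fun x => decide (x ∈ V))
      · rw [List.filter_cons_of_pos (by simpa using h), List.sum_cons, ih, List.sum_cons]
      · rw [List.filter_cons_of_neg (by simpa using h), ih, List.sum_cons, Nat.eq_zero_of_not_pos h,
          zero_add]
  rw [blockSizes, List.flatMap_def, List.sum_flatten, List.map_map]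
  simp only [Function.comp_def, h1]
  rw [sum_countP_swap (outputPartition L) L.flatten (fun V x => decide (x ∈ V))]
  have : ∀ x ∈ L.flatten, (outputPartition L).countP (fun V => decide (x ∈ V)) = 1 :=
    fun x hx => countP_outputPartition L hx
  rw [List.map_congr_left this, List.map_const', List.sum_replicate, smul_eq_mul, mul_one]

theorem length_le_sum_partitionValues (hne : ∀ r ∈ L, r ≠ []) :
    L.length ≤ (partitionValues L).sum := by
  have : (partitionValues L).sum = ((outputPartition L).map (fun V =>
      L.countP (fun r => r.any (fun x => decide (x ∈ V))))).sum := rfl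
  rw [this, sum_countP_swap (outputPartition L) L
    (fun V r => r.any (fun x => decide (x ∈ V)))]
  have h1 : ∀ k ∈ L.map (fun r => (outputPartition L).countP
      (fun V => r.any (fun x => decide (x ∈ V)))), 1 ≤ k := by
    intro k hk
    obtain ⟨r, hr, rfl⟩ := List.mem_map.1 hk
    obtain ⟨x, hx⟩ := List.exists_mem_of_ne_nil r (hne r hr)
    obtain ⟨V, hV, hxV⟩ := List.mem_flatten.1
      ((mem_flatten_outputPartition L).2 (List.mem_flatten.2 ⟨r, hr, hx⟩))
    exact List.countP_pos_iff.2 ⟨V, hV, List.any_eq_true.2 ⟨x, hx, by simpa using hxV⟩⟩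
  have h2 := List.length_le_sum_of_one_le _ h1
  rwa [List.length_map] at h2

end OutputPartition

/-! ### Estimates for binomial coefficients. -/

section Bounds

theorem logb_two_le_self {x : ℝ} (hx : 0 < x) : Real.logb 2 x ≤ x := by
  have h1 := Real.log_le_sub_one_of_pos (show 0 < x / 2 by positivity)
  rw [Real.log_div hx.ne' two_ne_zero] at h1
  have h2 := Real.log_two_gt_d9
  have h3 := Real.log_two_lt_d9
  rw [Real.logb, div_le_iff₀ (by linarith)]
  nlinarith

/-- Split off the first factor of the binomial coefficient; replacing `r + 1` and `m + 1` by `r` and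
`m` does not decrease the quotient. -/
theorem div_pow_le_choose (m r : ℕ) (h : m ≤ r) : ((r : ℝ) / m) ^ m ≤ r.choose m := by
  induction m generalizing r with
  | zero => simp
  | succ m ih =>
    cases r with
    | zero => omega
    | succ r =>
      have hmr : m ≤ r := by omega
      have h1 := ih r hmr
      have h2 : ((r + 1 : ℕ) / (m + 1 : ℕ) : ℝ) ^ m ≤ ((r : ℝ) / m) ^ m := by
        rcases Nat.eq_zero_or_pos m with rfl | hm
        · simp
        · refine pow_le_pow_left₀ (by positivity) ?_ _
          have hm' : (0 : ℝ) < m := by exact_mod_cast hm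
          have hmr' : (m : ℝ) ≤ r := by exact_mod_cast hmr
          rw [div_le_div_iff₀ (by positivity) hm']
          push_cast
          nlinarith
      have h3 : ((r + 1 : ℕ) : ℝ) * r.choose m = (r + 1).choose (m + 1) * (m + 1 : ℕ) := by
        exact_mod_cast Nat.add_one_mul_choose_eq r m
      have h4 : ((r + 1).choose (m + 1) : ℝ) = ((r + 1 : ℕ) / (m + 1 : ℕ) : ℝ) * r.choose m := by
        rw [div_mul_eq_mul_div, h3, mul_div_cancel_right₀ _ (by positivity)]
      rw [h4, pow_succ']
      exact mul_le_mul_of_nonneg_left (h2.trans h1) (by positivity)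

/-- Here `k` and `μ` count maximal runs, `r` and `m` those of a given finer decomposition. Write
`log(r / μ)` as `log(r / m) + log(m / μ)`: the first term is bounded by the binomial coefficient,
and `μ log(m / μ) ≤ m`. -/
theorem mul_logb_sub_le {μ m k r : ℕ} (hμ : 0 < μ) (hμm : μ ≤ m) (hmr : m ≤ r) (hk : 0 < k)
    (hkr : k ≤ r) :
    (μ : ℝ) * (Real.logb 2 k - Real.logb 2 μ) ≤ Real.logb 2 (r.choose m) + m := by
  have hμ' : (0 : ℝ) < μ := by exact_mod_cast hμ
  have hμm' : (μ : ℝ) ≤ m := by exact_mod_cast hμm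
  have hm' : (0 : ℝ) < m := hμ'.trans_le hμm'
  have hmr' : (m : ℝ) ≤ r := by exact_mod_cast hmr
  have hr' : (0 : ℝ) < r := hm'.trans_le hmr'
  have h1 : Real.logb 2 k ≤ Real.logb 2 r :=
    Real.logb_le_logb_of_le one_lt_two (by exact_mod_cast hk) (by exact_mod_cast hkr)
  have h2 : (μ : ℝ) * (Real.logb 2 m - Real.logb 2 μ) ≤ m := by
    have := logb_two_le_self (x := (m : ℝ) / μ) (by positivity)
    rw [Real.logb_div hm'.ne' hμ'.ne', le_div_iff₀ hμ'] at this
    linarith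
  have h3 : (m : ℝ) * (Real.logb 2 r - Real.logb 2 m) ≤ Real.logb 2 (r.choose m) := by
    rw [← Real.logb_div hr'.ne' hm'.ne', ← Real.logb_pow]
    exact Real.logb_le_logb_of_le one_lt_two (by positivity) (div_pow_le_choose m r hmr)
  have h4 : 0 ≤ Real.logb 2 r - Real.logb 2 m :=
    sub_nonneg.2 (Real.logb_le_logb_of_le one_lt_two hm' hmr')
  have h5 := mul_le_mul_of_nonneg_right hμm' h4
  have h6 := mul_le_mul_of_nonneg_left h1 hμ'.le
  linarith

end Bounds


/-! ### The upper bound in terms of an arbitrary decomposition. -/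

section UpperBound

variable {α : Type*} [LinearOrder α] (L : List (List α))

/-- The number of members of the partition that lie below a value. -/
def memberRank (v : α) : ℕ := (outputPartition L).countP (fun V => V.all (fun w => decide (w < v)))

theorem memberRank_mono {u v : α} (h : u ≤ v) : memberRank L u ≤ memberRank L v := by
  refine List.countP_mono_left fun V _ hV => ?_
  simp only [List.all_eq_true, decide_eq_true_eq] at hV ⊢
  exact fun w hw => (hV w hw).trans_le h

theorem memberRank_lt {V : List α} (hV : V ∈ outputPartition L) {u v : α} (hu : u ∈ V)
    (hv : v ∈ L.flatten) (hvV : v ∉ V) (huv : u < v) : memberRank L u < memberRank L v := by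
  obtain ⟨W, hW, hvW⟩ := List.mem_flatten.1 ((mem_flatten_outputPartition L).2 hv)
  obtain ⟨s, t, hst⟩ := List.append_of_mem hV
  have hs := (sorted_outputPartition L).2
  have hall : ∀ w ∈ V, w < v := by
    rw [hst, List.pairwise_append, List.pairwise_cons] at hs
    rw [hst, List.mem_append, List.mem_cons] at hW
    rcases hW with hW | rfl | hW
    · exact absurd (hs.2.2 W hW V List.mem_cons_self v hvW u hu) huv.not_gt
    · exact absurd hvW hvV
    · exact fun w hw => hs.2.1.1 W hW w hw v hvW
  rw [memberRank, memberRank, hst, List.countP_append, List.countP_append, List.countP_cons,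
    List.countP_cons, if_neg (by simpa using ⟨u, hu, le_rfl⟩), if_pos (by simpa using hall)]
  have hmono : ∀ l : List (List α), l.countP (fun V => V.all (fun w => decide (w < u))) ≤
      l.countP (fun V => V.all (fun w => decide (w < v))) := fun l =>
    List.countP_mono_left fun V _ hV => by
      simp only [List.all_eq_true, decide_eq_true_eq] at hV ⊢
      exact fun w hw => (hV w hw).trans huv
  have h1 := hmono s
  have h2 := hmono t
  omega

theorem memberRank_eq {V : List α} (hV : V ∈ outputPartition L) {u v : α} (hu : u ∈ V)
    (hv : v ∈ V) : memberRank L u = memberRank L v := by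
  have hs := (sorted_outputPartition L).2
  obtain ⟨s, t, hst⟩ := List.append_of_mem hV
  rw [hst, List.pairwise_append, List.pairwise_cons] at hs
  refine List.countP_congr fun W hW => ?_
  simp only [List.all_eq_true, decide_eq_true_eq]
  have key : ∀ u ∈ V, ∀ v ∈ V, (∀ w ∈ W, w < u) → ∀ w ∈ W, w < v := by
    intro u hu v hv h w hw
    rw [hst, List.mem_append, List.mem_cons] at hW
    rcases hW with hW | rfl | hW
    · exact hs.2.2 W hW V List.mem_cons_self w hw v hv
    · exact absurd (h u hu) (lt_irrefl _)
    · exact absurd (hs.2.1.1 W hW u hu w hw) (h w hw).not_gt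
  exact ⟨key u hu v hv, key v hv u hu⟩

/-- Together with monotonicity, this makes the rank usable as the class function `κ` of the
potential argument: its classes are exactly the members. -/
theorem mem_of_memberRank_eq {V : List α} (hV : V ∈ outputPartition L) {u v : α} (hu : u ∈ V)
    (hv : v ∈ L.flatten) (h : memberRank L u = memberRank L v) : v ∈ V := by
  by_contra hvV
  rcases lt_trichotomy u v with huv | rfl | huv
  · exact (memberRank_lt L hV hu hv hvV huv).ne h
  · exact hvV hu
  · obtain ⟨W, hW, hvW⟩ := List.mem_flatten.1 ((mem_flatten_outputPartition L).2 hv)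
    have huW : u ∉ W := fun huW => by
      have h1 := countP_outputPartition L
        ((mem_flatten_outputPartition L).1 (List.mem_flatten.2 ⟨V, hV, hu⟩))
      have hVW : V ≠ W := by rintro rfl; exact hvV hvW
      obtain ⟨s, t, hst⟩ := List.append_of_mem hV
      rw [hst] at hW h1
      have hW' : W ∈ s ++ t := by
        simp only [List.mem_append, List.mem_cons] at hW ⊢
        rcases hW with hW | rfl | hW
        · exact Or.inl hW
        · exact absurd rfl hVW
        · exact Or.inr hW
      have h2 : 0 < (s ++ t).countP (fun V => decide (u ∈ V)) :=
        List.countP_pos_iff.2 ⟨W, hW', by simpa using huW⟩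
      rw [List.countP_append, List.countP_cons, if_pos (by simpa using hu)] at h1
      rw [List.countP_append] at h2
      omega
    exact (memberRank_lt L hW hvW ((mem_flatten_outputPartition L).1
      (List.mem_flatten.2 ⟨V, hV, hu⟩)) huW huv).ne h.symm

theorem logb_natCast_nonneg (k : ℕ) : 0 ≤ Real.logb 2 (k : ℝ) := by
  rcases Nat.eq_zero_or_pos k with rfl | h
  · simp
  · exact Real.logb_nonneg one_lt_two (by exact_mod_cast h)

theorem sum_map_logb_nonneg (l : List ℕ) (f : ℕ → ℕ) :
    0 ≤ (l.map (fun k : ℕ => Real.logb 2 (f k))).sum := by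
  refine List.sum_nonneg fun x hx => ?_
  obtain ⟨k, -, rfl⟩ := List.mem_map.1 hx
  exact logb_natCast_nonneg _

/-- In the definition, the list `g` itself is coerced to a list of reals; here the cast is moved to
its entries. -/
theorem synergyBound_eq (n ρ : ℕ) (g m : List ℕ) :
    synergyBound n ρ g m = n + (g.map (fun k : ℕ => Real.logb 2 (k : ℝ))).sum +
      (m.map (fun k : ℕ => Real.logb 2 (ρ.choose k : ℝ))).sum := by
  have h : (do let k ← g; pure (k : ℝ) : List ℝ) = g.map (fun k : ℕ => (k : ℝ)) :=
    List.flatMap_pure_eq_map _ _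
  rw [synergyBound, h, List.map_map]
  rfl

open QuickSynergy in
-- The potential is evaluated at the root with mixed data: the classes are the members of the given
-- decomposition `L`, while the labels `ri` refer to the maximal runs that the algorithm detects.
theorem quickSynergySort_cost_le {n : ℕ} (a : Fin n → α) (h : IsRunDecomposition a L) :
    ((quickSynergySort n).cost a : ℝ) ≤ (20 * (6 * 4 ^ 60 + 8)) *
      synergyBound n L.length (blockSizes L) (partitionValues L) := by
  obtain ⟨hflat, hruns⟩ := h
  obtain ⟨L', hL1, hL2⟩ := exists_lift_flatten a L (List.finRange n)
    (by rw [hflat, List.ofFn_eq_map])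
  obtain ⟨d1, d2, d3, d4⟩ := detectRuns_spec a (List.finRange n)
  have hIs := isRuns_detectRuns a
  rw [quickSynergySort, Comp.cost_bind]
  set rs := (detectRuns (List.finRange n)).eval a with hrs
  obtain ⟨ri, hri1, hri2⟩ := exists_label rs (by rw [d1]; exact List.nodup_finRange n)
  have hL'mem : ∀ s ∈ L', s ≠ [] ∧ s.map a ∈ L := by
    intro s hs
    have hm : s.map a ∈ L := by rw [← hL2]; exact List.mem_map.2 ⟨s, hs, rfl⟩
    exact ⟨fun h0 => (hruns _ hm).1 (by rw [h0]; rfl), hm⟩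
  have hsub : ∀ s ∈ L', ∃ r ∈ rs, s ⊆ r := by
    intro s hs
    refine exists_subset_of_isChain (fun x y => a x ≤ a y) L' rs (by rw [hL1, d1]) ?_
      (fun r hr => (d2 r hr).1) ?_ s hs (hL'mem s hs).1
    · intro s hs
      exact (List.pairwise_map.1 (hruns _ (hL'mem s hs).2).2).isChain
    · exact d3.imp fun {r s} hrs x hx y hy => not_le.2 (hrs x hx y hy)
  have hsame : ∀ s ∈ L', ∀ x ∈ s, ∀ y ∈ s, ri x = ri y := by
    intro s hs x hx y hy
    obtain ⟨r, hr, hsr⟩ := hsub s hs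
    exact hri1 r hr x (hsr hx) y (hsr hy)
  have hex : ∀ x : Fin n, ∃ s ∈ L', x ∈ s := fun x =>
    List.mem_flatten.1 (by rw [hL1]; exact List.mem_finRange x)
  have hval : ∀ x : Fin n, a x ∈ L.flatten := fun x => by
    rw [hflat, List.mem_ofFn]
    exact ⟨x, rfl⟩
  set κ : Fin n → ℕ := fun x => memberRank L (a x) with hκdef
  have hmember : ∀ x : Fin n, ∃ V ∈ outputPartition L, a x ∈ V := fun x =>
    List.mem_flatten.1 ((mem_flatten_outputPartition L).2 (hval x))
  -- Two different values in one member occur in a single run of `L` only, and this run is contained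
  -- in a maximal one.
  have hκri : ∀ x y, κ x = κ y → a x ≠ a y → ri x = ri y := by
    intro x y hxy hne
    obtain ⟨V, hV, hxV⟩ := hmember x
    have hyV := mem_of_memberRank_eq L hV hxV (hval y) hxy
    obtain ⟨h1, h2⟩ := holders_of_mem_outputPartition L hV hxV hyV hne
    obtain ⟨s, hs, hxs⟩ := hex x
    obtain ⟨t, ht, hyt⟩ := hex y
    obtain ⟨i, hi, rfl⟩ := List.mem_iff_getElem.1 hs
    obtain ⟨j, hj, rfl⟩ := List.mem_iff_getElem.1 ht
    have hlen : L.length = L'.length := by rw [← hL2, List.length_map]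
    have hget : ∀ (i : ℕ) (hi : i < L'.length), L[i]'(by omega) = (L'[i]).map a := by
      intro i hi
      simp only [← hL2, List.getElem_map]
    have hi' : (⟨i, by omega⟩ : Fin L.length) ∈ holders L (a x) := by
      simp only [holders, Finset.mem_filter, Finset.mem_univ, true_and, List.get_eq_getElem,
        hget i hi]
      exact List.mem_map.2 ⟨x, hxs, rfl⟩
    have hj' : (⟨j, by omega⟩ : Fin L.length) ∈ holders L (a x) := by
      rw [h1]
      simp only [holders, Finset.mem_filter, Finset.mem_univ, true_and, List.get_eq_getElem,
        hget j hj]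
      exact List.mem_map.2 ⟨y, hyt, rfl⟩
    have hij := Finset.card_le_one.1 h2.le _ hi' _ hj'
    obtain rfl : i = j := by simpa using hij
    exact hsame _ hs x hxs y hyt
  have hnode : IsNode a κ ri rs := by
    refine ⟨hIs, hri1, hri2, fun x _ y _ => ?_⟩
    rw [d1]
    exact List.mem_finRange y
  have hcost : ((sortRuns n rs).cost a : ℝ) ≤ potential (6 * 4 ^ 60 + 8) κ ri rs :=
    sortRuns_cost_le (fun x y h => memberRank_mono L h) hκri n rs hnode
  -- labels of the given runs
  set lab : List (Fin n) → ℕ := fun s => (s.head?.map ri).getD 0 with hlab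
  have hlab' : ∀ s ∈ L', ∀ x ∈ s, ri x = lab s := by
    intro s hs x hx
    cases s with
    | nil => simp at hx
    | cons y t => simpa [hlab] using hsame _ hs x hx y List.mem_cons_self
  have hρ : rs.length ≤ L.length := by
    obtain ⟨f, hf, hnd⟩ := hnode.exists_key
    rw [← List.length_map (f := f), ← List.toFinset_card_of_nodup hnd, ← hL2, List.length_map,
      ← List.length_map (f := lab)]
    refine le_trans (Finset.card_le_card fun j hj => ?_) (List.toFinset_card_le _)
    rw [List.mem_toFinset, List.mem_map] at hj ⊢
    obtain ⟨r, hr, rfl⟩ := hj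
    obtain ⟨x, hx⟩ := List.exists_mem_of_ne_nil r (hnode.ne_nil r hr)
    obtain ⟨s, hs, hxs⟩ := hex x
    exact ⟨s, hs, by rw [← hlab' s hs x hxs, hf r hr x hx]⟩
  have hclass : ∀ V ∈ outputPartition L, ∀ v ∈ V,
      classRuns κ ri (memberRank L v) ≤ memberValue L V := by
    intro V hV v hv
    have h1 : memberValue L V = (L'.filter (fun s => s.any (fun x => decide (a x ∈ V)))).length := by
      rw [memberValue, ← hL2, List.countP_map, ← List.countP_eq_length_filter]
      refine List.countP_congr fun s _ => ?_
      simp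
    rw [h1, ← List.length_map (f := lab)]
    refine le_trans (Finset.card_le_card fun j hj => ?_) (List.toFinset_card_le _)
    simp only [Finset.mem_image, Finset.mem_filter, Finset.mem_univ, true_and] at hj
    obtain ⟨x, hx, rfl⟩ := hj
    obtain ⟨s, hs, hxs⟩ := hex x
    rw [List.mem_toFinset, List.mem_map]
    refine ⟨s, List.mem_filter.2 ⟨hs, List.any_eq_true.2 ⟨x, hxs, ?_⟩⟩, (hlab' s hs x hxs).symm⟩
    simpa using mem_of_memberRank_eq L hV hv (hval x) hx.symm
  -- the sum over the blocks
  have hsumblocks : ∑ p ∈ blocks κ ri rs,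
      (Real.logb 2 rs.length - Real.logb 2 (classRuns κ ri p.1)) ≤
      ((partitionValues L).map (fun k => Real.logb 2 (L.length.choose k))).sum + n := by
    -- The `max` makes `F` nonnegative at every natural number, as needed to compare a sum over a
    -- subset with the sum over the list of all members. For ranks that occur it changes nothing.
    set F : ℕ → ℝ := fun c => classRuns κ ri c * max 0
      (Real.logb 2 rs.length - Real.logb 2 (classRuns κ ri c)) with hF
    have h1 : ∑ p ∈ blocks κ ri rs,
        (Real.logb 2 rs.length - Real.logb 2 (classRuns κ ri p.1)) ≤
        ∑ c ∈ (blocks κ ri rs).image Prod.fst, F c := by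
      have h2 := Finset.sum_comp (s := blocks κ ri rs)
        (fun c => max 0 (Real.logb 2 rs.length - Real.logb 2 (classRuns κ ri c))) Prod.fst
      refine (Finset.sum_le_sum fun p _ => le_max_right 0 _).trans (h2.le.trans ?_)
      refine Finset.sum_le_sum fun c _ => ?_
      rw [nsmul_eq_mul]
      refine mul_le_mul_of_nonneg_right ?_ (le_max_left _ _)
      have : ((blocks κ ri rs).filter (fun p => p.1 = c)).card ≤ classRuns κ ri c := by
        refine Finset.card_le_card_of_injOn Prod.snd ?_ ?_
        · intro p hp
          obtain ⟨hp', rfl⟩ := Finset.mem_filter.1 (Finset.mem_coe.1 hp)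
          obtain ⟨x, -, rfl⟩ := mem_blocks.1 hp'
          exact Finset.mem_coe.2 (Finset.mem_image_of_mem _ (by simp))
        · intro p hp q hq hpq
          have hp' := (Finset.mem_filter.1 (Finset.mem_coe.1 hp)).2
          have hq' := (Finset.mem_filter.1 (Finset.mem_coe.1 hq)).2
          exact Prod.ext (hp'.trans hq'.symm) hpq
      exact_mod_cast this
    have hFnn : ∀ c, 0 ≤ F c := fun c => by positivity
    set g : List α → ℕ := fun V => (V.head?.map (memberRank L)).getD 0 with hg
    have hgV : ∀ V ∈ outputPartition L, ∀ v ∈ V, memberRank L v = g V := by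
      intro V hV v hv
      cases V with
      | nil => simp at hv
      | cons w V => simpa [hg] using memberRank_eq L hV hv List.mem_cons_self
    have h2 := sum_le_sum_of_subset_toFinset F hFnn ((outputPartition L).map g)
      ((blocks κ ri rs).image Prod.fst) (fun c hc => by
        obtain ⟨p, hp, rfl⟩ := Finset.mem_image.1 hc
        obtain ⟨x, -, rfl⟩ := mem_blocks.1 hp
        obtain ⟨V, hV, hxV⟩ := hmember x
        exact List.mem_toFinset.2 (List.mem_map.2 ⟨V, hV, (hgV V hV _ hxV).symm⟩))
    have h3 : (((outputPartition L).map g).map F).sum ≤ ((partitionValues L).map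
        (fun k => Real.logb 2 (L.length.choose k) + (k : ℝ))).sum := by
      rw [partitionValues, List.map_map, List.map_map]
      refine List.sum_le_sum fun V hV => ?_
      obtain ⟨v, hv⟩ := List.exists_mem_of_ne_nil V (ne_nil_of_mem_outputPartition L hV)
      have hm := hclass V hV v hv
      rw [hgV V hV v hv] at hm
      simp only [Function.comp_apply, hF]
      obtain ⟨x, hx⟩ : ∃ x, a x = v := by
        have := (mem_flatten_outputPartition L).1 (List.mem_flatten.2 ⟨V, hV, hv⟩)
        rw [hflat, List.mem_ofFn] at this
        exact this
      have hb : (κ x, ri x) ∈ blocks κ ri rs :=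
        mem_blocks.2 ⟨x, by rw [d1]; exact List.mem_finRange x, rfl⟩
      have hc := hnode.classRuns_le hb
      have hκx : κ x = g V := by rw [hκdef, ← hgV V hV v hv, ← hx]
      rw [hκx] at hc
      have hnn : 0 ≤ Real.logb 2 rs.length - Real.logb 2 (classRuns κ ri (g V)) := by
        have := hnode.logb_classRuns_le hb
        rw [hκx] at this
        linarith
      rw [max_eq_right hnn]
      exact mul_logb_sub_le hc.1 hm (memberValue_le L V) (by omega) hρ
    -- The sum of the `m_i` is the number of blocks, and blocks are nonempty.
    have h4 : ((partitionValues L).map (fun k : ℕ => (k : ℝ))).sum ≤ n := by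
      have h5 : (partitionValues L).sum ≤ n := by
        rw [← length_blockSizes]
        refine (List.length_le_sum_of_one_le _ (blockSizes_pos L)).trans ?_
        rw [sum_blockSizes, hflat, List.length_ofFn]
      calc ((partitionValues L).map (fun k : ℕ => (k : ℝ))).sum = ((partitionValues L).sum : ℕ) := by
            rw [Nat.cast_list_sum]
        _ ≤ n := by exact_mod_cast h5
    rw [List.sum_map_add] at h3
    linarith
  have hpot : potential (6 * 4 ^ 60 + 8) κ ri rs ≤ (5 + 16 * (6 * 4 ^ 60 + 8)) * n +
      3 * (6 * 4 ^ 60 + 8) *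
        (((partitionValues L).map (fun k => Real.logb 2 (L.length.choose k))).sum + n) := by
    rw [potential]
    refine add_le_add ?_ (mul_le_mul_of_nonneg_left hsumblocks (by norm_num))
    have h1 : (rs.map (fun r => runPotential (8 * (6 * 4 ^ 60 + 8)) r.length)).sum ≤
        (rs.map (fun r => (5 + 2 * (8 * (6 * 4 ^ 60 + 8))) * (r.length : ℝ))).sum :=
      List.sum_le_sum fun r _ => runPotential_le (by norm_num) _
    have h2 : (rs.map (fun r => (r.length : ℝ))).sum = n := by
      have h3 : (rs.map List.length).sum = n := by
        rw [← List.length_flatten, d1, List.length_finRange]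
      have h4 : ((rs.map List.length).sum : ℝ) = n := by exact_mod_cast h3
      rw [← h4, Nat.cast_list_sum, List.map_map]
      rfl
    rw [List.sum_map_mul_left, h2] at h1
    linarith
  rw [List.length_finRange] at d4
  have d4' : ((detectRuns (List.finRange n)).cost a : ℝ) ≤ n := by exact_mod_cast d4
  rw [synergyBound_eq]
  have h1 := sum_map_logb_nonneg (blockSizes L) id
  have h2 := sum_map_logb_nonneg (partitionValues L) (fun k => L.length.choose k)
  have h3 : (0 : ℝ) ≤ n := by positivity
  simp only [id] at h1
  push_cast
  have hX : (0 : ℝ) ≤ 4 ^ 60 := by positivity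
  generalize (4 : ℝ) ^ 60 = X at *
  nlinarith [mul_nonneg hX h1, mul_nonneg hX h2, mul_nonneg hX h3]

end UpperBound


/-! ### Lower bounds for decision trees: connectivity and counting of leaves. -/

namespace Comp

variable {n : ℕ} {β : Type}

/-- The compared positions span few edges: some labelling is constant along all comparisons,
and takes at least `n - cost` values. -/
theorem exists_labelling {α : Type*} [LinearOrder α] (a : Fin n → α) (T : Comp n β) :
    ∃ f : Fin n → ℕ, n ≤ (Finset.univ.image f).card + T.cost a ∧
      ∀ b : Fin n → α, (∀ i j, f i = f j → compare (b i) (b j) = compare (a i) (a j)) →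
        T.eval b = T.eval a := by
  induction T with
  | ret x =>
    refine ⟨Fin.val, ?_, fun b _ => rfl⟩
    rw [Finset.card_image_of_injective _ Fin.val_injective]
    simp
  | query i j next ih =>
    obtain ⟨f, h1, h2⟩ := ih (compare (a i) (a j))
    -- The comparison merges the components of `i` and `j`, so it reduces the number of labels by at
    -- most one.
    refine ⟨fun x => if f x = f j then f i else f x, ?_, fun b hb => ?_⟩
    · have : (Finset.univ.image f).erase (f j) ⊆
          Finset.univ.image (fun x => if f x = f j then f i else f x) := by
        intro c hc
        rw [Finset.mem_erase, Finset.mem_image] at hc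
        obtain ⟨hc, x, -, rfl⟩ := hc
        exact Finset.mem_image.2 ⟨x, Finset.mem_univ _, if_neg hc⟩
      have h3 := Finset.card_le_card this
      have h4 := Finset.pred_card_le_card_erase (s := Finset.univ.image f) (a := f j)
      rw [cost]
      omega
    · have hij : compare (b i) (b j) = compare (a i) (a j) := hb i j (by simp)
      rw [eval, eval, hij]
      exact h2 b fun x y hxy => hb x y (by simp only [hxy])

/-- With two components left, lifting one of them, or all the others, by a large amount changes no
outcome of a comparison. The answer is the same in both cases, although `x` must come after `y` in
one and before it in the other. -/
theorem le_cost_of_sorts {T : Comp n (List (Fin n))} (hT : T.Sorts ℕ) (a : Fin n → ℕ) :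
    n ≤ T.cost a + 1 := by
  by_contra hlt
  obtain ⟨f, h1, h2⟩ := exists_labelling a T
  obtain ⟨c, hc, d, hd, hcd⟩ := Finset.one_lt_card.1
    (show 1 < (Finset.univ.image f).card by omega)
  obtain ⟨x, -, rfl⟩ := Finset.mem_image.1 hc
  obtain ⟨y, -, rfl⟩ := Finset.mem_image.1 hd
  set M := a x + a y + 1
  have hshift : ∀ p : ℕ → Prop, [DecidablePred p] → ∀ i j, f i = f j →
      compare (a i + if p (f i) then M else 0) (a j + if p (f j) then M else 0) =
        compare (a i) (a j) := by
    intro p _ i j hij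
    rw [hij]
    rcases lt_trichotomy (a i) (a j) with h | h | h
    · rw [compare_lt_iff_lt.2 h, compare_lt_iff_lt]; omega
    · rw [compare_eq_iff_eq.2 h, compare_eq_iff_eq]; omega
    · rw [compare_gt_iff_gt.2 h, compare_gt_iff_gt]; omega
  have e1 := h2 _ (hshift (fun c => c = f x))
  have e2 := h2 _ (hshift (fun c => c ≠ f x))
  obtain ⟨p1, s1⟩ := hT (fun i => a i + if f i = f x then M else 0)
  obtain ⟨p2, s2⟩ := hT (fun i => a i + if f i ≠ f x then M else 0)
  rw [e1] at p1 s1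
  rw [e2] at s2
  have hs := (List.pairwise_map.1 s1).and (List.pairwise_map.1 s2)
  have hx : x ∈ T.eval a := p1.symm.subset (List.mem_finRange x)
  have hy : y ∈ T.eval a := p1.symm.subset (List.mem_finRange y)
  have hxy : x ≠ y := by rintro rfl; exact hcd rfl
  obtain ⟨i, hi, rfl⟩ := List.mem_iff_getElem.1 hx
  obtain ⟨j, hj, rfl⟩ := List.mem_iff_getElem.1 hy
  rw [List.pairwise_iff_getElem] at hs
  rcases lt_trichotomy i j with h | h | h
  · have := (hs i j hi hj h).1
    rw [if_pos rfl, if_neg (Ne.symm hcd)] at this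
    omega
  · subst h
    exact hxy rfl
  · have := (hs j i hj hi h).2
    rw [if_pos (Ne.symm hcd), if_neg (by simp)] at this
    omega

/-- Only inputs in `F` are known to be cheap, so the ternary induction restricts `F` along each
branch and counts the answers that are reached from it. -/
theorem card_image_eval_le [DecidableEq β] {α : Type*} [LinearOrder α] (T : Comp n β)
    (F : Finset (Fin n → α)) (h : ℕ) (hF : ∀ a ∈ F, T.cost a ≤ h) :
    (F.image (fun a => T.eval a)).card ≤ 3 ^ h := by
  induction T generalizing F h with
  | ret x =>
    refine (Finset.card_le_card (t := {x}) fun y hy => ?_).trans ?_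
    · obtain ⟨a, -, rfl⟩ := Finset.mem_image.1 hy
      exact Finset.mem_singleton_self x
    · rw [Finset.card_singleton]
      exact Nat.one_le_pow _ _ (by norm_num)
  | query i j next ih =>
    rcases F.eq_empty_or_nonempty with rfl | ⟨a₀, ha₀⟩
    · simp
    cases h with
    | zero =>
      have := hF a₀ ha₀
      rw [cost] at this
      omega
    | succ h =>
      have key : ∀ o : Ordering, ((F.filter (fun a => compare (a i) (a j) = o)).image
          (fun a => (next o).eval a)).card ≤ 3 ^ h := by
        intro o
        refine ih o _ h fun a ha => ?_
        obtain ⟨haF, rfl⟩ := Finset.mem_filter.1 ha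
        have := hF a haF
        rw [cost] at this
        omega
      have hsub : F.image (fun a => eval a (query i j next)) ⊆
          ((F.filter (fun a => compare (a i) (a j) = Ordering.lt)).image
            (fun a => (next Ordering.lt).eval a)) ∪
          (((F.filter (fun a => compare (a i) (a j) = Ordering.eq)).image
            (fun a => (next Ordering.eq).eval a)) ∪
          ((F.filter (fun a => compare (a i) (a j) = Ordering.gt)).image
            (fun a => (next Ordering.gt).eval a))) := by
        intro y hy
        obtain ⟨a, ha, rfl⟩ := Finset.mem_image.1 hy
        have hmem : ∀ o, compare (a i) (a j) = o → eval a (query i j next) ∈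
            (F.filter (fun a => compare (a i) (a j) = o)).image (fun a => (next o).eval a) :=
          fun o ho => Finset.mem_image.2 ⟨a, Finset.mem_filter.2 ⟨ha, ho⟩, by rw [eval, ho]⟩
        rw [Finset.mem_union, Finset.mem_union]
        cases ho : compare (a i) (a j) with
        | lt => exact Or.inl (hmem _ ho)
        | eq => exact Or.inr (Or.inl (hmem _ ho))
        | gt => exact Or.inr (Or.inr (hmem _ ho))
      refine (Finset.card_le_card hsub).trans ((Finset.card_union_le _ _).trans ?_)
      have h1 := Finset.card_union_le
        ((F.filter (fun a => compare (a i) (a j) = Ordering.eq)).image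
            (fun a => (next Ordering.eq).eval a))
        ((F.filter (fun a => compare (a i) (a j) = Ordering.gt)).image
            (fun a => (next Ordering.gt).eval a))
      have h2 := key Ordering.lt
      have h3 := key Ordering.eq
      have h4 := key Ordering.gt
      rw [pow_succ]
      omega

end Comp

/-- The array formed by a list of runs. -/
def arrayOf (n : ℕ) (L : List (List ℕ)) : Fin n → ℕ := fun i => L.flatten.getD i 0

theorem ofFn_arrayOf {n : ℕ} {L : List (List ℕ)} (h : L.flatten.length = n) :
    List.ofFn (arrayOf n L) = L.flatten := by
  subst h
  refine List.ext_getElem (by simp) fun i h1 h2 => ?_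
  rw [List.getElem_ofFn, arrayOf, List.getD_eq_getElem _ _ h2]

/-- Among many arrays which consist of the same entries, cut into nonempty runs, there is one
that is expensive to sort. -/
theorem exists_card_le_pow_cost {n : ℕ} {T : Comp n (List (Fin n))} (hT : T.Sorts ℕ)
    (S : Finset (List (List ℕ))) (hS : S.Nonempty) (l₀ : List ℕ) (hl₀ : l₀.length = n)
    (hperm : ∀ L ∈ S, L.flatten.Perm l₀) (hne : ∀ L ∈ S, ∀ r ∈ L, r ≠ []) :
    ∃ L ∈ S, S.card ≤ 3 ^ T.cost (arrayOf n L) * 2 ^ n := by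
  obtain ⟨L₀, hL₀, hmax⟩ := S.exists_max_image (fun L => T.cost (arrayOf n L)) hS
  refine ⟨L₀, hL₀, ?_⟩
  have hlen : ∀ L ∈ S, L.flatten.length = n := fun L hL => by rw [(hperm L hL).length_eq, hl₀]
  have h1 := T.card_image_eval_le (S.image (arrayOf n)) (T.cost (arrayOf n L₀)) (fun a ha => by
    obtain ⟨L, hL, rfl⟩ := Finset.mem_image.1 ha
    exact hmax L hL)
  have h2 : (Finset.univ.image (fun c : Composition n => c.blocks)).card ≤ 2 ^ n := by
    refine Finset.card_image_le.trans ?_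
    rw [Finset.card_univ, composition_card]
    exact Nat.pow_le_pow_right (by norm_num) (Nat.sub_le _ _)
  refine le_trans ?_ (Nat.mul_le_mul h1 h2)
  rw [← Finset.card_product]
  -- All arrays have the same sorted sequence, so the sorting order determines the array. The
  -- lengths of the runs form a composition of `n` and determine the cuts; this gives the factor `2
  -- ^ n`.
  refine Finset.card_le_card_of_injOn (fun L => (T.eval (arrayOf n L), L.map List.length)) ?_ ?_
  · intro L hL
    have hL := Finset.mem_coe.1 hL
    refine Finset.mem_coe.2 (Finset.mem_product.2 ⟨?_, ?_⟩)
    · exact Finset.mem_image.2 ⟨arrayOf n L, Finset.mem_image_of_mem _ hL, rfl⟩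
    · refine Finset.mem_image.2 ⟨⟨L.map List.length, ?_, ?_⟩, Finset.mem_univ _, rfl⟩
      · intro i hi
        obtain ⟨r, hr, rfl⟩ := List.mem_map.1 hi
        exact List.length_pos_iff.2 (hne L hL r hr)
      · rw [← List.length_flatten, hlen L hL]
  · intro L hL L' hL' heq
    have hL := Finset.mem_coe.1 hL
    have hL' := Finset.mem_coe.1 hL'
    obtain ⟨he, hlens⟩ := Prod.mk.inj heq
    obtain ⟨p, s⟩ := hT (arrayOf n L)
    obtain ⟨p', s'⟩ := hT (arrayOf n L')
    rw [← he] at p' s'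
    have q : ∀ L ∈ S, ((T.eval (arrayOf n L)).map (arrayOf n L)).Perm l₀ := by
      intro L hL
      refine ((hT (arrayOf n L)).1.map _).trans ?_
      rw [← List.ofFn_eq_map, ofFn_arrayOf (hlen L hL)]
      exact hperm L hL
    have q1 := q L hL
    have q2 := q L' hL'
    rw [← he] at q2
    have hmap := (q1.trans q2.symm).eq_of_pairwise (fun _ _ _ _ h h' => le_antisymm h h') s s'
    have harr : arrayOf n L = arrayOf n L' := by
      funext i
      exact List.map_inj_left.1 hmap i (p.symm.subset (List.mem_finRange i))
    rw [List.eq_iff_flatten_eq]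
    exact ⟨by rw [← ofFn_arrayOf (hlen L hL), harr, ofFn_arrayOf (hlen L' hL')], hlens⟩


/-! ### Arrays in which the runs that contain each value are prescribed. -/

section Construction

/-- The sizes are handed out in order to the indices in `J`, and all other indices get zero; this
reproduces the order of the blocks within a member. -/
theorem exists_sizes_list {ι : Type*} [DecidableEq ι] (J : Finset ι) (js : List ι)
    (hjs : js.Nodup) (G : List ℕ) (hG : ∀ k ∈ G, 0 < k)
    (hlen : G.length = js.countP (fun j => decide (j ∈ J))) :
    ∃ z : ι → ℕ, (∀ j ∈ js, 0 < z j ↔ j ∈ J) ∧ (js.map z).filter (fun k => 0 < k) = G := by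
  induction js generalizing G with
  | nil => exact ⟨fun _ => 0, by simp, by simpa using (List.length_eq_zero_iff.1 hlen).symm⟩
  | cons j js ih =>
    rw [List.nodup_cons] at hjs
    have hupd : ∀ (z : ι → ℕ) (k : ℕ), js.map (Function.update z j k) = js.map z := fun z k =>
      List.map_congr_left fun i hi => Function.update_of_ne (by rintro rfl; exact hjs.1 hi) _ _
    have hupd' : ∀ (z : ι → ℕ) (k : ℕ), ∀ i ∈ js, Function.update z j k i = z i := fun z k i hi =>
      Function.update_of_ne (by rintro rfl; exact hjs.1 hi) _ _
    rw [List.countP_cons] at hlen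
    by_cases hj : j ∈ J
    · rw [if_pos (by simpa using hj)] at hlen
      match G, hG, hlen with
      | k :: G, hG, hlen =>
        have hk := hG k List.mem_cons_self
        obtain ⟨z, h1, h2⟩ := ih hjs.2 G (fun i hi => hG i (List.mem_cons_of_mem _ hi))
          (by simpa using hlen)
        refine ⟨Function.update z j k, fun i hi => ?_, ?_⟩
        · rcases List.mem_cons.1 hi with rfl | hi
          · simpa [hj] using hk
          · rw [hupd' z k i hi]; exact h1 i hi
        · rw [List.map_cons, hupd, Function.update_self,
            List.filter_cons_of_pos (by simpa using hk), h2]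
    · rw [if_neg (by simpa using hj)] at hlen
      obtain ⟨z, h1, h2⟩ := ih hjs.2 G hG hlen
      refine ⟨Function.update z j 0, fun i hi => ?_, ?_⟩
      · rcases List.mem_cons.1 hi with rfl | hi
        · simpa using hj
        · rw [hupd' z 0 i hi]; exact h1 i hi
      · rw [List.map_cons, hupd, Function.update_self, List.filter_cons_of_neg (by simp), h2]

theorem exists_sizes {ρ : ℕ} (J : Finset (Fin ρ)) (G : List ℕ) (hG : ∀ k ∈ G, 0 < k)
    (hlen : G.length = J.card) :
    ∃ z : Fin ρ → ℕ, (∀ j, 0 < z j ↔ j ∈ J) ∧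
      ((List.finRange ρ).map z).filter (fun k => 0 < k) = G := by
  obtain ⟨z, h1, h2⟩ := exists_sizes_list J (List.finRange ρ) (List.nodup_finRange ρ) G hG (by
    rw [hlen, List.countP_eq_length_filter, ← List.toFinset_card_of_nodup
      ((List.nodup_finRange ρ).filter _)]
    congr 1
    ext j
    simp)
  exact ⟨z, fun j => h1 j (List.mem_finRange j), h2⟩

variable {ρ : ℕ}

/-- The run in which the value `i < χ` occurs `z i` times. -/
def runOf (χ : ℕ) (z : ℕ → ℕ) : List ℕ := (List.range χ).flatMap (fun i => List.replicate (z i) i)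

/-- The runs in which the value `i < χ` occurs `Z i j` times in run `j`. -/
def runsOf (χ : ℕ) (Z : ℕ → Fin ρ → ℕ) : List (List ℕ) :=
  (List.finRange ρ).map (fun j => runOf χ (fun i => Z i j))

theorem mem_runOf {χ : ℕ} {z : ℕ → ℕ} {v : ℕ} : v ∈ runOf χ z ↔ v < χ ∧ 0 < z v := by
  simp only [runOf, List.mem_flatMap, List.mem_range, List.mem_replicate]
  constructor
  · rintro ⟨i, hi, h0, rfl⟩
    exact ⟨hi, Nat.pos_of_ne_zero h0⟩
  · rintro ⟨hi, h0⟩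
    exact ⟨v, hi, h0.ne', rfl⟩

theorem count_runOf (χ : ℕ) (z : ℕ → ℕ) (v : ℕ) :
    (runOf χ z).count v = if v < χ then z v else 0 := by
  induction χ with
  | zero => simp [runOf]
  | succ χ ih =>
    rw [runOf, List.range_succ, List.flatMap_append, List.count_append]
    rw [runOf] at ih
    rw [ih, List.flatMap_singleton, List.count_replicate]
    rcases lt_trichotomy v χ with h | rfl | h
    · simp [h, h.ne', h.trans (Nat.lt_succ_self χ)]
    · simp
    · simp [h.not_gt, h.ne, (Nat.succ_le_of_lt h).not_gt]

theorem sorted_runOf (χ : ℕ) (z : ℕ → ℕ) : (runOf χ z).Pairwise (· ≤ ·) := by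
  rw [runOf, List.pairwise_flatMap]
  refine ⟨fun i _ => List.pairwise_replicate.2 (Or.inr le_rfl), ?_⟩
  refine List.pairwise_lt_range.imp fun {i j} hij x hx y hy => ?_
  rw [(List.mem_replicate.1 hx).2, (List.mem_replicate.1 hy).2]
  exact hij.le

theorem holders_runsOf (χ : ℕ) (Z : ℕ → Fin ρ → ℕ) (v : ℕ) (j : Fin (runsOf χ Z).length) :
    j ∈ holders (runsOf χ Z) v ↔ v < χ ∧ 0 < Z v (j.cast (by simp [runsOf])) := by
  simp only [holders, Finset.mem_filter, Finset.mem_univ, true_and, List.get_eq_getElem]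
  have : (runsOf χ Z)[j.val] = runOf χ (fun i => Z i (j.cast (by simp [runsOf]))) := by
    simp only [runsOf, List.getElem_map, List.getElem_finRange]
    rfl
  rw [this, mem_runOf]

theorem card_holders_runsOf (χ : ℕ) (Z : ℕ → Fin ρ → ℕ) (v : ℕ) (hv : v < χ) :
    (holders (runsOf χ Z) v).card = (Finset.univ.filter (fun j => 0 < Z v j)).card := by
  have hl : (runsOf χ Z).length = ρ := by simp [runsOf]
  refine Finset.card_bij (fun j _ => j.cast hl) (fun j hj => ?_) (fun i _ j _ h => ?_)
    (fun j hj => ⟨j.cast hl.symm, ?_, ?_⟩)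
  · rw [holders_runsOf] at hj
    simpa using hj.2
  · exact Fin.cast_injective hl h
  · rw [holders_runsOf]
    simpa [hv] using hj
  · simp

theorem toFinset_runsOf {χ : ℕ} {Z : ℕ → Fin ρ → ℕ} (hZ : ∀ i < χ, ∃ j, 0 < Z i j) :
    (runsOf χ Z).flatten.toFinset = Finset.range χ := by
  ext v
  simp only [List.mem_toFinset, List.mem_flatten, runsOf, List.mem_map, List.mem_finRange,
    true_and, Finset.mem_range]
  constructor
  · rintro ⟨_, ⟨j, rfl⟩, hv⟩
    exact (mem_runOf.1 hv).1
  · intro hv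
    obtain ⟨j, hj⟩ := hZ v hv
    exact ⟨_, ⟨j, rfl⟩, mem_runOf.2 ⟨hv, hj⟩⟩

/-- By `hsep`, two neighbouring values never share a single run as their only one, so the partition
cuts everywhere. Interval members thus need not be constructed: one value with the right
multiplicity replaces the interval. -/
theorem outputPartition_runsOf {χ : ℕ} {Z : ℕ → Fin ρ → ℕ} (hZ : ∀ i < χ, ∃ j, 0 < Z i j)
    (hsep : ∀ i, i + 1 < χ → (∀ j, 0 < Z i j ↔ 0 < Z (i + 1) j) →
      (Finset.univ.filter (fun j => 0 < Z i j)).card ≠ 1) :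
    outputPartition (runsOf χ Z) = (List.range χ).map (fun i => [i]) := by
  rw [outputPartition, toFinset_runsOf hZ, List.splitBy_eq_iff]
  refine ⟨?_, by simp, by simp, ?_⟩
  · have h1 : ((List.range χ).map (fun i => [i])).flatten = List.range χ := by
      rw [← List.flatMap_def]
      exact List.flatMap_singleton' _
    rw [h1]
    refine List.Perm.eq_of_pairwise (fun _ _ _ _ h h' => le_antisymm h h')
      (Finset.pairwise_sort _ _) List.pairwise_le_range ?_
    rw [List.perm_ext_iff_of_nodup (Finset.sort_nodup _ _) List.nodup_range]
    simp
  · rw [List.isChain_map, List.isChain_range]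
    intro i hi
    refine ⟨by simp, by simp, ?_⟩
    refine decide_eq_false ?_
    rintro ⟨heq, hcard⟩
    simp only [List.getLast_singleton, List.head_cons] at heq hcard
    rw [card_holders_runsOf χ Z i (by omega)] at hcard
    refine hsep i (by omega) (fun j => ?_) hcard
    have hl : (runsOf χ Z).length = ρ := by simp [runsOf]
    have h1 := holders_runsOf χ Z i (j.cast hl.symm)
    have h2 := holders_runsOf χ Z (i + 1) (j.cast hl.symm)
    rw [heq, h2] at h1
    simpa [show i < χ by omega, show i + 1 < χ by omega] using h1.symm

theorem memberBlocks_runsOf {χ : ℕ} {Z : ℕ → Fin ρ → ℕ} {i : ℕ} (hi : i < χ) :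
    memberBlocks (runsOf χ Z) [i] =
      ((List.finRange ρ).map (Z i)).filter (fun k => 0 < k) := by
  rw [memberBlocks, runsOf, List.map_map]
  congr 1
  refine List.map_congr_left fun j _ => ?_
  have h := count_runOf χ (fun i => Z i j) i
  rw [if_pos hi] at h
  rw [← h, List.count]
  refine List.countP_congr fun x _ => ?_
  simp

theorem hasParameters_runsOf {χ : ℕ} {Z : ℕ → Fin ρ → ℕ} {G : List (List ℕ)} (hχ : G.length = χ)
    (hG : ∀ i (hi : i < G.length), ((List.finRange ρ).map (Z i)).filter (fun k => 0 < k) = G[i])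
    (hZ : ∀ i < χ, ∃ j, 0 < Z i j)
    (hsep : ∀ i, i + 1 < χ → (∀ j, 0 < Z i j ↔ 0 < Z (i + 1) j) →
      (Finset.univ.filter (fun j => 0 < Z i j)).card ≠ 1) :
    HasParameters (runsOf χ Z) ρ G.flatten (G.map List.length) := by
  subst hχ
  have hmap : (List.range G.length).map (fun i => memberBlocks (runsOf G.length Z) [i]) = G := by
    refine List.ext_getElem (by simp) fun i h1 h2 => ?_
    rw [List.getElem_map, List.getElem_range, memberBlocks_runsOf h2, hG i h2]
  refine ⟨by simp [runsOf], ?_, ?_⟩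
  · rw [blockSizes, outputPartition_runsOf hZ hsep, List.flatMap_map, List.flatMap_def, hmap]
  · rw [partitionValues, outputPartition_runsOf hZ hsep, List.map_map]
    conv_rhs => rw [← hmap, List.map_map]
    refine List.map_congr_left fun i _ => ?_
    simp only [Function.comp_apply, length_memberBlocks]

theorem sum_filter_pos (l : List ℕ) : (l.filter (fun k => 0 < k)).sum = l.sum := by
  induction l with
  | nil => rfl
  | cons k l ih =>
    by_cases h : 0 < k
    · rw [List.filter_cons_of_pos (by simpa using h), List.sum_cons, List.sum_cons, ih]
    · rw [List.filter_cons_of_neg (by simpa using h), List.sum_cons, ih]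
      omega

/-- The right-hand side depends on the block sizes only; hence all arrays of the family have the
same multiset of entries, as the counting argument requires. -/
theorem flatten_runsOf_perm {χ : ℕ} {Z : ℕ → Fin ρ → ℕ} {G : List (List ℕ)} (hχ : G.length = χ)
    (hG : ∀ i (hi : i < G.length), ((List.finRange ρ).map (Z i)).filter (fun k => 0 < k) = G[i]) :
    (runsOf χ Z).flatten.Perm (runOf χ (fun i => (G.getD i []).sum)) := by
  subst hχ
  rw [List.perm_iff_count]
  intro v
  rw [List.count_flatten, runsOf, List.map_map, count_runOf]
  have h1 : ∀ j ∈ List.finRange ρ, (List.count v ∘ fun j => runOf G.length fun i => Z i j) j =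
      if v < G.length then Z v j else 0 := fun j _ => by
    rw [Function.comp_apply, count_runOf]
  rw [List.map_congr_left h1]
  split_ifs with hv
  · rw [List.getD_eq_getElem _ _ hv, ← hG v hv, sum_filter_pos]
  · simp

theorem flatten_runsOf_length {χ : ℕ} {Z : ℕ → Fin ρ → ℕ} {G : List (List ℕ)} (hχ : G.length = χ)
    (hG : ∀ i (hi : i < G.length), ((List.finRange ρ).map (Z i)).filter (fun k => 0 < k) = G[i])
    (hZ : ∀ i < χ, ∃ j, 0 < Z i j)
    (hsep : ∀ i, i + 1 < χ → (∀ j, 0 < Z i j ↔ 0 < Z (i + 1) j) →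
      (Finset.univ.filter (fun j => 0 < Z i j)).card ≠ 1) :
    (runsOf χ Z).flatten.length = G.flatten.sum := by
  rw [← sum_blockSizes, (hasParameters_runsOf hχ hG hZ hsep).2.1]

theorem ne_nil_of_mem_runsOf {χ : ℕ} {Z : ℕ → Fin ρ → ℕ} (h : ∀ j, ∃ i < χ, 0 < Z i j) :
    ∀ r ∈ runsOf χ Z, r ≠ [] := by
  intro r hr
  obtain ⟨j, -, rfl⟩ := List.mem_map.1 hr
  obtain ⟨i, hi, hz⟩ := h j
  exact List.ne_nil_of_mem (mem_runOf.2 ⟨hi, hz⟩)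

theorem isRunDecomposition_runsOf {n χ : ℕ} {Z : ℕ → Fin ρ → ℕ} (h : ∀ j, ∃ i < χ, 0 < Z i j)
    (hn : (runsOf χ Z).flatten.length = n) :
    IsRunDecomposition (arrayOf n (runsOf χ Z)) (runsOf χ Z) := by
  refine ⟨(ofFn_arrayOf hn).symm, fun r hr => ⟨ne_nil_of_mem_runsOf h r hr, ?_⟩⟩
  obtain ⟨j, -, rfl⟩ := List.mem_map.1 hr
  exact sorted_runOf _ _

theorem isMaximalRunDecomposition_runsOf {n χ : ℕ} {Z : ℕ → Fin ρ → ℕ}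
    (h : ∀ j, ∃ i < χ, 0 < Z i j) (hn : (runsOf χ Z).flatten.length = n)
    (hdesc : ∀ j j' : Fin ρ, j'.val = j.val + 1 →
      ∃ i' i, i' < i ∧ i < χ ∧ 0 < Z i' j' ∧ 0 < Z i j) :
    IsMaximalRunDecomposition (arrayOf n (runsOf χ Z)) (runsOf χ Z) := by
  refine ⟨isRunDecomposition_runsOf h hn, ?_⟩
  rw [List.isChain_iff_getElem]
  intro k hk x hx y hy
  have hl : (runsOf χ Z).length = ρ := by simp [runsOf]
  have hget : ∀ (k : ℕ) (hk : k < (runsOf χ Z).length), (runsOf χ Z)[k] =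
      runOf χ (fun i => Z i ⟨k, by omega⟩) := by
    intro k hk
    simp only [runsOf, List.getElem_map, List.getElem_finRange]
    rfl
  rw [hget] at hx hy
  obtain ⟨i', i, hii, hi, h1, h2⟩ := hdesc ⟨k, by omega⟩ ⟨k + 1, by omega⟩ rfl
  have hix : i ≤ x := by
    have hm : i ∈ runOf χ (fun i => Z i ⟨k, by omega⟩) := mem_runOf.2 ⟨hi, h2⟩
    have hs := sorted_runOf χ (fun i => Z i ⟨k, by omega⟩)
    obtain ⟨l, hl⟩ := List.getLast?_eq_some_iff.1 hx
    rw [hl] at hm hs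
    rcases List.mem_append.1 hm with hm | hm
    · exact (List.pairwise_append.1 hs).2.2 i hm x (List.mem_singleton_self x)
    · exact (List.mem_singleton.1 hm).le
  have hiy : y ≤ i' := by
    have hm : i' ∈ runOf χ (fun i => Z i ⟨k + 1, by omega⟩) := mem_runOf.2 ⟨by omega, h1⟩
    have hs := sorted_runOf χ (fun i => Z i ⟨k + 1, by omega⟩)
    obtain ⟨l, hl⟩ := List.head?_eq_some_iff.1 hy
    rw [hl] at hm hs
    rcases List.mem_cons.1 hm with hm | hm
    · exact hm.ge
    · exact (List.pairwise_cons.1 hs).1 i' hm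
  omega

end Construction


/-! ### Counting sequences of sets of runs with prescribed sizes. -/

section Counting

/-- At least `N` elements have the property `P`. -/
def Many {β : Type*} (P : β → Prop) (N : ℝ) : Prop := ∃ S : Finset β, (∀ b ∈ S, P b) ∧ N ≤ S.card

theorem Many.mono {β : Type*} {P Q : β → Prop} {M N : ℝ} (h : Many P N) (hPQ : ∀ b, P b → Q b)
    (hMN : M ≤ N) : Many Q M := by
  obtain ⟨S, hS, hN⟩ := h
  exact ⟨S, fun b hb => hPQ b (hS b hb), hMN.trans hN⟩

theorem many_one {β : Type*} {P : β → Prop} {b : β} (hb : P b) : Many P 1 :=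
  ⟨{b}, fun c hc => by rwa [Finset.mem_singleton.1 hc], by simp⟩

theorem many_card {β : Type*} (S : Finset β) : Many (fun b => b ∈ S) S.card :=
  ⟨S, fun _ h => h, le_rfl⟩

/-- The product rule for choices made one after the other, where the later options may depend on the
earlier choice. -/
theorem Many.bind {β γ δ : Type*} {P : β → Prop} {Q : δ → Prop} {M N : ℝ} (f : β → γ → δ)
    (R : β → γ → Prop) (h : Many P M) (hN : 0 ≤ N) (hR : ∀ b, P b → Many (R b) N)
    (hQ : ∀ b c, P b → R b c → Q (f b c))
    (hf : ∀ b b' c c', P b → P b' → f b c = f b' c' → b = b' ∧ c = c') : Many Q (M * N) := by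
  classical
  obtain ⟨S, hS, hM⟩ := h
  choose! T hT hT' using hR
  refine ⟨(S.sigma T).image (fun x => f x.1 x.2), fun d hd => ?_, ?_⟩
  · obtain ⟨⟨b, c⟩, hbc, rfl⟩ := Finset.mem_image.1 hd
    rw [Finset.mem_sigma] at hbc
    exact hQ b c (hS b hbc.1) (hT b (hS b hbc.1) c hbc.2)
  · rw [Finset.card_image_of_injOn, Finset.card_sigma, Nat.cast_sum]
    · calc M * N ≤ S.card * N := mul_le_mul_of_nonneg_right hM hN
        _ = ∑ b ∈ S, N := by rw [Finset.sum_const, nsmul_eq_mul]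
        _ ≤ ∑ b ∈ S, ((T b).card : ℝ) := Finset.sum_le_sum fun b hb => hT' b (hS b hb)
    · rintro ⟨b, c⟩ hbc ⟨b', c'⟩ hbc' heq
      simp only [Finset.coe_sigma, Set.mem_sigma_iff, Finset.mem_coe] at hbc hbc'
      obtain ⟨rfl, rfl⟩ := hf b b' c c' (hS b hbc.1) (hS b' hbc'.1) heq
      rfl

variable {ρ : ℕ}

/-- The sets `Js` have the sizes `ms`, and no singleton among them equals its predecessor, which
is `P` for the first set. -/
def IsSpread (P : Finset (Fin ρ)) (ms : List ℕ) (Js : List (Finset (Fin ρ))) : Prop :=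
  Js.map Finset.card = ms ∧ (P :: Js).IsChain (fun J K => K.card = 1 → K ≠ J)

theorem IsSpread.cons {P J : Finset (Fin ρ)} {ms : List ℕ} {Js : List (Finset (Fin ρ))}
    (h : IsSpread J ms Js) (hJ : J.card = 1 → J ≠ P) : IsSpread P (J.card :: ms) (J :: Js) :=
  ⟨by rw [List.map_cons, h.1], List.isChain_cons_cons.2 ⟨hJ, h.2⟩⟩

theorem IsSpread.append {P : Finset (Fin ρ)} {ms ms' : List ℕ} {Js Js' : List (Finset (Fin ρ))}
    (h : IsSpread P ms Js) (h' : IsSpread (Js.getLastD P) ms' Js') :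
    IsSpread P (ms ++ ms') (Js ++ Js') := by
  induction Js generalizing P ms with
  | nil =>
    obtain rfl : ms = [] := by simpa using h.1.symm
    simpa using h'
  | cons J Js ih =>
    obtain ⟨h1, h2⟩ := h
    rw [List.map_cons] at h1
    subst h1
    rw [List.isChain_cons_cons] at h2
    rw [List.getLastD_cons] at h'
    exact (ih ⟨rfl, h2.2⟩ h').cons h2.1

/-- Every element of `U` is in one of the sets `Js`. -/
def Covers (U : Finset (Fin ρ)) (Js : List (Finset (Fin ρ))) : Prop := ∀ j ∈ U, ∃ J ∈ Js, j ∈ J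

/-- The factor by which the requirement to cover `u` elements reduces the number of choices. -/
noncomputable def coverLoss (ρ u : ℕ) : ℝ :=
  if u = 0 then 1 else (ρ : ℝ) ^ u / u.factorial * 2 ^ ρ

theorem coverLoss_pos {u : ℕ} (hρ : 0 < ρ) : 0 < coverLoss ρ u := by
  rw [coverLoss]
  split_ifs <;> positivity

theorem coverLoss_le (ρ u : ℕ) : coverLoss ρ u ≤ 8 ^ ρ := by
  rw [coverLoss]
  split_ifs
  · exact one_le_pow₀ (by norm_num)
  · have h1 : (ρ : ℝ) ^ u / u.factorial ≤ 4 ^ ρ := by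
      refine (Real.pow_div_factorial_le_exp (x := (ρ : ℝ)) (by positivity) u).trans ?_
      rw [← mul_one (ρ : ℝ), Real.exp_nat_mul]
      exact pow_le_pow_left₀ (Real.exp_pos _).le (by linarith [Real.exp_one_lt_d9]) _
    calc (ρ : ℝ) ^ u / u.factorial * 2 ^ ρ ≤ 4 ^ ρ * 2 ^ ρ :=
          mul_le_mul_of_nonneg_right h1 (by positivity)
      _ = 8 ^ ρ := by rw [← mul_pow]; norm_num

theorem choose_le_coverLoss {u : ℕ} (hu : 0 < u) (huρ : u ≤ ρ) (m : ℕ) :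
    (ρ.choose m : ℝ) ≤ coverLoss ρ u := by
  rw [coverLoss, if_neg hu.ne']
  have h1 : (1 : ℝ) ≤ (ρ : ℝ) ^ u / u.factorial := by
    rw [one_le_div (by positivity)]
    exact_mod_cast (Nat.factorial_le_pow u).trans (Nat.pow_le_pow_left huρ u)
  have h2 : (ρ.choose m : ℝ) ≤ 2 ^ ρ := by exact_mod_cast Nat.choose_le_two_pow ρ m
  nlinarith [pow_pos (two_pos : (0 : ℝ) < 2) ρ]

/-- This is why `coverLoss` contains `ρ ^ u / u!`: choosing `m` elements inside the uncovered set
instead of anywhere loses at most the ratio of consecutive values, since `ρ choose m ≤ ρ ^ m / m!`.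
-/
theorem choose_mul_coverLoss_le {u m : ℕ} (hu : 0 < u) (hm : m ≤ u) :
    (ρ.choose m : ℝ) * coverLoss ρ (u - m) ≤ u.choose m * coverLoss ρ u := by
  have h1 : coverLoss ρ (u - m) ≤ (ρ : ℝ) ^ (u - m) / (u - m).factorial * 2 ^ ρ := by
    rw [coverLoss]
    split_ifs with h
    · rw [h]
      simpa using one_le_pow₀ (one_le_two : (1 : ℝ) ≤ 2)
    · exact le_rfl
  have h2 : (ρ.choose m : ℝ) ≤ (ρ : ℝ) ^ m / m.factorial := Nat.choose_le_pow_div m ρ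
  have h3 : (u.choose m : ℝ) = u.factorial / (m.factorial * (u - m).factorial) :=
    Nat.cast_choose ℝ hm
  rw [h3, coverLoss.eq_1 ρ u, if_neg hu.ne']
  calc (ρ.choose m : ℝ) * coverLoss ρ (u - m)
      ≤ (ρ : ℝ) ^ m / m.factorial * ((ρ : ℝ) ^ (u - m) / (u - m).factorial * 2 ^ ρ) :=
        mul_le_mul h2 h1 (by rw [coverLoss]; split_ifs <;> positivity) (by positivity)
    _ = u.factorial / (m.factorial * (u - m).factorial) *
          ((ρ : ℝ) ^ u / u.factorial * 2 ^ ρ) := by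
        rw [← Nat.add_sub_cancel' hm, pow_add, Nat.add_sub_cancel_left]
        field_simp

/-- At most one set is forbidden, and only for `m = 1`. The condition `hP` excludes the case in
which it would be the only choice, namely `P = U` with one element. -/
theorem half_choose_le_card (P U : Finset (Fin ρ)) {m : ℕ} (hm : 1 ≤ m)
    (hP : P ∩ U = ∅ ∨ 2 ≤ U.card ∨ 2 ≤ P.card) :
    (U.card.choose m : ℝ) / 2 ≤
      (((U.powersetCard m).filter (fun J => J.card = 1 → J ≠ P)).card : ℝ) := by
  by_cases h : m = 1 ∧ P.card = 1 ∧ P ⊆ U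
  · obtain ⟨rfl, h1, hPU⟩ := h
    have hU : 2 ≤ U.card := by
      rcases hP with hP | hP | hP
      · rw [Finset.inter_eq_left.2 hPU] at hP
        simp [hP] at h1
      · exact hP
      · omega
    have h2 : (U.powersetCard 1).erase P ⊆
        (U.powersetCard 1).filter (fun J => J.card = 1 → J ≠ P) := by
      intro J hJ
      rw [Finset.mem_erase] at hJ
      exact Finset.mem_filter.2 ⟨hJ.2, fun _ => hJ.1⟩
    have h3 := Finset.card_le_card h2
    have h4 := Finset.pred_card_le_card_erase (s := U.powersetCard 1) (a := P)
    rw [Finset.card_powersetCard, Nat.choose_one_right] at h4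
    rw [Nat.choose_one_right]
    have h5 : (U.card : ℝ) ≤ 2 * (((U.powersetCard 1).filter
        (fun J => J.card = 1 → J ≠ P)).card : ℝ) := by
      exact_mod_cast (by omega : U.card ≤ 2 * ((U.powersetCard 1).filter
        (fun J => J.card = 1 → J ≠ P)).card)
    linarith
  · rw [Finset.filter_true_of_mem, Finset.card_powersetCard]
    · exact half_le_self (by positivity)
    · intro J hJ h1 hJP
      rw [Finset.mem_powersetCard] at hJ
      subst hJP
      exact h ⟨by omega, h1, hJ.1⟩

/-- Greedy covering: each set is chosen inside the uncovered rest as long as it fits, then one set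
is chosen to contain the rest, and all later ones are free. Avoiding the predecessor costs a factor
2 per set; covering costs `coverLoss` once. -/
theorem many_cover (hρ : 2 ≤ ρ) (ms : List ℕ) (hms : ∀ m ∈ ms, 1 ≤ m ∧ m ≤ ρ)
    (P U : Finset (Fin ρ)) (hU : U.card ≤ ms.sum)
    (hP : P ∩ U = ∅ ∨ 2 ≤ U.card ∨ 2 ≤ P.card) :
    Many (fun Js => IsSpread P ms Js ∧ Covers U Js)
      ((ms.map (fun m => (ρ.choose m : ℝ))).prod / (2 ^ ms.length * coverLoss ρ U.card)) := by
  induction ms generalizing P U with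
  | nil =>
    have hU0 : U = ∅ := by simpa using hU
    subst hU0
    refine (many_one (b := []) ⟨⟨rfl, by simp⟩, by simp [Covers]⟩).mono (fun _ h => h) ?_
    simp [coverLoss]
  | cons m ms ih =>
    obtain ⟨hm1, hmρ⟩ := hms m List.mem_cons_self
    have ih := ih (fun m hm => hms m (List.mem_cons_of_mem _ hm))
    have hcons : ∀ (H : Finset (Finset (Fin ρ))) (M N : ℝ), M ≤ H.card →
        0 ≤ N → (∀ J ∈ H, J.card = m ∧ (J.card = 1 → J ≠ P)) →
        (∀ J ∈ H, Many (fun Js => IsSpread J ms Js ∧ Covers (U \ J) Js) N) →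
        Many (fun Js => IsSpread P (m :: ms) Js ∧ Covers U Js) (M * N) := by
      intro H M N hM hN hH hmany
      refine ((many_card H).mono (fun _ h => h) hM).bind List.cons
        (fun J Js => IsSpread J ms Js ∧ Covers (U \ J) Js) hN hmany ?_ ?_
      · rintro J Js hJ ⟨h1, h2⟩
        have h3 := h1.cons (hH J hJ).2
        rw [(hH J hJ).1] at h3
        refine ⟨h3, fun j hj => ?_⟩
        by_cases hjJ : j ∈ J
        · exact ⟨J, List.mem_cons_self, hjJ⟩
        · obtain ⟨K, hK, hjK⟩ := h2 j (Finset.mem_sdiff.2 ⟨hj, hjJ⟩)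
          exact ⟨K, List.mem_cons_of_mem _ hK, hjK⟩
      · intro b b' c c' _ _ h
        exact List.cons.inj h
    set D := (ms.map (fun m => (ρ.choose m : ℝ))).prod with hD
    have hD0 : 0 ≤ D := List.prod_nonneg fun x hx => by
      obtain ⟨k, -, rfl⟩ := List.mem_map.1 hx
      positivity
    have hloss := fun u => coverLoss_pos (ρ := ρ) (u := u) (by omega)
    rw [List.map_cons, List.prod_cons, ← hD, List.length_cons, pow_succ]
    rcases Finset.eq_empty_or_nonempty U with rfl | hne
    · refine (hcons ((Finset.univ.powersetCard m).filter (fun J => J.card = 1 → J ≠ P))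
        (ρ.choose m / 2) (D / (2 ^ ms.length * coverLoss ρ 0)) ?_ (by
          have := hloss 0; positivity) ?_ ?_).mono (fun _ h => h) ?_
      · have := half_choose_le_card P Finset.univ hm1 (Or.inr (Or.inl (by simpa using hρ)))
        simpa using this
      · intro J hJ
        rw [Finset.mem_filter, Finset.mem_powersetCard] at hJ
        exact ⟨hJ.1.2, hJ.2⟩
      · intro J _
        simpa using ih J ∅ (by simp) (Or.inl (by simp))
      · apply le_of_eq
        rw [Finset.card_empty]
        have := (hloss 0).ne'
        field_simp
    have hu := hne.card_pos
    have huρ : U.card ≤ ρ := by simpa using Finset.card_le_univ U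
    rcases le_or_gt m U.card with hmu | hmu
    · refine (hcons ((U.powersetCard m).filter (fun J => J.card = 1 → J ≠ P))
        (U.card.choose m / 2) (D / (2 ^ ms.length * coverLoss ρ (U.card - m)))
        (half_choose_le_card P U hm1 hP) (by
          have := hloss (U.card - m); positivity) ?_ ?_).mono (fun _ h => h) ?_
      · intro J hJ
        rw [Finset.mem_filter, Finset.mem_powersetCard] at hJ
        exact ⟨hJ.1.2, hJ.2⟩
      · intro J hJ
        rw [Finset.mem_filter, Finset.mem_powersetCard] at hJ
        have hc : (U \ J).card = U.card - m := by
          rw [Finset.card_sdiff_of_subset hJ.1.1, hJ.1.2]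
        rw [← hc]
        -- The new predecessor `J` is disjoint from what remains to be covered, so the side
        -- condition holds even if a single element remains.
        refine ih J (U \ J) ?_ (Or.inl (Finset.inter_sdiff_self _ _))
        rw [List.sum_cons] at hU
        omega
      · have h1 := choose_mul_coverLoss_le (ρ := ρ) hu hmu
        have hp1 := hloss U.card
        have hp2 := hloss (U.card - m)
        rw [div_mul_div_comm, div_le_div_iff₀ (by positivity) (by positivity)]
        have h2 : 0 ≤ D * 2 ^ ms.length * 2 := by positivity
        nlinarith [mul_le_mul_of_nonneg_left h1 h2]
    -- One fixed set finishes the covering. Giving up its choices costs at most `2 ^ ρ`, the second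
    -- factor of `coverLoss`. It has at least two elements, so it may follow any predecessor.
    · obtain ⟨J, hUJ, hJ⟩ := Finset.exists_superset_card_eq hmu.le (by simpa using hmρ)
      refine (hcons {J} 1 (D / (2 ^ ms.length * coverLoss ρ 0)) (by simp) (by
          have := hloss 0; positivity) ?_ ?_).mono (fun _ h => h) ?_
      · intro K hK
        rw [Finset.mem_singleton.1 hK]
        exact ⟨hJ, fun h => by omega⟩
      · intro K hK
        rw [Finset.mem_singleton.1 hK, Finset.sdiff_eq_empty_iff_subset.2 hUJ]
        simpa using ih J ∅ (by simp) (Or.inl (by simp))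
      · have h1 := choose_le_coverLoss hu huρ m
        have hp1 := hloss U.card
        have h0 : coverLoss ρ 0 = 1 := by simp [coverLoss]
        rw [h0, one_mul, mul_one, div_le_div_iff₀ (by positivity) (by positivity)]
        have h2 : 0 ≤ D * 2 ^ ms.length := by positivity
        nlinarith [mul_le_mul_of_nonneg_left h1 h2, mul_nonneg h2 hp1.le]

theorem exists_split_sum (ms : List ℕ) (s : ℕ) (hs : 0 < s) (h : s ≤ ms.sum) :
    ∃ lo m hi, ms = lo ++ m :: hi ∧ lo.sum < s ∧ s ≤ lo.sum + m := by
  induction ms generalizing s with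
  | nil => simp at h; omega
  | cons k ms ih =>
    rw [List.sum_cons] at h
    rcases le_or_gt s k with hk | hk
    · exact ⟨[], k, ms, rfl, by simpa using hs, by simpa using hk⟩
    · obtain ⟨lo, m, hi, rfl, h1, h2⟩ := ih (s - k) (by omega) (by omega)
      exact ⟨k :: lo, m, hi, rfl, by rw [List.sum_cons]; omega, by rw [List.sum_cons]; omega⟩

theorem prod_choose_pos {ms : List ℕ} (hms : ∀ m ∈ ms, 1 ≤ m ∧ m ≤ ρ) :
    0 < (ms.map (fun m => (ρ.choose m : ℝ))).prod :=
  List.prod_pos fun x hx => by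
    obtain ⟨k, hk, rfl⟩ := List.mem_map.1 hx
    exact_mod_cast Nat.choose_pos (hms k hk).2

/-- The exponent `3 * ρ` would do; `7 * ρ` is the one of `many_descends`, so that both feed the same
conclusion. -/
theorem many_cover_univ (hρ : 2 ≤ ρ) (ms : List ℕ) (hms : ∀ m ∈ ms, 1 ≤ m ∧ m ≤ ρ)
    (hsum : ρ ≤ ms.sum) :
    Many (fun Js => IsSpread (∅ : Finset (Fin ρ)) ms Js ∧ Covers Finset.univ Js)
      ((ms.map (fun m => (ρ.choose m : ℝ))).prod / 2 ^ (ms.length + 7 * ρ)) := by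
  refine (many_cover hρ ms hms ∅ Finset.univ (by simpa using hsum) (Or.inl (by simp))).mono
    (fun _ h => h) ?_
  have h1 := coverLoss_pos (ρ := ρ) (u := (Finset.univ : Finset (Fin ρ)).card) (by omega)
  refine div_le_div_of_nonneg_left (prod_choose_pos hms).le (by positivity) ?_
  rw [pow_add, pow_mul]
  refine mul_le_mul_of_nonneg_left ((coverLoss_le _ _).trans ?_) (by positivity)
  exact pow_le_pow_left₀ (by norm_num) (by norm_num) _

/-- Every run contains an element that comes, in the order of the output, after some element
of the next run. -/
def Descends (Js : List (Finset (Fin ρ))) : Prop :=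
  ∀ j j' : Fin ρ, j'.val = j.val + 1 →
    ∃ l₁ l₂, Js = l₁ ++ l₂ ∧ (∃ J ∈ l₁, j' ∈ J) ∧ ∃ J ∈ l₂, j ∈ J

/-- Two independent coverings, at a cost of `8 ^ ρ` each, around a fixed middle part. By `hcard`,
the last set before the second covering cannot block its first choice. -/
theorem many_cover_append (hρ : 2 ≤ ρ) (lo mid hi : List ℕ)
    (hlo : ∀ m ∈ lo, 1 ≤ m ∧ m ≤ ρ) (hhi : ∀ m ∈ hi, 1 ≤ m ∧ m ≤ ρ) (Ks : List (Finset (Fin ρ)))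
    (hKs : ∀ P, IsSpread P mid Ks) (X Y : Finset (Fin ρ)) (hX : X.card ≤ lo.sum)
    (hY : Y.card ≤ hi.sum) (hcard : 2 ≤ Y.card ∨ ∃ K, Ks.getLast? = some K ∧ 2 ≤ K.card) :
    Many (fun Js => IsSpread ∅ (lo ++ (mid ++ hi)) Js ∧
        ∃ l₁ l₂, Js = l₁ ++ (Ks ++ l₂) ∧ Covers X l₁ ∧ Covers Y l₂)
      (((lo ++ hi).map (fun m => (ρ.choose m : ℝ))).prod /
        2 ^ ((lo ++ hi).length + 6 * ρ)) := by
  have hloss := fun u => coverLoss_pos (ρ := ρ) (u := u) (by omega)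
  have hp1 := prod_choose_pos hlo
  have hp2 := prod_choose_pos hhi
  have hlX := hloss X.card
  have hlY := hloss Y.card
  refine ((many_cover hρ lo hlo ∅ X hX (Or.inl (by simp))).bind
    (fun l₁ l₂ => l₁ ++ (Ks ++ l₂))
    (fun l₁ l₂ => IsSpread ((l₁ ++ Ks).getLastD ∅) hi l₂ ∧ Covers Y l₂) (by positivity)
    (fun l₁ h₁ => many_cover hρ hi hhi ((l₁ ++ Ks).getLastD ∅) Y hY ?_) ?_ ?_).mono
    (fun _ h => h) ?_
  · rcases hcard with h | ⟨K, hK, h⟩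
    · exact Or.inr (Or.inl h)
    · refine Or.inr (Or.inr ?_)
      rw [List.getLastD_eq_getLast?, List.getLast?_append, hK]
      exact h
  · rintro l₁ l₂ ⟨h1, h2⟩ ⟨h3, h4⟩
    refine ⟨h1.append ((hKs _).append ?_), l₁, l₂, rfl, h2, h4⟩
    convert h3 using 1
    rw [List.getLastD_eq_getLast?, List.getLastD_eq_getLast?, List.getLastD_eq_getLast?,
      List.getLast?_append]
    cases Ks.getLast? <;> rfl
  · rintro l₁ l₁' l₂ l₂' ⟨h1, -⟩ ⟨h1', -⟩ heq
    have hlen : l₁.length = l₁'.length := by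
      rw [← List.length_map (f := Finset.card), h1.1, ← h1'.1, List.length_map]
    obtain ⟨rfl, h2⟩ := List.append_inj heq hlen
    exact ⟨rfl, List.append_cancel_left h2⟩
  · rw [List.map_append, List.prod_append, div_mul_div_comm]
    refine div_le_div_of_nonneg_left (by positivity) (by positivity) ?_
    have h1 : coverLoss ρ X.card * coverLoss ρ Y.card ≤ 2 ^ (6 * ρ) := by
      calc coverLoss ρ X.card * coverLoss ρ Y.card ≤ 8 ^ ρ * 8 ^ ρ :=
            mul_le_mul (coverLoss_le _ _) (coverLoss_le _ _) hlY.le (by positivity)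
        _ = 2 ^ (6 * ρ) := by rw [← mul_pow, pow_mul]; norm_num
    calc 2 ^ lo.length * coverLoss ρ X.card * (2 ^ hi.length * coverLoss ρ Y.card)
        = 2 ^ (lo.length + hi.length) * (coverLoss ρ X.card * coverLoss ρ Y.card) := by
          rw [pow_add]; ring
      _ ≤ 2 ^ (lo.length + hi.length) * 2 ^ (6 * ρ) :=
          mul_le_mul_of_nonneg_left h1 (by positivity)
      _ = 2 ^ ((lo ++ hi).length + 6 * ρ) := by
          rw [List.length_append, pow_add _ (lo.length + hi.length)]

/-- The sequence is cut where the partial sums of the sizes reach `ρ`. If they hit `ρ` exactly, both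
parts can cover all runs. Otherwise the set at the cut is fixed, and serves both parts. -/
theorem many_descends (hρ : 2 ≤ ρ) (ms : List ℕ) (hms : ∀ m ∈ ms, 1 ≤ m ∧ m ≤ ρ)
    (hsum : 2 * ρ ≤ ms.sum) :
    Many (fun Js => IsSpread (∅ : Finset (Fin ρ)) ms Js ∧ Covers Finset.univ Js ∧ Descends Js)
      ((ms.map (fun m => (ρ.choose m : ℝ))).prod / 2 ^ (ms.length + 7 * ρ)) := by
  obtain ⟨lo, m, hi, rfl, h1, h2⟩ := exists_split_sum ms ρ (by omega) (by omega)
  have hlo : ∀ k ∈ lo, 1 ≤ k ∧ k ≤ ρ := fun k hk => hms k (by simp [hk])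
  have hhi : ∀ k ∈ hi, 1 ≤ k ∧ k ≤ ρ := fun k hk => hms k (by simp [hk])
  obtain ⟨hm1, hmρ⟩ := hms m (by simp)
  rw [List.sum_append, List.sum_cons] at hsum
  rcases h2.eq_or_lt with h2 | h2
  · have hlm : ∀ k ∈ lo ++ [m], 1 ≤ k ∧ k ≤ ρ := fun k hk => hms k (by
      rcases List.mem_append.1 hk with h | h
      · simp [h]
      · simp [List.mem_singleton.1 h])
    have hlist : lo ++ m :: hi = (lo ++ [m]) ++ hi := by simp
    refine (many_cover_append hρ (lo ++ [m]) [] hi hlm hhi []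
      (fun P => ⟨rfl, List.isChain_singleton _⟩) Finset.univ Finset.univ ?_ ?_
      (Or.inl (by simpa using hρ))).mono ?_ ?_
    · simp [List.sum_append]; omega
    · simp; omega
    · rintro Js ⟨h3, l₁, l₂, rfl, h4, h5⟩
      rw [List.nil_append] at h3 ⊢
      rw [hlist]
      refine ⟨h3, fun j _ => ?_, fun j j' _ => ⟨l₁, l₂, rfl, h4 j' (Finset.mem_univ _),
        h5 j (Finset.mem_univ _)⟩⟩
      obtain ⟨J, hJ, hj⟩ := h4 j (Finset.mem_univ _)
      exact ⟨J, List.mem_append_left _ hJ, hj⟩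
    · rw [hlist] at hms ⊢
      refine div_le_div_of_nonneg_left (prod_choose_pos hms).le (by positivity) ?_
      exact pow_le_pow_right₀ (by norm_num) (by omega)
  · set y := min hi.sum ρ with hy
    -- The early part covers the last runs and the late part the first ones, as far as their sizes
    -- allow. Since the total is at least `2 * ρ`, the set `K` of size `m` has room for all runs
    -- missed by either part.
    set X : Finset (Fin ρ) := Finset.univ.filter (fun j => ρ - lo.sum ≤ j.val) with hX
    set Y : Finset (Fin ρ) := Finset.univ.filter (fun j => j.val < y) with hY
    have hYc : Y.card = y := by
      rw [hY, Fin.card_filter_val_lt]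
      omega
    have hXc' : Xᶜ.card = ρ - lo.sum := by
      rw [hX, Finset.compl_filter]
      simp only [not_le]
      rw [Fin.card_filter_val_lt]
      omega
    have hXc : X.card = lo.sum := by
      have := Finset.card_add_card_compl X
      rw [Fintype.card_fin] at this
      omega
    have hYc' : Yᶜ.card = ρ - y := by rw [Finset.card_compl, hYc, Fintype.card_fin]
    have hKc : (Xᶜ ∪ Yᶜ).card ≤ m := by
      have := Finset.card_union_le Xᶜ Yᶜ
      omega
    obtain ⟨K, hK, hKm⟩ := Finset.exists_superset_card_eq hKc (by simpa using hmρ)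
    have hKX : ∀ j, j ∉ X → j ∈ K := fun j hj =>
      hK (Finset.mem_union_left _ (Finset.mem_compl.2 hj))
    have hKY : ∀ j, j ∉ Y → j ∈ K := fun j hj =>
      hK (Finset.mem_union_right _ (Finset.mem_compl.2 hj))
    refine (many_cover_append hρ lo [m] hi hlo hhi [K]
      (fun P => ⟨by simp [hKm], by simp; omega⟩) X Y hXc.le (by omega)
      (Or.inr ⟨K, rfl, by omega⟩)).mono ?_ ?_
    · rintro Js ⟨h3, l₁, l₂, rfl, h4, h5⟩
      have hlow : ∀ j, ∃ J ∈ l₁ ++ [K], j ∈ J := fun j => by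
        by_cases hj : j ∈ X
        · obtain ⟨J, hJ, hjJ⟩ := h4 j hj
          exact ⟨J, List.mem_append_left _ hJ, hjJ⟩
        · exact ⟨K, by simp, hKX j hj⟩
      refine ⟨h3, fun j _ => ?_, fun j j' hjj => ?_⟩
      · obtain ⟨J, hJ, hj⟩ := hlow j
        refine ⟨J, ?_, hj⟩
        rw [← List.append_assoc]
        exact List.mem_append_left _ hJ
      -- If `j` is covered late, the cut is made after `K`, as `K` and the early part together
      -- contain every `j'`. Otherwise `j` is in `K` and the cut is made before it: from `m ≤ ρ` the
      -- other sizes add up to at least `ρ`, which puts `j + 1` into `X`.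
      · by_cases hj : j ∈ Y
        · exact ⟨l₁ ++ [K], l₂, by simp, hlow j', h5 j hj⟩
        · refine ⟨l₁, [K] ++ l₂, rfl, h4 j' ?_, K, by simp, hKY j hj⟩
          have hj' := j'.isLt
          simp only [hY, Finset.mem_filter, Finset.mem_univ, true_and, not_lt] at hj
          simp only [hX, Finset.mem_filter, Finset.mem_univ, true_and]
          omega
    · have hp := prod_choose_pos hlo
      have hp' := prod_choose_pos hhi
      have hc : (ρ.choose m : ℝ) ≤ 2 ^ ρ := by exact_mod_cast Nat.choose_le_two_pow ρ m
      simp only [List.map_append, List.map_cons, List.prod_append, List.prod_cons,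
        List.length_append, List.length_cons]
      rw [div_le_div_iff₀ (by positivity) (by positivity)]
      have he : (2 : ℝ) ^ (lo.length + (hi.length + 1) + 7 * ρ) =
          2 * 2 ^ ρ * 2 ^ (lo.length + hi.length + 6 * ρ) := by ring
      rw [he]
      have hq : (0 : ℝ) < 2 ^ (lo.length + hi.length + 6 * ρ) := by positivity
      set A := (lo.map (fun m => (ρ.choose m : ℝ))).prod
      set B := (hi.map (fun m => (ρ.choose m : ℝ))).prod
      calc A * ((ρ.choose m : ℝ) * B) * 2 ^ (lo.length + hi.length + 6 * ρ)
          = (A * B * 2 ^ (lo.length + hi.length + 6 * ρ)) * ρ.choose m := by ring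
        _ ≤ (A * B * 2 ^ (lo.length + hi.length + 6 * ρ)) * (2 * 2 ^ ρ) :=
            mul_le_mul_of_nonneg_left (by linarith [pow_pos (two_pos : (0 : ℝ) < 2) ρ])
              (by positivity)
        _ = _ := by ring

end Counting


/-! ### From many sequences of sets to an expensive array. -/

section LowerBound

variable {ρ : ℕ}

/-- The value `i` is put into the runs of the `i`-th set, with the block sizes of the `i`-th member
as multiplicities. The predicate `Q` is carried along so that the same argument serves arbitrary and
maximal runs. -/
theorem exists_isRunDecomposition_of_many {n : ℕ} {T : Comp n (List (Fin n))} (hT : T.Sorts ℕ)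
    (G : List (List ℕ)) (hG : ∀ b ∈ G, 1 ≤ b.length ∧ ∀ k ∈ b, 0 < k) (hn : G.flatten.sum = n)
    (Q : List (Finset (Fin ρ)) → Prop) {N : ℝ} (hN : 0 < N)
    (hmany : Many (fun Js => IsSpread ∅ (G.map List.length) Js ∧ Covers Finset.univ Js ∧ Q Js) N) :
    ∃ L, HasParameters L ρ G.flatten (G.map List.length) ∧ IsRunDecomposition (arrayOf n L) L ∧
      ((∀ Js, Q Js → Descends Js) → IsMaximalRunDecomposition (arrayOf n L) L) ∧
      N ≤ 3 ^ T.cost (arrayOf n L) * 2 ^ n := by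
  obtain ⟨S, hS, hNS⟩ := hmany
  choose! z hz1 hz2 using
    fun (J : Finset (Fin ρ)) (b : List ℕ) (hb : ∀ k ∈ b, 0 < k) => exists_sizes J b hb
  set Z : List (Finset (Fin ρ)) → ℕ → Fin ρ → ℕ := fun Js i => z (Js.getD i ∅) (G.getD i []) with hZ
  have hlen : ∀ Js ∈ S, Js.length = G.length := fun Js hJs => by
    rw [← List.length_map (f := Finset.card), (hS Js hJs).1.1, List.length_map]
  have hcard : ∀ Js ∈ S, ∀ i (hi : i < G.length), (G.getD i []).length = (Js.getD i ∅).card := by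
    intro Js hJs i hi
    have h1 : i < Js.length := (hlen Js hJs).symm ▸ hi
    have h2 := (hS Js hJs).1.1
    rw [List.getD_eq_getElem _ _ hi, List.getD_eq_getElem _ _ h1,
      ← List.getElem_map List.length (h := by simpa using hi),
      ← List.getElem_map Finset.card (h := by simpa using h1)]
    simp only [h2]
  have hpos : ∀ i < G.length, ∀ k ∈ G.getD i [], 0 < k := fun i hi k hk => by
    rw [List.getD_eq_getElem _ _ hi] at hk
    exact (hG _ (List.getElem_mem hi)).2 k hk
  have hmem : ∀ Js ∈ S, ∀ i < G.length, ∀ j, 0 < Z Js i j ↔ j ∈ Js.getD i ∅ :=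
    fun Js hJs i hi => hz1 _ _ (hpos i hi) (hcard Js hJs i hi)
  have hsizes : ∀ Js ∈ S, ∀ i (hi : i < G.length),
      ((List.finRange ρ).map (Z Js i)).filter (fun k => 0 < k) = G[i] := fun Js hJs i hi => by
    rw [← List.getD_eq_getElem _ [] hi]
    exact hz2 _ _ (hpos i hi) (hcard Js hJs i hi)
  have hfilter : ∀ Js ∈ S, ∀ i < G.length,
      Finset.univ.filter (fun j => 0 < Z Js i j) = Js.getD i ∅ := fun Js hJs i hi => by
    ext j
    simp [hmem Js hJs i hi j]
  have hex : ∀ Js ∈ S, ∀ i < G.length, ∃ j, 0 < Z Js i j := by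
    intro Js hJs i hi
    have h1 := hcard Js hJs i hi
    have h2 := (hG _ (List.getElem_mem hi)).1
    rw [List.getD_eq_getElem _ _ hi] at h1
    obtain ⟨j, hj⟩ := Finset.card_pos.1 (show 0 < (Js.getD i ∅).card by omega)
    exact ⟨j, (hmem Js hJs i hi j).2 hj⟩
  have hsep : ∀ Js ∈ S, ∀ i, i + 1 < G.length → (∀ j, 0 < Z Js i j ↔ 0 < Z Js (i + 1) j) →
      (Finset.univ.filter (fun j => 0 < Z Js i j)).card ≠ 1 := by
    intro Js hJs i hi heq hc
    rw [hfilter Js hJs i (by omega)] at hc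
    have h1 : Js.getD i ∅ = Js.getD (i + 1) ∅ := by
      rw [← hfilter Js hJs i (by omega), ← hfilter Js hJs (i + 1) hi]
      exact Finset.filter_congr fun j _ => heq j
    have h2 := (hS Js hJs).1.2.tail
    rw [List.tail_cons, List.isChain_iff_getElem] at h2
    have hl := hlen Js hJs
    rw [h1] at hc
    rw [List.getD_eq_getElem _ _ (by omega : i < Js.length),
      List.getD_eq_getElem _ _ (by omega : i + 1 < Js.length)] at h1
    rw [List.getD_eq_getElem _ _ (by omega : i + 1 < Js.length)] at hc
    exact h2 i (by omega) hc h1.symm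
  have hcover : ∀ Js ∈ S, ∀ j, ∃ i < G.length, 0 < Z Js i j := by
    intro Js hJs j
    obtain ⟨J, hJ, hj⟩ := (hS Js hJs).2.1 j (Finset.mem_univ j)
    obtain ⟨i, hi, rfl⟩ := List.getElem_of_mem hJ
    have hi' : i < G.length := hlen Js hJs ▸ hi
    refine ⟨i, hi', (hmem Js hJs i hi' j).2 ?_⟩
    rwa [List.getD_eq_getElem _ _ hi]
  -- The sets are recovered from the runs, as `j` is in the `i`-th set if and only if the value `i`
  -- occurs in run `j`.
  have hinj : Set.InjOn (fun Js => runsOf G.length (Z Js)) S := by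
    intro Js hJs Ks hKs heq
    have hl := hlen Js hJs
    have hl' := hlen Ks hKs
    refine List.ext_getElem (hl.trans hl'.symm) fun i h1 h2 => ?_
    rw [← List.getD_eq_getElem _ ∅ h1, ← List.getD_eq_getElem _ ∅ h2]
    ext j
    have h3 := List.map_eq_map_iff.1 heq j (List.mem_finRange j)
    have h4 : i ∈ runOf G.length (fun i => Z Js i j) ↔ i ∈ runOf G.length (fun i => Z Ks i j) := by
      rw [h3]
    rw [mem_runOf, mem_runOf] at h4
    rw [← hmem Js hJs i (by omega), ← hmem Ks hKs i (by omega)]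
    simpa [show i < G.length by omega] using h4
  have hSne : S.Nonempty := Finset.card_pos.1 (by exact_mod_cast hN.trans_le hNS)
  have hflat : ∀ Js ∈ S, (runsOf G.length (Z Js)).flatten.length = n := fun Js hJs => by
    rw [flatten_runsOf_length rfl (hsizes Js hJs) (hex Js hJs) (hsep Js hJs), hn]
  have hperm : ∀ Js ∈ S, (runsOf G.length (Z Js)).flatten.Perm
      (runOf G.length (fun i => (G.getD i []).sum)) := fun Js hJs =>
    flatten_runsOf_perm rfl (hsizes Js hJs)
  obtain ⟨Js₀, hJs₀⟩ := hSne
  obtain ⟨L, hL, hcost⟩ := exists_card_le_pow_cost hT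
    (S.image (fun Js => runsOf G.length (Z Js))) ⟨_, Finset.mem_image_of_mem _ hJs₀⟩
    (runOf G.length (fun i => (G.getD i []).sum))
    (by rw [← (hperm Js₀ hJs₀).length_eq, hflat Js₀ hJs₀])
    (fun L hL => by
      obtain ⟨Js, hJs, rfl⟩ := Finset.mem_image.1 hL
      exact hperm Js hJs)
    (fun L hL => by
      obtain ⟨Js, hJs, rfl⟩ := Finset.mem_image.1 hL
      exact ne_nil_of_mem_runsOf (hcover Js hJs))
  obtain ⟨Js, hJs, rfl⟩ := Finset.mem_image.1 hL
  refine ⟨_, hasParameters_runsOf rfl (hsizes Js hJs) (hex Js hJs) (hsep Js hJs),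
    isRunDecomposition_runsOf (hcover Js hJs) (hflat Js hJs), fun hQ => ?_, ?_⟩
  · refine isMaximalRunDecomposition_runsOf (hcover Js hJs) (hflat Js hJs) fun j j' hjj => ?_
    obtain ⟨l₁, l₂, rfl, ⟨J, hJ, hj'⟩, K, hK, hj⟩ := hQ Js (hS Js hJs).2.2 j j' hjj
    obtain ⟨i', hi', rfl⟩ := List.getElem_of_mem hJ
    obtain ⟨i, hi, rfl⟩ := List.getElem_of_mem hK
    have hl := hlen _ hJs
    rw [List.length_append] at hl
    refine ⟨i', l₁.length + i, by omega, by omega, (hmem _ hJs i' (by omega) j').2 ?_,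
      (hmem _ hJs _ (by omega) j).2 ?_⟩
    · rwa [List.getD_append _ _ _ _ hi', List.getD_eq_getElem _ _ hi']
    · rwa [List.getD_append_right _ _ _ _ (by omega), Nat.add_sub_cancel_left,
        List.getD_eq_getElem _ _ hi]
  · rw [Finset.card_image_of_injOn hinj] at hcost
    exact hNS.trans (by exact_mod_cast hcost)

theorem sum_map_logb_le {g : List ℕ} (hg : ∀ k ∈ g, 0 < k) :
    (g.map (fun k : ℕ => Real.logb 2 (k : ℝ))).sum ≤ g.sum := by
  rw [Nat.cast_list_sum]
  exact List.sum_le_sum fun k hk => logb_two_le_self (by exact_mod_cast hg k hk)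

theorem logb_prod_choose {m : List ℕ} (hm : ∀ k ∈ m, k ≤ ρ) :
    Real.logb 2 (m.map (fun k => (ρ.choose k : ℝ))).prod =
      (m.map (fun k : ℕ => Real.logb 2 (ρ.choose k : ℝ))).sum := by
  have hpos : ∀ k ∈ m, (ρ.choose k : ℝ) ≠ 0 := fun k hk => by
    exact_mod_cast (Nat.choose_pos (hm k hk)).ne'
  induction m with
  | nil => simp
  | cons k m ih =>
    rw [List.map_cons, List.map_cons, List.prod_cons, List.sum_cons,
      Real.logb_mul (hpos k List.mem_cons_self), ih (fun i hi => hm i (List.mem_cons_of_mem _ hi))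
        (fun i hi => hpos i (List.mem_cons_of_mem _ hi))]
    refine List.prod_ne_zero fun h0 => ?_
    obtain ⟨i, hi, h⟩ := List.mem_map.1 h0
    exact hpos i (List.mem_cons_of_mem _ hi) h

/-- Both `m.length` and `ρ` are at most the number of blocks, hence at most `n`. So the logarithm of
the product is at most `2h + 9n`, and the whole bound at most `2h + 11n`, where `n ≤ 2h` because of
`2 ≤ n ≤ h + 1`. -/
theorem synergyBound_le_of_le_pow {n h : ℕ} {g m : List ℕ} (hn : 2 ≤ n) (hg : ∀ k ∈ g, 0 < k)
    (hsum : g.sum = n) (hlen : g.length = m.sum) (hm : ∀ k ∈ m, 1 ≤ k ∧ k ≤ ρ)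
    (hρ : ρ ≤ m.sum) (hh : n ≤ h + 1)
    (hle : (m.map (fun k => (ρ.choose k : ℝ))).prod / 2 ^ (m.length + 7 * ρ) ≤ 3 ^ h * 2 ^ n) :
    synergyBound n ρ g m ≤ 24 * h := by
  rw [synergyBound_eq, ← logb_prod_choose (fun k hk => (hm k hk).2)]
  have h1 := sum_map_logb_le hg
  have h2 : g.length ≤ n := hsum ▸ List.length_le_sum_of_one_le g hg
  have h3 : m.length ≤ m.sum := List.length_le_sum_of_one_le m fun k hk => (hm k hk).1
  have hp := prod_choose_pos hm
  rw [div_le_iff₀ (by positivity)] at hle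
  have h4 : (m.map (fun k => (ρ.choose k : ℝ))).prod ≤ 2 ^ (2 * h + 9 * n) := by
    calc _ ≤ (3 : ℝ) ^ h * 2 ^ n * 2 ^ (m.length + 7 * ρ) := hle
      _ ≤ 4 ^ h * 2 ^ n * 2 ^ (8 * n) := by
        refine mul_le_mul (mul_le_mul_of_nonneg_right ?_ (by positivity)) ?_ (by positivity)
          (by positivity)
        · exact pow_le_pow_left₀ (by norm_num) (by norm_num) _
        · exact pow_le_pow_right₀ (by norm_num) (by omega)
      _ = 2 ^ (2 * h + 9 * n) := by
        rw [show (4 : ℝ) = 2 ^ 2 by norm_num, ← pow_mul, ← pow_add, ← pow_add]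
        congr 1
        omega
  have h5 : Real.logb 2 (m.map (fun k => (ρ.choose k : ℝ))).prod ≤ 2 * h + 9 * n := by
    have := Real.logb_le_logb_of_le one_lt_two hp h4
    rw [Real.logb_pow, Real.logb_self_eq_one one_lt_two] at this
    push_cast at this
    linarith
  have h6 : (n : ℝ) ≤ 2 * h := by exact_mod_cast (by omega : n ≤ 2 * h)
  rw [hsum] at h1
  linarith

/-- With at most one run there is no choice of sets to count, but also no binomial coefficient above
1, so the linear lower bound suffices. -/
theorem synergyBound_le_of_le_one {n h : ℕ} {g m : List ℕ} (hn : 2 ≤ n) (hg : ∀ k ∈ g, 0 < k)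
    (hsum : g.sum = n) (hρ : ρ ≤ 1) (hh : n ≤ h + 1) : synergyBound n ρ g m ≤ 24 * h := by
  rw [synergyBound_eq]
  have h1 := sum_map_logb_le hg
  have h2 : (m.map (fun k : ℕ => Real.logb 2 (ρ.choose k : ℝ))).sum ≤ 0 := by
    refine (List.sum_le_card_nsmul _ 0 fun x hx => ?_).trans_eq (nsmul_zero _)
    obtain ⟨k, -, rfl⟩ := List.mem_map.1 hx
    refine Real.logb_nonpos one_lt_two (by positivity) ?_
    have : ρ.choose k ≤ 1 := by
      interval_cases ρ
      · rcases k with _ | k <;> simp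
      · rcases k with _ | _ | k <;> simp [Nat.choose_eq_zero_of_lt]
    exact_mod_cast this
  have h6 : (n : ℝ) ≤ 2 * h := by exact_mod_cast (by omega : n ≤ 2 * h)
  rw [hsum] at h1
  linarith

theorem sum_blockSizes_of_isRunDecomposition {n : ℕ} {a : Fin n → ℕ} {L : List (List ℕ)}
    (h : IsRunDecomposition a L) : (blockSizes L).sum = n := by
  rw [sum_blockSizes, h.1, List.length_ofFn]

theorem exists_synergyBound_le_cost {n : ℕ} {a₀ : Fin n → ℕ} {L₀ : List (List ℕ)} (hn : 2 ≤ n)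
    (h₀ : IsRunDecomposition a₀ L₀) {T : Comp n (List (Fin n))} (hT : T.Sorts ℕ)
    (Q : List (Finset (Fin L₀.length)) → Prop)
    (hmany : Many (fun Js => IsSpread ∅ (partitionValues L₀) Js ∧ Covers Finset.univ Js ∧ Q Js)
      (((partitionValues L₀).map (fun k => (L₀.length.choose k : ℝ))).prod /
        2 ^ ((partitionValues L₀).length + 7 * L₀.length))) :
    ∃ L, HasParameters L L₀.length (blockSizes L₀) (partitionValues L₀) ∧
      IsRunDecomposition (arrayOf n L) L ∧
      ((∀ Js, Q Js → Descends Js) → IsMaximalRunDecomposition (arrayOf n L) L) ∧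
      synergyBound n L₀.length (blockSizes L₀) (partitionValues L₀) ≤
        24 * (T.cost (arrayOf n L) : ℝ) := by
  have hm : ∀ k ∈ partitionValues L₀, 1 ≤ k ∧ k ≤ L₀.length := fun k => partitionValues_mem L₀
  have hflat : ((outputPartition L₀).map (memberBlocks L₀)).flatten = blockSizes L₀ := by
    rw [blockSizes, List.flatMap_def]
  have hlen : ((outputPartition L₀).map (memberBlocks L₀)).map List.length =
      partitionValues L₀ := by
    rw [List.map_map, partitionValues]
    exact List.map_congr_left fun V _ => length_memberBlocks L₀ V
  have hsum := sum_blockSizes_of_isRunDecomposition h₀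
  have hpos : ∀ b ∈ (outputPartition L₀).map (memberBlocks L₀), 1 ≤ b.length ∧ ∀ k ∈ b, 0 < k :=
    fun b hb => ⟨(hm _ (by rw [← hlen]; exact List.mem_map_of_mem hb)).1, fun k hk =>
      blockSizes_pos L₀ k (by rw [← hflat]; exact List.mem_flatten.2 ⟨b, hb, hk⟩)⟩
  rw [← hlen] at hmany
  obtain ⟨L, h1, h2, h3, h4⟩ := exists_isRunDecomposition_of_many hT
    ((outputPartition L₀).map (memberBlocks L₀)) hpos (by rw [hflat, hsum]) Q
    (div_pos (prod_choose_pos (by rwa [hlen])) (by positivity)) hmany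
  rw [hflat, hlen] at h1
  rw [hlen] at h4
  exact ⟨L, h1, h2, h3, synergyBound_le_of_le_pow hn (blockSizes_pos L₀) hsum
    (length_blockSizes L₀) hm (length_le_sum_partitionValues L₀ fun r hr => (h₀.2 r hr).1)
    (Comp.le_cost_of_sorts hT _) h4⟩

end LowerBound

theorem mainTheorem4 :
    -- Quick Synergy Sort sorts, within `O(n + ∑ log g_i + ∑ log (ρ choose m_i))` comparisons
    (∃ C : ℝ, 0 < C ∧ ∀ (n : ℕ) (α : Type*) [LinearOrder α],
      (quickSynergySort n).Sorts α ∧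
      ∀ (a : Fin n → α) (L : List (List α)) (ρ : ℕ) (g m : List ℕ),
        IsRunDecomposition a L → HasParameters L ρ g m →
        ((quickSynergySort n).cost a : ℝ) ≤ C * synergyBound n ρ g m) ∧
    -- every comparison-based sorting algorithm has a worst case of this order, over the arrays
    -- formed by runs with the given parameters
    (∃ c : ℝ, 0 < c ∧ ∀ (n ρ : ℕ) (g m : List ℕ), 2 ≤ n →
      (∃ (a : Fin n → ℕ) (L : List (List ℕ)), IsRunDecomposition a L ∧ HasParameters L ρ g m) →
      ∀ T : Comp n (List (Fin n)), T.Sorts ℕ →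
        ∃ (a : Fin n → ℕ) (L : List (List ℕ)), IsRunDecomposition a L ∧ HasParameters L ρ g m ∧
          c * synergyBound n ρ g m ≤ (T.cost a : ℝ)) ∧
    -- the same over the arrays whose maximal runs have the given parameters, if there are at
    -- least twice as many blocks as runs
    (∃ c : ℝ, 0 < c ∧ ∀ (n ρ : ℕ) (g m : List ℕ), 2 ≤ n → 2 * ρ ≤ g.length →
      (∃ (a : Fin n → ℕ) (L : List (List ℕ)),
        IsMaximalRunDecomposition a L ∧ HasParameters L ρ g m) →
      ∀ T : Comp n (List (Fin n)), T.Sorts ℕ →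
        ∃ (a : Fin n → ℕ) (L : List (List ℕ)),
          IsMaximalRunDecomposition a L ∧ HasParameters L ρ g m ∧
          c * synergyBound n ρ g m ≤ (T.cost a : ℝ)) := by
  refine ⟨⟨20 * (6 * 4 ^ 60 + 8), by norm_num, fun n α _ => ⟨quickSynergySort_sorts n α, ?_⟩⟩,
    ⟨1 / 24, by norm_num, ?_⟩, ⟨1 / 24, by norm_num, ?_⟩⟩
  · rintro a L _ _ _ h ⟨rfl, rfl, rfl⟩
    exact quickSynergySort_cost_le L a h
  · rintro n _ _ _ hn ⟨a₀, L₀, h₀, rfl, rfl, rfl⟩ T hT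
    have hρm := length_le_sum_partitionValues L₀ fun r hr => (h₀.2 r hr).1
    rcases le_or_gt L₀.length 1 with hρ | hρ
    · have := synergyBound_le_of_le_one (m := partitionValues L₀) hn (blockSizes_pos L₀)
        (sum_blockSizes_of_isRunDecomposition h₀) hρ (Comp.le_cost_of_sorts hT a₀)
      exact ⟨a₀, L₀, h₀, ⟨rfl, rfl, rfl⟩, by linarith⟩
    · obtain ⟨L, h1, h2, -, h3⟩ := exists_synergyBound_le_cost hn h₀ hT (fun _ => True)
        ((many_cover_univ hρ _ (fun k => partitionValues_mem L₀) hρm).mono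
          (fun _ h => ⟨h.1, h.2, trivial⟩) le_rfl)
      exact ⟨_, L, h2, h1, by linarith⟩
  · rintro n _ _ _ hn hδ ⟨a₀, L₀, h₀, rfl, rfl, rfl⟩ T hT
    rcases le_or_gt L₀.length 1 with hρ | hρ
    · have := synergyBound_le_of_le_one (m := partitionValues L₀) hn (blockSizes_pos L₀)
        (sum_blockSizes_of_isRunDecomposition h₀.1) hρ (Comp.le_cost_of_sorts hT a₀)
      exact ⟨a₀, L₀, h₀, ⟨rfl, rfl, rfl⟩, by linarith⟩
    · rw [length_blockSizes] at hδ
      obtain ⟨L, h1, -, h2, h3⟩ := exists_synergyBound_le_cost hn h₀.1 hT Descends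
        (many_descends hρ _ (fun k => partitionValues_mem L₀) hδ)
      exact ⟨_, L, h2 (fun _ h => h), h1, by linarith⟩
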